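/- **Setting.** Let $\mathcal H=\bigoplus_{d\in\mathbb Z}\mathcal H^d$ be a $\mathbb Z$-graded complex vector space (possibly infinite dimensional), $Q:\mathcal H\to\mathcal H$ linear of degree $1$ with $Q^2=0$, and $\omega:\mathcal H\otimes\mathcal H\to\mathbb C$ a nondegenerate skewsymmetric bilinear form of degree $-1$ (so $\omega(o,o')\neq0$ for homogeneous $o,o'$ only if $\deg o+\deg o'=1$; nondegenerate means that $\omega(x,\cdot)=0$ implies $x=0$). Let $H_Q=\ker Q/\operatorname{im}Q$ and let $A_n:H_Q^{\otimes n}\to\mathbb C$, $n\ge3$, be multilinear maps (the tree on-shell open string amplitudes). The data $(\mathcal H,\omega,Q,A)$ represent a fixed conformal background. In signs, $o$ stands for $\deg o$. **Theories.** A *classical open string field theory* on this background is a collection of multilinear maps $m_k:\mathcal H^{\otimes k}\to\mathcal H$ ($k\ge1$) of degree $1$ with $m_1=Q$ such that: 1. (cyclic action) $\omega(o_1,m_k(o_2,\dots,o_{k+1}))=(-1)^{o_2}\omega(o_2,m_k(o_3,\dots,o_{k+1},o_1))$ for all $k\ge1$ and homogeneous $o_i$; that is, $S=\frac12\omega(\Phi,Q\Phi)+\sum_{k\ge2}\frac1{k+1}\omega(\Phi,m_k(\Phi,\dots,\Phi))$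 is a cyclic function of the fields. 2. (classical BV master equation $(S,S)=0$) for all $n$ and homogeneous $o_1,\dots,o_n$, the sum over all cyclic permutations of $(o_1,\dots,o_n)$, with Koszul signs, of $\sum_{p+q=n,\ p,q\ge1}(-1)^{o_1+\cdots+o_p+1}\,\omega(m_p(o_1,\dots,o_p),m_q(o_{p+1},\dots,o_n))$ vanishes. 3. (properness) there is a decomposition $\mathcal H=\mathcal H_+\oplus\mathcal H_-$ into graded subspaces isotropic for $\omega$, and a degree-$0$ map $t:\mathcal H_-\to\mathcal H_+$ (extended by $0$ to $\mathcal H_+$) such that $T=1+t$ preserves $\omega$ and $Q=T^{-1}c_3T$, where $c_3:\mathcal H_+\to\mathcal H_-$ is the corresponding block of $Q$ (extended by $0$ to $\mathcal H_-$). 4. (amplitudes) for such a decomposition there are: a degree-$0$ projection $\pi_+$ of $\mathcal H_+$ onto $\ker c_3\cap\mathcal H_+$; a propagator, i.e. a degree $-1$ map $Q^+:\mathcal H_-\to\mathcal H_+$ (extended by $0$ to $\mathcal H_+$) with $Q^+c_3=1-\pi_+$ on $\mathcal H_+$, $\omega(c_3Q^+y,x)=\omega(y,(1-\pi_+)x)$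 for $y\in\mathcal H_-$, $x\in\mathcal H_+$, and $\pi_+Q^+=0$; and a gauge fixing field redefinition, i.e. a collection $n=\{n_k\}_{k\ge1}$ of degree-$1$ maps with $n_1=Q$ satisfying 1, and a cyclic $A_\infty$-morphism $\{f_k\}$ (defined below) from $n$ to $m$ with $f_1=1$ and, for $k\ge2$, $f_k$ taking values in $\mathcal H_-$ and depending only on the $\mathcal H_+$-components of its arguments (for instance $n=m$ and $f_k=0$ for $k\ge2$). With these, for all $k\ge2$ and $x_0,\dots,x_k\in\mathcal H^p$, where $\mathcal H^p$ is the set of $x\in\ker Q$ with $(1-QQ^+-Q^+Q)x=x$, and with $x_0$ homogeneous, $$(-1)^{x_0}\,\omega\Big(x_0,\sum_{\Gamma}\tilde n_\Gamma(x_1,\dots,x_k)\Big)=A_{k+1}([x_0],\dots,[x_k]).$$ Here $\Gamma$ runs over the rooted planar trees with $k$ leaves all of whose vertices have at least two incoming edges, and $\tilde n_\Gamma$ is obtained by putting $n_j$ at each vertex with $j$ incoming edges and $-Q^+$ at each internal edge. **Cyclic $A_\infty$-algebras and isomorphisms.** $(\mathcal H,\omega,m)$, with $m_k$ ($k\ge1$)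 of degree $1$, is a *cyclic $A_\infty$-algebra* if 1 holds and $\sum_{j\ge0,\ l\ge1,\ j+l\le n}(-1)^{o_1+\cdots+o_j}m_{n-l+1}(o_1,\dots,o_j,m_l(o_{j+1},\dots,o_{j+l}),o_{j+l+1},\dots,o_n)=0$ for all $n$ and homogeneous $o_i$. A *cyclic $A_\infty$-morphism* from $m$ to $m'$ is a collection of degree-$0$ multilinear maps $f_k:\mathcal H^{\otimes k}\to\mathcal H$, $k\ge1$, with $$\sum_{1\le k_1<\cdots<k_i=n}m'_i\big(f_{k_1}(o_1,\dots,o_{k_1}),\dots,f_{n-k_{i-1}}(o_{k_{i-1}+1},\dots,o_n)\big)=\sum_{j\ge0,\ l\ge1,\ j+l\le n}(-1)^{o_1+\cdots+o_j}f_{n-l+1}(o_1,\dots,o_j,m_l(o_{j+1},\dots,o_{j+l}),o_{j+l+1},\dots,o_n)$$ for all $n\ge 1$ and homogeneous $o_i$, $\omega(f_1(o),f_1(o'))=\omega(o,o')$, and $\sum_{k+l=n,\ k,l\ge1}\omega(f_k(o_1,\dots,o_k),f_l(o_{k+1},\dots,o_n))=0$ for all $n\ge3$. It is a *cyclic $A_\infty$-isomorphism*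 if $f_1$ is bijective. **Theorem.** Any two classical open string field theories $m,m'$ on the same conformal background $(\mathcal H,\omega,Q,A)$ are cyclic $A_\infty$-algebras and are cyclic $A_\infty$-isomorphic to each other. -/

import Mathlib

open scoped BigOperators

/-- A conformal background on the complex vector space `H`, as far as the algebra of an open
string field theory sees it: a `ℤ`-grading of the string state space `H`, the BRST operator `Q`
(a coboundary operator of degree one), and the BPZ inner product `ω` (an odd constant symplectic
structure: skewsymmetric, of degree minus one, nondegenerate).
`H` may be infinite dimensional. -/
structure ConformalBackground (H : Type*) [AddCommGroup H] [Module ℂ H] where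
  /-- `deg d` is the space of elements of degree `d`. -/
  deg : ℤ → Submodule ℂ H
  isInternal : DirectSum.IsInternal deg
  /-- The BRST operator. -/
  Q : H →ₗ[ℂ] H
  Q_deg : ∀ (d : ℤ), ∀ x ∈ deg d, Q x ∈ deg (d + 1)
  Q_sq : ∀ x, Q (Q x) = 0
  /-- The BPZ inner product. -/
  ω : H →ₗ[ℂ] H →ₗ[ℂ] ℂ
  ω_deg : ∀ (d e : ℤ), ∀ x ∈ deg d, ∀ y ∈ deg e, ω x y ≠ 0 → d + e = 1
  ω_skew : ∀ x y, ω y x = -ω x y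
  ω_nondeg : ∀ x, (∀ y, ω x y = 0) → x = 0

/-- A collection of multilinear maps `H^{⊗ k} → H`, one for each `k`. -/
abbrev MultiOps (H : Type*) [AddCommGroup H] [Module ℂ H] : Type _ :=
  (k : ℕ) → MultilinearMap ℂ (fun _ : Fin k => H) H

/-- `g.on [x₁, …, x_k] = g_k (x₁, …, x_k)`. -/
def MultiOps.on {H : Type*} [AddCommGroup H] [Module ℂ H] (g : MultiOps H) (l : List H) : H :=
  g l.length l.get

/-- `∑_i ∑_{1 ≤ k₁ < ⋯ < k_i = n} g_i (f_{k₁} (v₁, …), f_{k₂ - k₁} (…), …, f_{n - k_{i-1}} (…, v_n))`. -/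
def MultiOps.blockSum {H : Type*} [AddCommGroup H] [Module ℂ H] (g f : MultiOps H)
    {n : ℕ} (v : Fin n → H) : H :=
  ∑ c : Composition n, g c.length (fun i => f (c.blocksFun i) (v ∘ c.embedding i))

/-- Rooted planar trees with `n` leaves all of whose vertices have at least two incoming edges
(so at least three incident edges). A tree is either the tree without a vertex, or a root vertex
whose incoming edges carry, from left to right, trees that share out the leaves. -/
inductive PlanarTree : ℕ → Type
  | leaf : PlanarTree 1
  | node {n : ℕ} (c : Composition n) (hc : 2 ≤ c.length)
      (branch : (i : Fin c.length) → PlanarTree (c.blocksFun i)) : PlanarTree n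

theorem PlanarTree.finite (n : ℕ) : Finite (PlanarTree n) := by
  induction n using Nat.strong_induction_on with
  | _ n ih =>
    let S := Σ c : {c : Composition n // 2 ≤ c.length},
      ((i : Fin c.1.length) → PlanarTree (c.1.blocksFun i))
    have hS : Finite S := by
      have : ∀ c : {c : Composition n // 2 ≤ c.length},
          Finite ((i : Fin c.1.length) → PlanarTree (c.1.blocksFun i)) := by
        intro c
        have : ∀ i : Fin c.1.length, Finite (PlanarTree (c.1.blocksFun i)) := by
          intro i
          apply ih
          have hn : 0 < n := by
            have h1 := c.1.length_le
            have h2 := c.2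
            omega
          refine (Composition.ne_single_iff hn).1 ?_ i
          intro h
          have h2 := c.2
          rw [h, Composition.single_length] at h2
          omega
        infer_instance
      infer_instance
    by_cases h1 : n = 1
    · subst h1
      let φ : Option S → PlanarTree 1 := fun o => match o with
        | none => .leaf
        | some s => .node s.1.1 s.1.2 s.2
      refine Finite.of_surjective φ ?_
      intro t
      cases t with
      | leaf => exact ⟨none, rfl⟩
      | node c hc b => exact ⟨some ⟨⟨c, hc⟩, b⟩, rfl⟩
    · let φ : S → PlanarTree n := fun s => .node s.1.1 s.1.2 s.2
      refine Finite.of_surjective φ ?_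
      intro t
      cases t with
      | leaf => exact absurd rfl h1
      | node c hc b => exact ⟨⟨⟨c, hc⟩, b⟩, rfl⟩

noncomputable instance PlanarTree.instFintype (n : ℕ) : Fintype (PlanarTree n) :=
  haveI := PlanarTree.finite n
  Fintype.ofFinite _

namespace ConformalBackground

variable {H : Type*} [AddCommGroup H] [Module ℂ H]

/-- A homogeneous element together with its degree. -/
abbrev Homog (B : ConformalBackground H) : Type _ := Σ d : ℤ, B.deg d

/-- The underlying vectors of a list of homogeneous elements. -/
def vecs (B : ConformalBackground H) (l : List B.Homog) : List H :=
  l.map (fun o => (o.2 : H))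

/-- The sum of the degrees of a list of homogeneous elements. -/
def totalDeg (B : ConformalBackground H) (l : List B.Homog) : ℤ :=
  (l.map Sigma.fst).sum

/-- The maps `g_k` have degree `e`. -/
def HasDegree (B : ConformalBackground H) (e : ℤ) (g : MultiOps H) : Prop :=
  ∀ l : List B.Homog, g.on (B.vecs l) ∈ B.deg (B.totalDeg l + e)

/-- A linear operator of degree `e`. -/
def OpHasDegree (B : ConformalBackground H) (e : ℤ) (g : H →ₗ[ℂ] H) : Prop :=
  ∀ d : ℤ, ∀ x ∈ B.deg d, g x ∈ B.deg (d + e)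

/-! ### Cyclic `A∞`-algebras and cyclic `A∞`-isomorphisms -/

/-- For `l = (o₁, …, o_n)`, the sum over `j` and `b ≥ 1` of
`(-1)^{o₁ + ⋯ + o_j} g (o₁, …, o_j, m_b (o_{j+1}, …, o_{j+b}), o_{j+b+1}, …, o_n)`. -/
noncomputable def insertSum (B : ConformalBackground H) (g m : MultiOps H) (l : List B.Homog) : H :=
  ∑ j ∈ Finset.range l.length, ∑ b ∈ Finset.Icc 1 (l.length - j),
    (-1 : ℂ) ^ B.totalDeg (l.take j) •
      g.on (B.vecs (l.take j) ++ m.on (B.vecs ((l.drop j).take b)) :: B.vecs (l.drop (j + b)))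

/-- `ω (o₁, m_k (o₂, …, o_{k+1})) = (-1)^{o₂} ω (o₂, m_k (o₃, …, o_{k+1}, o₁))` for `k ≥ 1`. -/
def IsCyclic (B : ConformalBackground H) (m : MultiOps H) : Prop :=
  ∀ (o₁ o₂ : B.Homog) (l : List B.Homog),
    B.ω o₁.2 (m.on (B.vecs (o₂ :: l))) =
      (-1 : ℂ) ^ o₂.1 * B.ω o₂.2 (m.on (B.vecs (l ++ [o₁])))

/-- `(H, ω, m)` is a cyclic `A∞`-algebra. -/
structure IsCyclicAInfinity (B : ConformalBackground H) (m : MultiOps H) : Prop where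
  zero : m 0 = 0
  degree : B.HasDegree 1 m
  relation : ∀ l : List B.Homog, B.insertSum m m l = 0
  cyclic : B.IsCyclic m

/-- `f = {f_k}` is a cyclic `A∞`-morphism from `(H, ω, m)` to `(H, ω, m')`. -/
structure IsCyclicMorphism (B : ConformalBackground H) (m m' f : MultiOps H) : Prop where
  zero : f 0 = 0
  degree : B.HasDegree 0 f
  morphism : ∀ l : List B.Homog,
    m'.blockSum f (fun i : Fin l.length => ((l.get i).2 : H)) = B.insertSum f m l
  symplectic : ∀ x y : H, B.ω (f.on [x]) (f.on [y]) = B.ω x y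
  symplectic_higher : ∀ l : List H, 3 ≤ l.length →
    ∑ k ∈ Finset.Ico 1 l.length, B.ω (f.on (l.take k)) (f.on (l.drop k)) = 0

/-- The cyclic `A∞`-algebras `(H, ω, m)` and `(H, ω, m')` are cyclic `A∞`-isomorphic: there is
a cyclic `A∞`-morphism whose linear part `f₁` is an isomorphism. -/
def CyclicIsomorphic (B : ConformalBackground H) (m m' : MultiOps H) : Prop :=
  B.IsCyclicAInfinity m ∧ B.IsCyclicAInfinity m' ∧
    ∃ f : MultiOps H, B.IsCyclicMorphism m m' f ∧ Function.Bijective (fun x : H => f.on [x])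

/-! ### Actions and the classical master equation -/

/-- The maps `m_k` are the coefficients of an action
`S(Φ) = ½ ω(Φ, QΦ) + ∑_{k ≥ 2} (k+1)⁻¹ ω(Φ, m_k(Φ, …, Φ))` of degree zero which is a cyclic
function of the fields. Its vertices are
`V_{k+1}(o₁, …, o_{k+1}) = (-1)^{o₁} ω(o₁, m_k(o₂, …, o_{k+1}))`. -/
structure IsCyclicAction (B : ConformalBackground H) (m : MultiOps H) : Prop where
  zero : m 0 = 0
  kinetic : ∀ x : H, m.on [x] = B.Q x
  degree : B.HasDegree 1 m
  cyclic : B.IsCyclic m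

/-- The sum over `p + q = n`, `p, q ≥ 1`, of the contraction
`∑_{i,j} V_{q+1}(e_i, o_{p+1}, …, o_n) ω^{ij} V_{p+1}(o₁, …, o_p, e_j)` of two vertices of the
action with the inverse `ω^{ij}` of the symplectic form. Since the vertices are given by `ω` and
`m`, this contraction is
`(-1)^{o₁ + ⋯ + o_p + 1} ω(m_p(o₁, …, o_p), m_q(o_{p+1}, …, o_n))`, which needs no basis. -/
noncomputable def contraction (B : ConformalBackground H) (m : MultiOps H)
    (l : List B.Homog) : ℂ :=
  ∑ p ∈ Finset.Ico 1 l.length,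
    (-1 : ℂ) ^ (B.totalDeg (l.take p) + 1) *
      B.ω (m.on (B.vecs (l.take p))) (m.on (B.vecs (l.drop p)))

/-- The coefficient at `o₁, …, o_n` of the odd Poisson (BV) bracket `(S, S)`: the contraction
summed over all cyclic permutations of the arguments, with their Koszul signs. -/
noncomputable def bracketSS (B : ConformalBackground H) (m : MultiOps H)
    (l : List B.Homog) : ℂ :=
  ∑ r ∈ Finset.range l.length,
    (-1 : ℂ) ^ (B.totalDeg (l.take r) * B.totalDeg (l.drop r)) *
      B.contraction m (l.drop r ++ l.take r)

/-- The classical BV master equation `(S, S) = 0`. -/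
def MasterEquation (B : ConformalBackground H) (m : MultiOps H) : Prop :=
  ∀ l : List B.Homog, B.bracketSS m l = 0

/-! ### Gauge fixing, properness and the propagator -/

/-- A decomposition `H = H₊ ⊕ H₋` into two Lagrangian graded subspaces (the directions of the
fields and of the antifields), given by the projection `p` onto `H₊` along `H₋`. -/
structure IsFieldProjection (B : ConformalBackground H) (p : H →ₗ[ℂ] H) : Prop where
  degree : B.OpHasDegree 0 p
  idem : ∀ x, p (p x) = p x
  isotropic_fields : ∀ x y, B.ω (p x) (p y) = 0
  isotropic_antifields : ∀ x y, B.ω (x - p x) (y - p y) = 0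

/-- The block `c₃ : H₊ → H₋` of `Q`; the kinetic term in the gauge `φ* = 0`, that is on `H₊`,
is `ω(x, c₃ y)`. -/
def kineticBlock (B : ConformalBackground H) (p : H →ₗ[ℂ] H) : H →ₗ[ℂ] H :=
  (LinearMap.id - p) ∘ₗ B.Q ∘ₗ p

/-- Properness of an action with kinetic operator `Q`, in coordinates in which the gauge fixing is
`φ* = 0`: there is a symplectic `T = 1 + t` with `t : H₋ → H₊` and `Q = T⁻¹ c₃ T`. -/
def IsProper (B : ConformalBackground H) (p : H →ₗ[ℂ] H) : Prop :=
  ∃ t : H →ₗ[ℂ] H, B.OpHasDegree 0 t ∧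
    (∀ x, t (p x) = 0) ∧ (∀ x, p (t x) = t x) ∧
    (∀ x y, B.ω (x + t x) (y + t y) = B.ω x y) ∧
    B.Q = (LinearMap.id - t) ∘ₗ B.kineticBlock p ∘ₗ (LinearMap.id + t)

/-- The BV propagator of the gauge `φ* = 0`, as an operator `R = Q⁺ : H → H` of degree minus one
that maps `H₋` to `H₊` and `H₊` to zero. There is a projection `π` of `H₊` onto the kernel
of the gauge fixed kinetic term such that `R` inverts that term: `R c₃ = 1 - π` on `H₊`,
`c₃ R` is one minus the transpose of `π` on `H₋` (with respect to `ω`), and the kernel modes do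
not propagate. -/
def IsPropagator (B : ConformalBackground H) (p R : H →ₗ[ℂ] H) : Prop :=
  B.OpHasDegree (-1) R ∧ (∀ x, p (R x) = R x) ∧ (∀ x, R (p x) = 0) ∧
  ∃ π : H →ₗ[ℂ] H, B.OpHasDegree 0 π ∧ (∀ x, π (π x) = π x) ∧
    (∀ x, p (π x) = π x) ∧ (∀ x, π (p x) = π x) ∧
    (∀ x, B.kineticBlock p (π x) = 0) ∧
    (∀ x, R (B.kineticBlock p x) = p x - π x) ∧
    (∀ x y, B.ω (B.kineticBlock p (R y)) x = B.ω y (p x - π x)) ∧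
    (∀ x, π (R x) = 0)

/-- The field redefinition of a gauge fixing fermion `Ψ` of order at least three in the fields.
It replaces the gauge condition `φ* = ∂Ψ/∂φ` by `φ* = 0`: it is the identity plus the maps
`f_k : H₊^{⊗ k} → H₋` with `Ψ_{k+1}(o₁, …, o_{k+1}) = ± ω(o₁, f_k(o₂, …, o_{k+1}))`, and it turns
the action of `m` into the action of `n`. (A quadratic part of `Ψ` is absorbed into the choice of
`H₊` and `H₋`; `f_k = 0` for `k ≥ 2` is the case without higher terms.) -/
structure IsGaugeRedefinition (B : ConformalBackground H) (p : H →ₗ[ℂ] H)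
    (m n f : MultiOps H) : Prop where
  action : B.IsCyclicAction n
  linear_part : ∀ x : H, f.on [x] = x
  fields_only : ∀ l : List H, 2 ≤ l.length → f.on (l.map p) = f.on l
  antifields_only : ∀ l : List H, 2 ≤ l.length → p (f.on l) = 0
  morphism : B.IsCyclicMorphism n m f

/-! ### Tree on-shell amplitudes -/

/-- The operator of a rooted planar tree whose root edge is internal: `m_k` at each vertex with
`k` incoming edges and `-R` at each edge that leaves a vertex. -/
def edgeValue (m : MultiOps H) (R : H →ₗ[ℂ] H) :
    {n : ℕ} → PlanarTree n → (Fin n → H) → H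
  | _, .leaf, v => v 0
  | _, .node c _ branch, v =>
      -R (m c.length (fun i => edgeValue m R (branch i) (v ∘ c.embedding i)))

/-- The operator of a rooted planar tree whose root edge is external: `m_k` at each vertex with
`k` incoming edges and `-R` at each internal edge (and `m_1` for the tree without vertices). -/
def treeValue (m : MultiOps H) (R : H →ₗ[ℂ] H) :
    {n : ℕ} → PlanarTree n → (Fin n → H) → H
  | _, .leaf, v => m 1 v
  | _, .node c _ branch, v =>
      m c.length (fun i => edgeValue m R (branch i) (v ∘ c.embedding i))

/-- The BRST cohomology `ker Q / im Q`, the space of physical states. -/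
abbrev Cohomology (B : ConformalBackground H) : Type _ :=
  (LinearMap.ker B.Q) ⧸ (LinearMap.range B.Q).submoduleOf (LinearMap.ker B.Q)

/-- The projection `P = 1 - Q R - R Q` onto the on-shell states `H^p`. -/
def onShell (B : ConformalBackground H) (R : H →ₗ[ℂ] H) : H →ₗ[ℂ] H :=
  LinearMap.id - B.Q ∘ₗ R - R ∘ₗ B.Q

/-- The tree on-shell amplitudes computed from the vertices `m` and the propagator `R` are the
given maps `A_n` on physical states, for `n = k + 1 ≥ 3`. The amplitude of `x₁, …, x_n ∈ H^p`,
placed in this cyclic order at the external legs, is the sum over all planar tree Feynman graphs;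
each such graph is counted once, as a planar tree rooted at its first leg. The Koszul sign is that
of `ω ∘ (1 ⊗ m)`. -/
def AmplitudesEq (B : ConformalBackground H)
    (A : (n : ℕ) → MultilinearMap ℂ (fun _ : Fin n => B.Cohomology) ℂ)
    (m : MultiOps H) (R : H →ₗ[ℂ] H) : Prop :=
  ∀ (k : ℕ), 2 ≤ k → ∀ (x : Fin (k + 1) → LinearMap.ker B.Q),
    (∀ i, B.onShell R (x i) = x i) →
    ∀ d : ℤ, (x 0 : H) ∈ B.deg d →
      (-1 : ℂ) ^ d * B.ω (x 0) (∑ Γ : PlanarTree k, treeValue m R Γ (fun i => (x i.succ : H)))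
        = A (k + 1) (fun i => Submodule.Quotient.mk (x i))

/-- `m` is (the action of) a classical open string field theory on the conformal background
`(H, ω, Q)` with tree on-shell open string amplitudes `A_n` (`n ≥ 3`): the action is cyclic, it
solves the classical BV master equation, it is proper, and its perturbative expansion in some
gauge reproduces the amplitudes `A_n`. -/
structure IsClassicalOpenSFT (B : ConformalBackground H)
    (A : (n : ℕ) → MultilinearMap ℂ (fun _ : Fin n => B.Cohomology) ℂ)
    (m : MultiOps H) : Prop where
  action : B.IsCyclicAction m
  master : B.MasterEquation m
  proper_and_amplitudes : ∃ p : H →ₗ[ℂ] H, B.IsFieldProjection p ∧ B.IsProper p ∧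
    ∃ R : H →ₗ[ℂ] H, B.IsPropagator p R ∧
      ∃ n f : MultiOps H, B.IsGaugeRedefinition p m n f ∧ B.AmplitudesEq A n R

end ConformalBackground

open scoped BigOperators

noncomputable section

open scoped TensorProduct

namespace TensorCoalgebra

variable {H : Type*} [AddCommGroup H] [Module ℂ H]

/-- The product `x₁ ⊗ ⋯ ⊗ x_n` in the tensor algebra. -/
def word (l : List H) : TensorAlgebra ℂ H := (l.map (TensorAlgebra.ι ℂ)).prod

@[simp] theorem word_nil : word ([] : List H) = 1 := rfl

@[simp] theorem word_cons (x : H) (l : List H) :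
    word (x :: l) = TensorAlgebra.ι ℂ x * word l := by simp [word]

theorem word_append (l l' : List H) : word (l ++ l') = word l * word l' := by simp [word]

theorem word_singleton (x : H) : word [x] = TensorAlgebra.ι ℂ x := by simp [word]

theorem span_word : Submodule.span ℂ (Set.range (word (H := H))) = ⊤ := by
  rw [eq_top_iff]
  have h : (Subalgebra.toSubmodule (Algebra.adjoin ℂ
      (Set.range (TensorAlgebra.ι ℂ (M := H))))) = ⊤ := by
    rw [TensorAlgebra.adjoin_range_ι]; rfl
  rw [← h, Algebra.adjoin_eq_span]
  refine Submodule.span_mono ?_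
  intro t ht
  obtain ⟨L, hL, rfl⟩ := Submonoid.exists_list_of_mem_closure ht
  have : ∀ L : List (TensorAlgebra ℂ H), (∀ y ∈ L, y ∈ Set.range (TensorAlgebra.ι ℂ (M := H))) →
      ∃ l : List H, L.prod = word l := by
    intro L
    induction L with
    | nil => exact fun _ => ⟨[], rfl⟩
    | cons a L ih =>
      intro h
      obtain ⟨x, rfl⟩ := h a (by simp)
      obtain ⟨l, hl⟩ := ih (fun y hy => h y (by simp [hy]))
      exact ⟨x :: l, by simp [hl]⟩
  obtain ⟨l, hl⟩ := this L hL
  exact ⟨l, hl.symm⟩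

theorem word_induction {C : TensorAlgebra ℂ H → Prop} (word : ∀ l, C (word l))
    (zero : C 0) (add : ∀ a b, C a → C b → C (a + b)) (smul : ∀ (c : ℂ) a, C a → C (c • a))
    (t : TensorAlgebra ℂ H) : C t := by
  have ht : t ∈ Submodule.span ℂ (Set.range (TensorCoalgebra.word (H := H))) := by
    rw [span_word]; trivial
  induction ht using Submodule.span_induction with
  | mem x h => obtain ⟨l, rfl⟩ := h; exact word l
  | zero => exact zero
  | add x y _ _ hx hy => exact add x y hx hy
  | smul a x _ hx => exact smul a x hx

theorem ext_word {M : Type*} [AddCommGroup M] [Module ℂ M] {φ ψ : TensorAlgebra ℂ H →ₗ[ℂ] M}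
    (h : ∀ l, φ (word l) = ψ (word l)) : φ = ψ := by
  ext t
  induction t using word_induction with
  | word l => exact h l
  | zero => simp
  | add a b ha hb => simp [ha, hb]
  | smul c a ha => simp [ha]

/-! ### Linear maps out of the tensor algebra -/

/-- The linear map on the tensor algebra given by a multilinear map in each length. -/
def ofMultilinear {M : Type*} [AddCommGroup M] [Module ℂ M]
    (g : (n : ℕ) → MultilinearMap ℂ (fun _ : Fin n => H) M) : TensorAlgebra ℂ H →ₗ[ℂ] M :=
  (DirectSum.toModule ℂ ℕ M (fun n => PiTensorProduct.lift (g n))) ∘ₗ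
    TensorAlgebra.toDirectSum.toLinearMap

theorem tprod_get (l : List H) : TensorAlgebra.tprod ℂ H l.length l.get = word l := by
  rw [TensorAlgebra.tprod_apply, word, List.ofFn_comp' l.get (TensorAlgebra.ι ℂ), List.ofFn_get]

theorem tprod_eq_word {n : ℕ} (v : Fin n → H) :
    TensorAlgebra.tprod ℂ H n v = word (List.ofFn v) := by
  rw [TensorAlgebra.tprod_apply, word, List.ofFn_comp' v (TensorAlgebra.ι ℂ)]

theorem ofMultilinear_tprod {M : Type*} [AddCommGroup M] [Module ℂ M]
    (g : (n : ℕ) → MultilinearMap ℂ (fun _ : Fin n => H) M) {n : ℕ} (v : Fin n → H) :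
    ofMultilinear g (TensorAlgebra.tprod ℂ H n v) = g n v := by
  rw [ofMultilinear, LinearMap.comp_apply, AlgHom.toLinearMap_apply,
    TensorAlgebra.toDirectSum_tensorPower_tprod, ← DirectSum.lof_eq_of ℂ,
    DirectSum.toModule_lof, PiTensorProduct.lift.tprod]

theorem ofMultilinear_word {M : Type*} [AddCommGroup M] [Module ℂ M]
    (g : (n : ℕ) → MultilinearMap ℂ (fun _ : Fin n => H) M) (l : List H) :
    ofMultilinear g (word l) = g l.length l.get := by
  rw [← tprod_get, ofMultilinear_tprod]

/-- The linear map on the tensor algebra which is `S n` on words of length `n`. -/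
def glue {M : Type*} [AddCommGroup M] [Module ℂ M]
    (S : ℕ → TensorAlgebra ℂ H →ₗ[ℂ] M) : TensorAlgebra ℂ H →ₗ[ℂ] M :=
  ofMultilinear (fun n => (S n).compMultilinearMap (TensorAlgebra.tprod ℂ H n))

theorem glue_word {M : Type*} [AddCommGroup M] [Module ℂ M]
    (S : ℕ → TensorAlgebra ℂ H →ₗ[ℂ] M) (l : List H) :
    glue S (word l) = S l.length (word l) := by
  rw [glue, ofMultilinear_word, LinearMap.compMultilinearMap_apply, tprod_get]

/-- The projection of the tensor algebra onto the words of length one. -/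
def proj : TensorAlgebra ℂ H →ₗ[ℂ] H :=
  glue (fun n => if n = 1 then TensorAlgebra.ιInv else 0)

@[simp] theorem proj_one : proj (1 : TensorAlgebra ℂ H) = 0 := by
  rw [← word_nil, proj, glue_word]; simp

@[simp] theorem proj_ι (x : H) : proj (TensorAlgebra.ι ℂ x) = x := by
  rw [← word_singleton, proj, glue_word, word_singleton]
  simpa using TensorAlgebra.ι_leftInverse x

theorem proj_word (l : List H) (h : l.length ≠ 1) : proj (word l) = 0 := by
  rw [proj, glue_word, if_neg h]; rfl

theorem proj_mul (x y : H) (l : List H) :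
    proj (TensorAlgebra.ι ℂ x * (TensorAlgebra.ι ℂ y * word l)) = 0 := by
  rw [← word_cons, ← word_cons]; exact proj_word _ (by simp)

/-- The counit of the tensor coalgebra. -/
def counit : TensorAlgebra ℂ H →ₗ[ℂ] ℂ := TensorAlgebra.algebraMapInv.toLinearMap

@[simp] theorem counit_one : counit (1 : TensorAlgebra ℂ H) = 1 := by simp [counit]

@[simp] theorem counit_ι_mul (x : H) (t : TensorAlgebra ℂ H) :
    counit (TensorAlgebra.ι ℂ x * t) = 0 := by simp [counit, TensorAlgebra.algebraMapInv]

@[simp] theorem counit_ι (x : H) : counit (TensorAlgebra.ι ℂ x) = 0 := by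
  simp [counit, TensorAlgebra.algebraMapInv]

/-! ### The deconcatenation coproduct -/

/-- The algebra map `t ↦ !![t ⊗ 1, ∂ t; 0, 1 ⊗ t]` which encodes the deconcatenation coproduct. -/
def deconcMatrix : TensorAlgebra ℂ H →ₐ[ℂ]
    Matrix (Fin 2) (Fin 2) (TensorAlgebra ℂ H ⊗[ℂ] TensorAlgebra ℂ H) :=
  TensorAlgebra.lift ℂ
    { toFun := fun x => !![TensorAlgebra.ι ℂ x ⊗ₜ[ℂ] 1, TensorAlgebra.ι ℂ x ⊗ₜ[ℂ] 1;
        0, 1 ⊗ₜ[ℂ] TensorAlgebra.ι ℂ x]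
      map_add' := fun x y => by
        ext i j; fin_cases i <;> fin_cases j <;> simp [TensorProduct.add_tmul, TensorProduct.tmul_add]
      map_smul' := fun c x => by
        ext i j; fin_cases i <;> fin_cases j <;> simp [TensorProduct.smul_tmul'] }

/-- The deconcatenation coproduct of the tensor algebra. -/
def deconc : TensorAlgebra ℂ H →ₗ[ℂ] TensorAlgebra ℂ H ⊗[ℂ] TensorAlgebra ℂ H :=
  Matrix.entryLinearMap ℂ _ 0 1 ∘ₗ deconcMatrix.toLinearMap +
    Algebra.TensorProduct.includeRight.toLinearMap

@[simp] theorem deconc_one : deconc (1 : TensorAlgebra ℂ H) = 1 ⊗ₜ[ℂ] 1 := by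
  simp [deconc]

theorem deconcMatrix_apply_one_one (t : TensorAlgebra ℂ H) : deconcMatrix t 1 1 = 1 ⊗ₜ[ℂ] t := by
  induction t using word_induction with
  | word l =>
    induction l with
    | nil => simp; rfl
    | cons x l ih =>
      rw [word_cons, map_mul, Matrix.mul_apply, Fin.sum_univ_two, ih]
      simp [deconcMatrix]
  | zero => simp
  | add a b ha hb => simp [ha, hb, TensorProduct.tmul_add]
  | smul c a ha => simp [ha]

theorem deconc_ι_mul (x : H) (t : TensorAlgebra ℂ H) :
    deconc (TensorAlgebra.ι ℂ x * t) =
      (TensorAlgebra.ι ℂ x ⊗ₜ[ℂ] 1) * deconc t + 1 ⊗ₜ[ℂ] (TensorAlgebra.ι ℂ x * t) := by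
  have h : deconcMatrix (TensorAlgebra.ι ℂ x * t) 0 1 =
      (TensorAlgebra.ι ℂ x ⊗ₜ[ℂ] 1) * deconcMatrix t 0 1 +
      (TensorAlgebra.ι ℂ x ⊗ₜ[ℂ] 1) * (1 ⊗ₜ[ℂ] t) := by
    rw [map_mul, Matrix.mul_apply, Fin.sum_univ_two, deconcMatrix_apply_one_one]
    simp [deconcMatrix]
  simp only [deconc, LinearMap.add_apply, LinearMap.comp_apply, AlgHom.toLinearMap_apply,
    Matrix.entryLinearMap_apply, h, Algebra.TensorProduct.includeRight_apply, mul_add]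

theorem deconc_word (l : List H) : deconc (word l) =
    ∑ i ∈ Finset.range (l.length + 1), word (l.take i) ⊗ₜ[ℂ] word (l.drop i) := by
  induction l with
  | nil => simp
  | cons x l ih =>
    rw [word_cons, deconc_ι_mul, ih, Finset.sum_range_succ' _ (x :: l).length, Finset.mul_sum]
    simp

theorem deconc_mul (u v : TensorAlgebra ℂ H) :
    deconc (u * v) = deconc u * (1 ⊗ₜ[ℂ] v) + (u ⊗ₜ[ℂ] 1) * deconc v - u ⊗ₜ[ℂ] v := by
  induction u using word_induction with
  | word l =>
    induction l with
    | nil => simp [← Algebra.TensorProduct.one_def]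
    | cons x l ih =>
      rw [word_cons, mul_assoc, deconc_ι_mul, ih, deconc_ι_mul]
      simp only [add_mul, mul_add, mul_sub, ← mul_assoc, Algebra.TensorProduct.tmul_mul_tmul,
        one_mul, mul_one]
      abel
  | zero => simp
  | add a b ha hb =>
    simp only [add_mul, map_add, ha, hb, TensorProduct.add_tmul]; abel
  | smul c a ha =>
    simp only [smul_mul_assoc, map_smul, ha, ← TensorProduct.smul_tmul', smul_add, smul_sub]

/-! ### Convolution -/

section Convolution

variable {A : Type*} [Ring A] [Algebra ℂ A]

/-- The convolution product of linear maps from the tensor coalgebra to an algebra. -/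
def conv (φ ψ : TensorAlgebra ℂ H →ₗ[ℂ] A) : TensorAlgebra ℂ H →ₗ[ℂ] A :=
  LinearMap.mul' ℂ A ∘ₗ TensorProduct.map φ ψ ∘ₗ deconc

/-- The unit of the convolution product. -/
def convOne : TensorAlgebra ℂ H →ₗ[ℂ] A := Algebra.linearMap ℂ A ∘ₗ counit

theorem conv_one_apply (φ ψ : TensorAlgebra ℂ H →ₗ[ℂ] A) : conv φ ψ 1 = φ 1 * ψ 1 := by
  simp [conv]

theorem conv_word (φ ψ : TensorAlgebra ℂ H →ₗ[ℂ] A) (l : List H) : conv φ ψ (word l) =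
    ∑ i ∈ Finset.range (l.length + 1), φ (word (l.take i)) * ψ (word (l.drop i)) := by
  simp [conv, deconc_word]

theorem conv_ι_mul (φ ψ : TensorAlgebra ℂ H →ₗ[ℂ] A) (x : H) (t : TensorAlgebra ℂ H) :
    conv φ ψ (TensorAlgebra.ι ℂ x * t) =
      conv (φ ∘ₗ LinearMap.mulLeft ℂ (TensorAlgebra.ι ℂ x)) ψ t +
        φ 1 * ψ (TensorAlgebra.ι ℂ x * t) := by
  simp only [conv, LinearMap.comp_apply, deconc_ι_mul, map_add, TensorProduct.map_tmul,
    LinearMap.mul'_apply]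
  congr 1
  induction deconc t using TensorProduct.induction_on with
  | zero => simp
  | tmul a b => simp
  | add a b ha hb => simp only [mul_add, map_add, ha, hb]

theorem add_conv (φ φ' ψ : TensorAlgebra ℂ H →ₗ[ℂ] A) :
    conv (φ + φ') ψ = conv φ ψ + conv φ' ψ := by
  simp [conv, TensorProduct.map_add_left, LinearMap.add_comp, LinearMap.comp_add]

theorem conv_add (φ ψ ψ' : TensorAlgebra ℂ H →ₗ[ℂ] A) :
    conv φ (ψ + ψ') = conv φ ψ + conv φ ψ' := by
  simp [conv, TensorProduct.map_add_right, LinearMap.add_comp, LinearMap.comp_add]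

theorem smul_conv (c : ℂ) (φ ψ : TensorAlgebra ℂ H →ₗ[ℂ] A) :
    conv (c • φ) ψ = c • conv φ ψ := by
  simp [conv, TensorProduct.map_smul_left, LinearMap.smul_comp, LinearMap.comp_smul]

theorem neg_conv (φ ψ : TensorAlgebra ℂ H →ₗ[ℂ] A) : conv (-φ) ψ = -conv φ ψ := by
  refine ext_word fun l => ?_; simp [conv_word]

theorem conv_neg (φ ψ : TensorAlgebra ℂ H →ₗ[ℂ] A) : conv φ (-ψ) = -conv φ ψ := by
  refine ext_word fun l => ?_; simp [conv_word]

theorem sub_conv (φ φ' ψ : TensorAlgebra ℂ H →ₗ[ℂ] A) :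
    conv (φ - φ') ψ = conv φ ψ - conv φ' ψ := by
  rw [sub_eq_add_neg, add_conv, neg_conv, sub_eq_add_neg]

theorem conv_sub (φ ψ ψ' : TensorAlgebra ℂ H →ₗ[ℂ] A) :
    conv φ (ψ - ψ') = conv φ ψ - conv φ ψ' := by
  rw [sub_eq_add_neg, conv_add, conv_neg, sub_eq_add_neg]

theorem zero_conv (ψ : TensorAlgebra ℂ H →ₗ[ℂ] A) : conv 0 ψ = 0 := by
  simpa using smul_conv 0 0 ψ

@[simp] theorem convOne_apply_one : (convOne : TensorAlgebra ℂ H →ₗ[ℂ] A) 1 = 1 := by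
  simp [convOne]

@[simp] theorem convOne_ι_mul (x : H) (t : TensorAlgebra ℂ H) :
    (convOne : TensorAlgebra ℂ H →ₗ[ℂ] A) (TensorAlgebra.ι ℂ x * t) = 0 := by
  simp [convOne]

theorem convOne_comp_mulLeft (x : H) : (convOne : TensorAlgebra ℂ H →ₗ[ℂ] A) ∘ₗ
    LinearMap.mulLeft ℂ (TensorAlgebra.ι ℂ x) = 0 := by
  ext t; simp

theorem one_conv (φ : TensorAlgebra ℂ H →ₗ[ℂ] A) : conv convOne φ = φ := by
  refine ext_word fun l => ?_
  cases l with
  | nil => simp [conv_one_apply]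
  | cons x l => rw [word_cons, conv_ι_mul, convOne_comp_mulLeft, zero_conv]; simp

theorem conv_assoc (φ ψ χ : TensorAlgebra ℂ H →ₗ[ℂ] A) :
    conv (conv φ ψ) χ = conv φ (conv ψ χ) := by
  refine ext_word fun l => ?_
  induction l generalizing φ ψ with
  | nil => simp [conv_one_apply, mul_assoc]
  | cons x l ih =>
    have h : conv φ ψ ∘ₗ LinearMap.mulLeft ℂ (TensorAlgebra.ι ℂ x) =
        conv (φ ∘ₗ LinearMap.mulLeft ℂ (TensorAlgebra.ι ℂ x)) ψ +
          LinearMap.mulLeft ℂ (φ 1) ∘ₗ (ψ ∘ₗ LinearMap.mulLeft ℂ (TensorAlgebra.ι ℂ x)) := by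
      ext t; simp [conv_ι_mul]
    have h' : ∀ (a : A) (ψ' : TensorAlgebra ℂ H →ₗ[ℂ] A) (t : TensorAlgebra ℂ H),
        conv (LinearMap.mulLeft ℂ a ∘ₗ ψ') χ t = a * conv ψ' χ t := by
      intro a ψ' t
      induction t using word_induction with
      | word l => simp [conv_word, Finset.mul_sum, mul_assoc]
      | zero => simp
      | add a b ha hb => simp [ha, hb, mul_add]
      | smul c a ha => simp [ha]
    rw [word_cons, conv_ι_mul, conv_ι_mul, h, add_conv, LinearMap.add_apply, ih, h', conv_ι_mul,
      conv_one_apply, mul_add, add_assoc, mul_assoc]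

theorem algHom_comp_conv {A' : Type*} [Ring A'] [Algebra ℂ A'] (α : A →ₐ[ℂ] A')
    (φ ψ : TensorAlgebra ℂ H →ₗ[ℂ] A) :
    α.toLinearMap ∘ₗ conv φ ψ = conv (α.toLinearMap ∘ₗ φ) (α.toLinearMap ∘ₗ ψ) := by
  refine ext_word fun l => ?_
  simp [conv_word]

theorem algHom_comp_convOne {A' : Type*} [Ring A'] [Algebra ℂ A'] (α : A →ₐ[ℂ] A') :
    α.toLinearMap ∘ₗ (convOne : TensorAlgebra ℂ H →ₗ[ℂ] A) = convOne := by
  ext t; simp [convOne]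

theorem eq_zero_of_eq_conv {a χ : TensorAlgebra ℂ H →ₗ[ℂ] A} (ha : a 1 = 0)
    (h : χ = conv a χ) : χ = 0 := by
  refine ext_word fun l => ?_
  induction hn : l.length using Nat.strong_induction_on generalizing l with
  | _ n ih =>
    rw [h, conv_word, LinearMap.zero_apply]
    refine Finset.sum_eq_zero fun i _ => ?_
    by_cases hi : i = 0
    · subst hi; simp [ha]
    · by_cases hl : l.length = 0
      · have : l = [] := List.length_eq_zero_iff.1 hl
        subst this; simp [ha]
      · rw [ih (l.drop i).length (by rw [List.length_drop]; omega) _ rfl]; simp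

theorem eq_of_eq_add_conv {a c χ χ' : TensorAlgebra ℂ H →ₗ[ℂ] A} (ha : a 1 = 0)
    (h : χ = c + conv a χ) (h' : χ' = c + conv a χ') : χ = χ' := by
  rw [← sub_eq_zero]
  refine eq_zero_of_eq_conv ha ?_
  rw [conv_sub]
  nth_rw 1 [h, h']
  abel

end Convolution

end TensorCoalgebra

namespace TensorCoalgebra

variable {H : Type*} [AddCommGroup H] [Module ℂ H]

/-! ### Coalgebra morphisms -/

/-- A morphism of coaugmented coalgebras from the tensor coalgebra to itself. -/
structure IsCohom (F : TensorAlgebra ℂ H →ₗ[ℂ] TensorAlgebra ℂ H) : Prop where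
  deconc_comp : deconc ∘ₗ F = TensorProduct.map F F ∘ₗ deconc
  map_one : F 1 = 1
  counit_comp : counit ∘ₗ F = counit

/-- An `α`-twisted coderivation of the tensor coalgebra. -/
structure IsCoder (α D : TensorAlgebra ℂ H →ₗ[ℂ] TensorAlgebra ℂ H) : Prop where
  deconc_comp : deconc ∘ₗ D =
    (TensorProduct.map D LinearMap.id + TensorProduct.map α D) ∘ₗ deconc
  map_one : D 1 = 0
  counit_comp : counit ∘ₗ D = 0

section

variable {A : Type*} [Ring A] [Algebra ℂ A]

theorem IsCohom.conv_comp {F : TensorAlgebra ℂ H →ₗ[ℂ] TensorAlgebra ℂ H} (hF : IsCohom F)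
    (φ ψ : TensorAlgebra ℂ H →ₗ[ℂ] A) : conv φ ψ ∘ₗ F = conv (φ ∘ₗ F) (ψ ∘ₗ F) := by
  rw [conv, LinearMap.comp_assoc, LinearMap.comp_assoc, hF.deconc_comp, conv,
    TensorProduct.map_comp, LinearMap.comp_assoc]

theorem IsCohom.convOne_comp {F : TensorAlgebra ℂ H →ₗ[ℂ] TensorAlgebra ℂ H} (hF : IsCohom F) :
    (convOne : TensorAlgebra ℂ H →ₗ[ℂ] A) ∘ₗ F = convOne := by
  rw [convOne, LinearMap.comp_assoc, hF.counit_comp]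

theorem IsCoder.conv_comp {α D : TensorAlgebra ℂ H →ₗ[ℂ] TensorAlgebra ℂ H} (hD : IsCoder α D)
    (φ ψ : TensorAlgebra ℂ H →ₗ[ℂ] A) :
    conv φ ψ ∘ₗ D = conv (φ ∘ₗ D) ψ + conv (φ ∘ₗ α) (ψ ∘ₗ D) := by
  rw [conv, LinearMap.comp_assoc, LinearMap.comp_assoc, hD.deconc_comp, conv, conv,
    LinearMap.add_comp, LinearMap.comp_add, LinearMap.comp_add, TensorProduct.map_comp,
    ← LinearMap.comp_assoc deconc, ← TensorProduct.map_comp, LinearMap.comp_id,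
    LinearMap.comp_assoc]

theorem IsCoder.convOne_comp {α D : TensorAlgebra ℂ H →ₗ[ℂ] TensorAlgebra ℂ H}
    (hD : IsCoder α D) : (convOne : TensorAlgebra ℂ H →ₗ[ℂ] A) ∘ₗ D = 0 := by
  rw [convOne, LinearMap.comp_assoc, hD.counit_comp, LinearMap.comp_zero]

end

theorem isCohom_id : IsCohom (LinearMap.id : TensorAlgebra ℂ H →ₗ[ℂ] TensorAlgebra ℂ H) :=
  ⟨by simp, rfl, rfl⟩

theorem IsCohom.comp {F G : TensorAlgebra ℂ H →ₗ[ℂ] TensorAlgebra ℂ H} (hF : IsCohom F)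
    (hG : IsCohom G) : IsCohom (F ∘ₗ G) where
  deconc_comp := by
    rw [← LinearMap.comp_assoc, hF.deconc_comp, LinearMap.comp_assoc, hG.deconc_comp,
      ← LinearMap.comp_assoc, TensorProduct.map_comp]
  map_one := by simp [hG.map_one, hF.map_one]
  counit_comp := by rw [← LinearMap.comp_assoc, hF.counit_comp, hG.counit_comp]

theorem IsCohom.of_inverse {F G : TensorAlgebra ℂ H →ₗ[ℂ] TensorAlgebra ℂ H} (hF : IsCohom F)
    (hFG : F ∘ₗ G = LinearMap.id) (hGF : G ∘ₗ F = LinearMap.id) : IsCohom G where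
  deconc_comp := by
    have h : TensorProduct.map G G ∘ₗ (deconc ∘ₗ F) ∘ₗ G = TensorProduct.map G G ∘ₗ deconc := by
      rw [LinearMap.comp_assoc, hFG, LinearMap.comp_id]
    rw [← h, hF.deconc_comp, ← LinearMap.comp_assoc, ← LinearMap.comp_assoc,
      ← TensorProduct.map_comp, hGF, TensorProduct.map_id, LinearMap.id_comp]
  map_one := by
    have := LinearMap.congr_fun hGF 1
    rwa [LinearMap.comp_apply, hF.map_one] at this
  counit_comp := by
    rw [← hF.counit_comp, LinearMap.comp_assoc, hFG, LinearMap.comp_id, hF.counit_comp]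

theorem id_eq_conv : (LinearMap.id : TensorAlgebra ℂ H →ₗ[ℂ] TensorAlgebra ℂ H) =
    convOne + conv (TensorAlgebra.ι ℂ ∘ₗ proj) LinearMap.id := by
  refine ext_word fun l => ?_
  cases l with
  | nil => simp [conv_one_apply]
  | cons x l =>
    rw [LinearMap.add_apply, conv_word, Finset.sum_range_succ', Finset.sum_eq_single 0]
    · simp
    · intro i hi h0
      have hi := Finset.mem_range.1 hi
      rw [LinearMap.comp_apply, proj_word]
      · simp
      · simp only [List.length_take, List.length_cons] at hi ⊢; omega
    · simp

theorem IsCohom.eq_conv {F : TensorAlgebra ℂ H →ₗ[ℂ] TensorAlgebra ℂ H} (hF : IsCohom F) :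
    F = convOne + conv (TensorAlgebra.ι ℂ ∘ₗ (proj ∘ₗ F)) F := by
  nth_rw 1 [← LinearMap.id_comp F, id_eq_conv, LinearMap.add_comp, hF.convOne_comp, hF.conv_comp,
    LinearMap.id_comp, LinearMap.comp_assoc]

theorem IsCohom.ext {F G : TensorAlgebra ℂ H →ₗ[ℂ] TensorAlgebra ℂ H} (hF : IsCohom F)
    (hG : IsCohom G) (h : proj ∘ₗ F = proj ∘ₗ G) : F = G :=
  eq_of_eq_add_conv (a := TensorAlgebra.ι ℂ ∘ₗ (proj ∘ₗ F)) (by simp [hF.map_one]) hF.eq_conv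
    (by rw [h]; exact hG.eq_conv)

theorem IsCoder.eq_conv {α D : TensorAlgebra ℂ H →ₗ[ℂ] TensorAlgebra ℂ H} (hD : IsCoder α D) :
    D = conv (TensorAlgebra.ι ℂ ∘ₗ (proj ∘ₗ D)) LinearMap.id +
      conv (TensorAlgebra.ι ℂ ∘ₗ (proj ∘ₗ α)) D := by
  nth_rw 1 [← LinearMap.id_comp D, id_eq_conv, LinearMap.add_comp, hD.convOne_comp, hD.conv_comp,
    LinearMap.id_comp, LinearMap.comp_assoc, LinearMap.comp_assoc, zero_add]

/-- A linear map which is a coderivation along the morphisms `α`, `γ` vanishes if its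
corestriction does. -/
theorem eq_zero_of_coder {α γ C : TensorAlgebra ℂ H →ₗ[ℂ] TensorAlgebra ℂ H} (hα : α 1 = 1)
    (hC : deconc ∘ₗ C = (TensorProduct.map C γ + TensorProduct.map α C) ∘ₗ deconc)
    (hε : counit ∘ₗ C = 0) (h : proj ∘ₗ C = 0) : C = 0 := by
  refine eq_zero_of_eq_conv (a := TensorAlgebra.ι ℂ ∘ₗ (proj ∘ₗ α)) (by simp [hα]) ?_
  have h1 : ∀ φ ψ : TensorAlgebra ℂ H →ₗ[ℂ] TensorAlgebra ℂ H,
      conv φ ψ ∘ₗ C = conv (φ ∘ₗ C) (ψ ∘ₗ γ) + conv (φ ∘ₗ α) (ψ ∘ₗ C) := by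
    intro φ ψ
    rw [conv, LinearMap.comp_assoc, LinearMap.comp_assoc, hC, conv, conv,
      LinearMap.add_comp, LinearMap.comp_add, LinearMap.comp_add,
      TensorProduct.map_comp, TensorProduct.map_comp, LinearMap.comp_assoc, LinearMap.comp_assoc]
  nth_rw 1 [← LinearMap.id_comp C, id_eq_conv]
  rw [LinearMap.add_comp, h1, convOne, LinearMap.comp_assoc, hε,
    LinearMap.comp_assoc, h, LinearMap.comp_assoc]
  simp [zero_conv]

theorem map_sub_left (φ φ' ψ : TensorAlgebra ℂ H →ₗ[ℂ] TensorAlgebra ℂ H) :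
    TensorProduct.map (φ - φ') ψ = TensorProduct.map φ ψ - TensorProduct.map φ' ψ := by
  ext a b; simp [TensorProduct.sub_tmul]

theorem map_sub_right (φ ψ ψ' : TensorAlgebra ℂ H →ₗ[ℂ] TensorAlgebra ℂ H) :
    TensorProduct.map φ (ψ - ψ') = TensorProduct.map φ ψ - TensorProduct.map φ ψ' := by
  ext a b; simp [TensorProduct.tmul_sub]

theorem IsCoder.ext {α D D' : TensorAlgebra ℂ H →ₗ[ℂ] TensorAlgebra ℂ H} (hα : α 1 = 1)
    (hD : IsCoder α D) (hD' : IsCoder α D') (h : proj ∘ₗ D = proj ∘ₗ D') : D = D' := by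
  rw [← sub_eq_zero]
  refine eq_zero_of_coder (α := α) (γ := LinearMap.id) hα ?_ ?_ ?_
  · rw [LinearMap.comp_sub, hD.deconc_comp, hD'.deconc_comp, map_sub_left, map_sub_right,
      ← LinearMap.sub_comp]
    congr 1; abel
  · rw [LinearMap.comp_sub, hD.counit_comp, hD'.counit_comp, sub_zero]
  · rw [LinearMap.comp_sub, h, sub_self]

/-- The inclusion of the left factor. -/
abbrev inclL : TensorAlgebra ℂ H →ₐ[ℂ] TensorAlgebra ℂ H ⊗[ℂ] TensorAlgebra ℂ H :=
  Algebra.TensorProduct.includeLeft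

/-- The inclusion of the right factor. -/
abbrev inclR : TensorAlgebra ℂ H →ₐ[ℂ] TensorAlgebra ℂ H ⊗[ℂ] TensorAlgebra ℂ H :=
  Algebra.TensorProduct.includeRight

theorem map_comp_deconc (φ ψ : TensorAlgebra ℂ H →ₗ[ℂ] TensorAlgebra ℂ H) :
    TensorProduct.map φ ψ ∘ₗ deconc =
      conv (inclL.toLinearMap ∘ₗ φ) (inclR.toLinearMap ∘ₗ ψ) := by
  refine ext_word fun l => ?_
  simp [deconc_word, conv_word]

theorem deconc_eq_conv : (deconc : TensorAlgebra ℂ H →ₗ[ℂ] _) =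
    conv inclL.toLinearMap inclR.toLinearMap := by
  simpa using map_comp_deconc (H := H) LinearMap.id LinearMap.id

theorem deconc_comp_conv (φ ψ : TensorAlgebra ℂ H →ₗ[ℂ] TensorAlgebra ℂ H) :
    deconc ∘ₗ conv φ ψ = conv (deconc ∘ₗ φ) (inclR.toLinearMap ∘ₗ ψ) +
      conv (inclL.toLinearMap ∘ₗ φ) (deconc ∘ₗ ψ) -
      conv (inclL.toLinearMap ∘ₗ φ) (inclR.toLinearMap ∘ₗ ψ) := by
  refine ext_word fun l => ?_
  simp [conv_word, deconc_mul, Finset.sum_add_distrib, Finset.sum_sub_distrib]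

theorem deconc_comp_ι (f : TensorAlgebra ℂ H →ₗ[ℂ] H) :
    deconc ∘ₗ (TensorAlgebra.ι ℂ ∘ₗ f) = inclL.toLinearMap ∘ₗ (TensorAlgebra.ι ℂ ∘ₗ f) +
      inclR.toLinearMap ∘ₗ (TensorAlgebra.ι ℂ ∘ₗ f) := by
  ext t
  have := deconc_ι_mul (f t) 1
  simpa [← Algebra.TensorProduct.one_def] using this

/-- The convolution powers of `f`. -/
def convPow (f : TensorAlgebra ℂ H →ₗ[ℂ] H) : ℕ → TensorAlgebra ℂ H →ₗ[ℂ] TensorAlgebra ℂ H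
  | 0 => convOne
  | k + 1 => conv (TensorAlgebra.ι ℂ ∘ₗ f) (convPow f k)

theorem convPow_word {f : TensorAlgebra ℂ H →ₗ[ℂ] H} (hf : f 1 = 0) (k : ℕ) (l : List H)
    (h : l.length < k) : convPow f k (word l) = 0 := by
  induction k generalizing l with
  | zero => omega
  | succ k ih =>
    rw [convPow, conv_word]
    refine Finset.sum_eq_zero fun i _ => ?_
    by_cases hi : i = 0
    · subst hi; simp [hf]
    · by_cases hl : l.length = 0
      · have : l = [] := List.length_eq_zero_iff.1 hl
        subst this; simp [hf]
      · rw [ih _ (by rw [List.length_drop]; omega), mul_zero]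

/-- The coalgebra morphism with corestriction `f`. -/
def cohom (f : TensorAlgebra ℂ H →ₗ[ℂ] H) : TensorAlgebra ℂ H →ₗ[ℂ] TensorAlgebra ℂ H :=
  glue (fun n => ∑ k ∈ Finset.range (n + 1), convPow f k)

theorem cohom_word {f : TensorAlgebra ℂ H →ₗ[ℂ] H} (hf : f 1 = 0) (l : List H) (N : ℕ)
    (h : l.length ≤ N) :
    cohom f (word l) = ∑ k ∈ Finset.range (N + 1), convPow f k (word l) := by
  rw [cohom, glue_word, LinearMap.sum_apply]
  refine Finset.sum_subset (Finset.range_mono (by omega)) fun k _ hk => ?_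
  exact convPow_word hf _ _ (by simpa using hk)

theorem cohom_eq_conv {f : TensorAlgebra ℂ H →ₗ[ℂ] H} (hf : f 1 = 0) :
    cohom f = convOne + conv (TensorAlgebra.ι ℂ ∘ₗ f) (cohom f) := by
  refine ext_word fun l => ?_
  rw [cohom_word hf l (l.length + 1) (by omega), Finset.sum_range_succ', add_comm,
    LinearMap.add_apply, conv_word]
  congr 1
  simp only [convPow, conv_word]
  rw [Finset.sum_comm]
  refine Finset.sum_congr rfl fun i _ => ?_
  rw [cohom_word hf (l.drop i) l.length (by simp), Finset.mul_sum]

theorem proj_ι_mul_of_counit (x : H) (t : TensorAlgebra ℂ H) :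
    proj (TensorAlgebra.ι ℂ x * t) = counit t • x := by
  induction t using word_induction with
  | word l =>
    cases l with
    | nil => simp
    | cons y l => rw [word_cons, proj_mul]; simp
  | zero => simp
  | add a b ha hb => simp [mul_add, ha, hb, add_smul]
  | smul c a ha => simp [ha, mul_smul]

theorem counit_comp_conv_ι (f : TensorAlgebra ℂ H →ₗ[ℂ] H)
    (F : TensorAlgebra ℂ H →ₗ[ℂ] TensorAlgebra ℂ H) :
    counit ∘ₗ conv (TensorAlgebra.ι ℂ ∘ₗ f) F = 0 := by
  refine ext_word fun l => ?_
  simp [conv_word]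

theorem proj_comp_convOne :
    proj ∘ₗ (convOne : TensorAlgebra ℂ H →ₗ[ℂ] TensorAlgebra ℂ H) = 0 := by
  ext t
  simp [convOne, Algebra.algebraMap_eq_smul_one]

theorem counit_comp_convOne :
    counit ∘ₗ (convOne : TensorAlgebra ℂ H →ₗ[ℂ] TensorAlgebra ℂ H) = counit := by
  ext t
  simp [convOne, Algebra.algebraMap_eq_smul_one]

theorem proj_comp_conv_ι (f : TensorAlgebra ℂ H →ₗ[ℂ] H)
    {F : TensorAlgebra ℂ H →ₗ[ℂ] TensorAlgebra ℂ H} (hF : counit ∘ₗ F = counit) :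
    proj ∘ₗ conv (TensorAlgebra.ι ℂ ∘ₗ f) F = f := by
  refine ext_word fun l => ?_
  have h : ∀ t, counit (F t) = counit t := fun t => LinearMap.congr_fun hF t
  rw [LinearMap.comp_apply, conv_word, map_sum, Finset.sum_range_succ]
  rw [Finset.sum_eq_zero]
  · simp [h, proj_ι_mul_of_counit]
  · intro i hi
    have hi := Finset.mem_range.1 hi
    rw [LinearMap.comp_apply, proj_ι_mul_of_counit, h]
    cases hd : l.drop i with
    | nil => rw [List.drop_eq_nil_iff] at hd; omega
    | cons y l' => simp

theorem isCohom_cohom {f : TensorAlgebra ℂ H →ₗ[ℂ] H} (hf : f 1 = 0) : IsCohom (cohom f) where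
  deconc_comp := by
    have hF := cohom_eq_conv hf
    set F := cohom f
    set f' := TensorAlgebra.ι ℂ ∘ₗ f with hf'
    have hR : inclR.toLinearMap ∘ₗ F =
        convOne + conv (inclR.toLinearMap ∘ₗ f') (inclR.toLinearMap ∘ₗ F) := by
      nth_rw 1 [hF]
      rw [LinearMap.comp_add, algHom_comp_conv, algHom_comp_convOne]
    have hL : inclL.toLinearMap ∘ₗ F =
        convOne + conv (inclL.toLinearMap ∘ₗ f') (inclL.toLinearMap ∘ₗ F) := by
      nth_rw 1 [hF]
      rw [LinearMap.comp_add, algHom_comp_conv, algHom_comp_convOne]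
    have hone : deconc ∘ₗ (convOne : TensorAlgebra ℂ H →ₗ[ℂ] TensorAlgebra ℂ H) = convOne := by
      ext t; simp [convOne, Algebra.algebraMap_eq_smul_one, Algebra.TensorProduct.one_def]
    refine eq_of_eq_add_conv (a := inclL.toLinearMap ∘ₗ f') (c := inclR.toLinearMap ∘ₗ F)
      (by simp [hf', hf]) ?_ ?_
    · nth_rw 1 [hF]
      rw [LinearMap.comp_add, hone, deconc_comp_conv, hf', deconc_comp_ι, ← hf', add_conv]
      nth_rw 4 [hR]
      abel
    · rw [map_comp_deconc]
      nth_rw 1 [hL]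
      rw [add_conv, one_conv, conv_assoc]
  map_one := by rw [cohom_eq_conv hf]; simp [conv_one_apply, hf]
  counit_comp := by
    rw [cohom_eq_conv hf, LinearMap.comp_add, counit_comp_conv_ι, counit_comp_convOne, add_zero]

theorem proj_comp_cohom {f : TensorAlgebra ℂ H →ₗ[ℂ] H} (hf : f 1 = 0) :
    proj ∘ₗ cohom f = f := by
  rw [cohom_eq_conv hf, LinearMap.comp_add, proj_comp_conv_ι _ (isCohom_cohom hf).counit_comp,
    proj_comp_convOne, zero_add]

/-! ### Coderivations -/

/-- The `α`-twisted coderivation with corestriction `m`. -/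
def coder (α : TensorAlgebra ℂ H →ₗ[ℂ] TensorAlgebra ℂ H) (m : TensorAlgebra ℂ H →ₗ[ℂ] H) :
    TensorAlgebra ℂ H →ₗ[ℂ] TensorAlgebra ℂ H :=
  conv α (conv (TensorAlgebra.ι ℂ ∘ₗ m) LinearMap.id)

theorem isCoder_coder {α : TensorAlgebra ℂ H →ₗ[ℂ] TensorAlgebra ℂ H} (hα : IsCohom α)
    {m : TensorAlgebra ℂ H →ₗ[ℂ] H} (hm : m 1 = 0) : IsCoder α (coder α m) where
  deconc_comp := by
    set m' := TensorAlgebra.ι ℂ ∘ₗ m with hm'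
    have h2 : deconc ∘ₗ conv m' LinearMap.id =
        conv (inclR.toLinearMap ∘ₗ m') inclR.toLinearMap +
        conv (inclL.toLinearMap ∘ₗ m') deconc := by
      rw [deconc_comp_conv, hm', deconc_comp_ι, ← hm', add_conv]
      simp only [LinearMap.comp_id]
      abel
    rw [coder, ← hm', deconc_comp_conv, h2, LinearMap.add_comp, map_comp_deconc, map_comp_deconc,
      LinearMap.comp_id, hα.deconc_comp, map_comp_deconc, conv_add]
    simp only [algHom_comp_conv]
    simp only [LinearMap.comp_id, conv_assoc, deconc_eq_conv]
    abel
  map_one := by simp [coder, conv_one_apply, hm]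
  counit_comp := by
    have h : ∀ t, counit (α t) = counit t := fun t => LinearMap.congr_fun hα.counit_comp t
    refine ext_word fun l => ?_
    simp only [coder, LinearMap.comp_apply, conv_word, map_sum, LinearMap.zero_apply]
    refine Finset.sum_eq_zero fun i _ => ?_
    have h3 : ∀ a b : TensorAlgebra ℂ H, counit (a * b) = counit a * counit b := by
      intro a b; simp [counit]
    simp [h3, Finset.mul_sum]

theorem proj_comp_coder {α : TensorAlgebra ℂ H →ₗ[ℂ] TensorAlgebra ℂ H} (hα : IsCohom α)
    {m : TensorAlgebra ℂ H →ₗ[ℂ] H} (hm : m 1 = 0) : proj ∘ₗ coder α m = m := by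
  have hα' : α = convOne + conv (TensorAlgebra.ι ℂ ∘ₗ (proj ∘ₗ α)) α := hα.eq_conv
  have hD := isCoder_coder hα hm
  have h0 : counit ∘ₗ coder α m = 0 := hD.counit_comp
  have hz : ∀ f : TensorAlgebra ℂ H →ₗ[ℂ] H, proj ∘ₗ conv (TensorAlgebra.ι ℂ ∘ₗ f) (coder α m) = 0 := by
    intro f
    refine ext_word fun l => ?_
    have h : ∀ t, counit (coder α m t) = 0 := fun t => LinearMap.congr_fun h0 t
    simp [conv_word, proj_ι_mul_of_counit, h]
  have h1 : coder α m = conv (TensorAlgebra.ι ℂ ∘ₗ m) LinearMap.id +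
      conv (TensorAlgebra.ι ℂ ∘ₗ (proj ∘ₗ α)) (coder α m) := by
    nth_rw 1 [coder]
    nth_rw 1 [hα']
    rw [add_conv, one_conv, conv_assoc]; rfl
  rw [h1, LinearMap.comp_add, hz, add_zero, proj_comp_conv_ι]
  rfl

theorem IsCoder.eq_coder {α D : TensorAlgebra ℂ H →ₗ[ℂ] TensorAlgebra ℂ H} (hα : IsCohom α)
    (hD : IsCoder α D) : D = coder α (proj ∘ₗ D) :=
  have h : (proj ∘ₗ D) 1 = 0 := by simp [hD.map_one]
  hD.ext hα.map_one (isCoder_coder hα h) (proj_comp_coder hα h).symm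

theorem coder_sub (α : TensorAlgebra ℂ H →ₗ[ℂ] TensorAlgebra ℂ H)
    (m m' : TensorAlgebra ℂ H →ₗ[ℂ] H) : coder α (m - m') = coder α m - coder α m' := by
  simp only [coder, LinearMap.comp_sub, sub_conv, conv_sub]

/-- The conjugate of a coderivation by an invertible morphism. -/
theorem IsCoder.conj {α D F G : TensorAlgebra ℂ H →ₗ[ℂ] TensorAlgebra ℂ H}
    (hD : IsCoder α D) (hF : IsCohom F) (hFG : F ∘ₗ G = LinearMap.id)
    (hGF : G ∘ₗ F = LinearMap.id) (hα : F ∘ₗ α = α ∘ₗ F) : IsCoder α (F ∘ₗ D ∘ₗ G) := by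
  have hG := hF.of_inverse hFG hGF
  have hαG : F ∘ₗ α ∘ₗ G = α := by
    rw [← LinearMap.comp_assoc, hα, LinearMap.comp_assoc, hFG, LinearMap.comp_id]
  refine ⟨?_, ?_, ?_⟩
  · rw [← LinearMap.comp_assoc, hF.deconc_comp, LinearMap.comp_assoc, ← LinearMap.comp_assoc G,
      hD.deconc_comp, LinearMap.comp_assoc, hG.deconc_comp, ← LinearMap.comp_assoc,
      ← LinearMap.comp_assoc]
    congr 1
    rw [LinearMap.comp_add, LinearMap.add_comp, ← TensorProduct.map_comp, ← TensorProduct.map_comp,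
      ← TensorProduct.map_comp, ← TensorProduct.map_comp, LinearMap.comp_id, hFG,
      LinearMap.comp_assoc, LinearMap.comp_assoc, hαG]
  · simp [hG.map_one, hD.map_one]
  · rw [← LinearMap.comp_assoc, hF.counit_comp, ← LinearMap.comp_assoc, hD.counit_comp,
      LinearMap.zero_comp]

/-- Two linear maps which intertwine coderivations up to corestriction do so. -/
theorem comp_eq_comp_of_proj {α D D' F : TensorAlgebra ℂ H →ₗ[ℂ] TensorAlgebra ℂ H}
    (hα : IsCohom α) (hD : IsCoder α D) (hD' : IsCoder α D') (hF : IsCohom F)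
    (hFα : F ∘ₗ α = α ∘ₗ F) (h : proj ∘ₗ D' ∘ₗ F = proj ∘ₗ F ∘ₗ D) : D' ∘ₗ F = F ∘ₗ D := by
  rw [← sub_eq_zero]
  refine eq_zero_of_coder (α := F ∘ₗ α) (γ := F) (by simp [hα.map_one, hF.map_one]) ?_ ?_ ?_
  · have e1 : deconc ∘ₗ (D' ∘ₗ F) =
        (TensorProduct.map (D' ∘ₗ F) F + TensorProduct.map (α ∘ₗ F) (D' ∘ₗ F)) ∘ₗ deconc := by
      rw [← LinearMap.comp_assoc, hD'.deconc_comp, LinearMap.comp_assoc, hF.deconc_comp,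
        ← LinearMap.comp_assoc, LinearMap.add_comp, ← TensorProduct.map_comp,
        ← TensorProduct.map_comp, LinearMap.id_comp]
    have e2 : deconc ∘ₗ (F ∘ₗ D) =
        (TensorProduct.map (F ∘ₗ D) F + TensorProduct.map (F ∘ₗ α) (F ∘ₗ D)) ∘ₗ deconc := by
      rw [← LinearMap.comp_assoc, hF.deconc_comp, LinearMap.comp_assoc, hD.deconc_comp,
        ← LinearMap.comp_assoc, LinearMap.comp_add, ← TensorProduct.map_comp,
        ← TensorProduct.map_comp, LinearMap.comp_id]
    rw [LinearMap.comp_sub, e1, e2, map_sub_left, map_sub_right, hFα, ← LinearMap.sub_comp]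
    congr 1; abel
  · rw [LinearMap.comp_sub, ← LinearMap.comp_assoc, hD'.counit_comp, ← LinearMap.comp_assoc,
      hF.counit_comp, hD.counit_comp]; simp
  · rw [LinearMap.comp_sub, h, sub_self]

end TensorCoalgebra

namespace TensorCoalgebra

variable {H : Type*} [AddCommGroup H] [Module ℂ H]

/-! ### The length filtration -/

/-- The span of the words of length at most `n`. -/
def fil (n : ℕ) : Submodule ℂ (TensorAlgebra ℂ H) :=
  Submodule.span ℂ (word '' {l | l.length ≤ n})

theorem word_mem_fil {l : List H} {n : ℕ} (h : l.length ≤ n) : word l ∈ fil n :=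
  Submodule.subset_span ⟨l, h, rfl⟩

theorem fil_mono {n n' : ℕ} (h : n ≤ n') : (fil n : Submodule ℂ (TensorAlgebra ℂ H)) ≤ fil n' :=
  Submodule.span_mono (Set.image_mono fun _ hl => le_trans hl h)

theorem fil_le_comap {M : Type*} [AddCommGroup M] [Module ℂ M] {φ : TensorAlgebra ℂ H →ₗ[ℂ] M}
    {S : Submodule ℂ M} {n : ℕ} (h : ∀ l : List H, l.length ≤ n → φ (word l) ∈ S)
    {t : TensorAlgebra ℂ H} (ht : t ∈ fil n) : φ t ∈ S := by
  have : fil n ≤ S.comap φ := by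
    rw [fil, Submodule.span_le]
    rintro _ ⟨l, hl, rfl⟩
    exact h l hl
  exact this ht

theorem eq_on_fil {M : Type*} [AddCommGroup M] [Module ℂ M] {φ ψ : TensorAlgebra ℂ H →ₗ[ℂ] M}
    {n : ℕ} (h : ∀ l : List H, l.length ≤ n → φ (word l) = ψ (word l))
    {t : TensorAlgebra ℂ H} (ht : t ∈ fil n) : φ t = ψ t := by
  have := fil_le_comap (φ := φ - ψ) (S := ⊥) (n := n)
    (fun l hl => by simp [h l hl]) ht
  simpa [sub_eq_zero] using this

theorem exists_mem_fil (t : TensorAlgebra ℂ H) : ∃ n, t ∈ fil n := by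
  induction t using word_induction with
  | word l => exact ⟨l.length, word_mem_fil le_rfl⟩
  | zero => exact ⟨0, zero_mem _⟩
  | add a b ha hb =>
    obtain ⟨n, hn⟩ := ha
    obtain ⟨n', hn'⟩ := hb
    exact ⟨max n n', add_mem (fil_mono (le_max_left _ _) hn) (fil_mono (le_max_right _ _) hn')⟩
  | smul c a ha =>
    obtain ⟨n, hn⟩ := ha
    exact ⟨n, Submodule.smul_mem _ _ hn⟩

theorem ι_mul_mem_fil (x : H) {t : TensorAlgebra ℂ H} {n : ℕ} (ht : t ∈ fil n) :
    TensorAlgebra.ι ℂ x * t ∈ fil (n + 1) :=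
  fil_le_comap (φ := LinearMap.mulLeft ℂ (TensorAlgebra.ι ℂ x))
    (fun l hl => by
      rw [LinearMap.mulLeft_apply, ← word_cons]
      exact word_mem_fil (by simpa using hl)) ht

theorem ι_mem_fil (x : H) : TensorAlgebra.ι ℂ x ∈ fil 1 := by
  rw [← word_singleton]; exact word_mem_fil (by simp)

theorem eq_smul_one_of_mem_fil_zero {t : TensorAlgebra ℂ H} (ht : t ∈ fil 0) :
    ∃ c : ℂ, t = c • (1 : TensorAlgebra ℂ H) := by
  have : t = (Algebra.linearMap ℂ _ ∘ₗ counit) t := by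
    refine eq_on_fil (φ := LinearMap.id) (fun l hl => ?_) ht
    have : l = [] := List.length_eq_zero_iff.1 (by omega)
    subst this; simp
  exact ⟨counit t, by rw [this]; simp [Algebra.algebraMap_eq_smul_one]⟩

theorem IsCohom.map_word {F : TensorAlgebra ℂ H →ₗ[ℂ] TensorAlgebra ℂ H} (hF : IsCohom F)
    (x : H) (l : List H) : F (word (x :: l)) = ∑ i ∈ Finset.range (l.length + 1),
      TensorAlgebra.ι ℂ (proj (F (word (x :: l.take i)))) * F (word (l.drop i)) := by
  nth_rw 1 [hF.eq_conv]
  rw [LinearMap.add_apply, conv_word, Finset.sum_range_succ']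
  simp [hF.map_one]

theorem IsCoder.map_word {α D : TensorAlgebra ℂ H →ₗ[ℂ] TensorAlgebra ℂ H} (hD : IsCoder α D)
    (hα : α 1 = 1) (x : H) (l : List H) :
    D (word (x :: l)) = ∑ i ∈ Finset.range (l.length + 1),
      (TensorAlgebra.ι ℂ (proj (D (word (x :: l.take i)))) * word (l.drop i) +
      TensorAlgebra.ι ℂ (proj (α (word (x :: l.take i)))) * D (word (l.drop i))) := by
  nth_rw 1 [hD.eq_conv]
  rw [LinearMap.add_apply, conv_word, conv_word, ← Finset.sum_add_distrib, Finset.sum_range_succ']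
  simp [hD.map_one, hα]

theorem IsCohom.mem_fil {F : TensorAlgebra ℂ H →ₗ[ℂ] TensorAlgebra ℂ H} (hF : IsCohom F)
    {n : ℕ} {t : TensorAlgebra ℂ H} (ht : t ∈ fil n) : F t ∈ fil n := by
  refine fil_le_comap (fun l hl => ?_) ht
  induction hk : l.length using Nat.strong_induction_on generalizing l n t with
  | _ k ih =>
    cases l with
    | nil => rw [word_nil, hF.map_one, ← word_nil]; exact word_mem_fil (by simp)
    | cons x l =>
      rw [hF.map_word]
      refine sum_mem fun i hi => ?_
      simp only [List.length_cons] at hl hk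
      have h := ih (l.drop i).length (by simp; omega) (n := n - 1) (t := 0) (zero_mem _)
        (l.drop i) (by simp; omega) rfl
      exact fil_mono (by omega) (ι_mul_mem_fil _ h)

theorem IsCohom.sub_mem_fil {F : TensorAlgebra ℂ H →ₗ[ℂ] TensorAlgebra ℂ H} (hF : IsCohom F)
    (h1 : ∀ x, proj (F (TensorAlgebra.ι ℂ x)) = x)
    {n : ℕ} {t : TensorAlgebra ℂ H} (ht : t ∈ fil (n + 1)) : F t - t ∈ fil n := by
  refine fil_le_comap (φ := F - LinearMap.id) (fun l hl => ?_) ht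
  rw [LinearMap.sub_apply, LinearMap.id_apply]
  clear ht t
  induction l generalizing n with
  | nil => rw [word_nil, hF.map_one, sub_self]; exact zero_mem _
  | cons x l ih =>
    simp only [List.length_cons] at hl
    rw [hF.map_word, Finset.sum_range_succ', List.take_zero, List.drop_zero, word_singleton, h1,
      word_cons, add_sub_assoc, ← mul_sub]
    refine add_mem (sum_mem fun i hi => ?_) ?_
    · have hi := Finset.mem_range.1 hi
      have := hF.mem_fil (word_mem_fil (le_refl (l.drop (i + 1)).length))
      refine fil_mono ?_ (ι_mul_mem_fil _ this)
      simp; omega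
    · cases l with
      | nil => simp [hF.map_one]
      | cons y l =>
        simp only [List.length_cons] at hl
        have := ih (n := n - 1) (by simp; omega)
        exact fil_mono (by omega) (ι_mul_mem_fil _ this)

theorem IsCoder.mem_fil {α D : TensorAlgebra ℂ H →ₗ[ℂ] TensorAlgebra ℂ H} (hD : IsCoder α D)
    (hα : α 1 = 1) {n : ℕ} {t : TensorAlgebra ℂ H} (ht : t ∈ fil n) : D t ∈ fil n := by
  refine fil_le_comap (fun l hl => ?_) ht
  induction hk : l.length using Nat.strong_induction_on generalizing l n t with
  | _ k ih =>
    cases l with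
    | nil => rw [word_nil, hD.map_one]; exact zero_mem _
    | cons x l =>
      rw [hD.map_word hα]
      refine sum_mem fun i hi => ?_
      simp only [List.length_cons] at hl hk
      have h := ih (l.drop i).length (by simp; omega) (n := n - 1) (t := 0) (zero_mem _)
        (l.drop i) (by simp; omega) rfl
      have h' : word (l.drop i) ∈ fil (n - 1) := word_mem_fil (by simp; omega)
      exact add_mem (fil_mono (by omega) (ι_mul_mem_fil _ h'))
        (fil_mono (by omega) (ι_mul_mem_fil _ h))

theorem IsCoder.mem_fil_of_lower {α D : TensorAlgebra ℂ H →ₗ[ℂ] TensorAlgebra ℂ H}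
    (hD : IsCoder α D) (hα : α 1 = 1) (h1 : ∀ x, proj (D (TensorAlgebra.ι ℂ x)) = 0)
    {n : ℕ} {t : TensorAlgebra ℂ H} (ht : t ∈ fil (n + 1)) : D t ∈ fil n := by
  refine fil_le_comap (fun l hl => ?_) ht
  induction hk : l.length using Nat.strong_induction_on generalizing l n t with
  | _ k ih =>
    cases l with
    | nil => rw [word_nil, hD.map_one]; exact zero_mem _
    | cons x l =>
      rw [hD.map_word hα]
      refine sum_mem fun i hi => ?_
      have hi := Finset.mem_range.1 hi
      simp only [List.length_cons] at hl hk
      refine add_mem ?_ ?_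
      · by_cases h0 : i = 0
        · subst h0
          rw [List.take_zero, word_singleton, h1]; simp
        · have h' : word (l.drop i) ∈ fil (n - 1) := word_mem_fil (by simp; omega)
          exact fil_mono (by omega) (ι_mul_mem_fil _ h')
      · by_cases hli : l.drop i = []
        · rw [hli, word_nil, hD.map_one, mul_zero]; exact zero_mem _
        · have hli' : l.length - i ≠ 0 := by
            rwa [Ne, ← List.length_drop, List.length_eq_zero_iff]
          have h := ih (l.drop i).length (by simp; omega) (n := n - 1) (t := 0) (zero_mem _)
            (l.drop i) (by simp; omega) rfl
          exact fil_mono (by omega) (ι_mul_mem_fil _ h)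

theorem IsCoder.map_word_of_proj_eq_zero {α D : TensorAlgebra ℂ H →ₗ[ℂ] TensorAlgebra ℂ H}
    (hD : IsCoder α D) (hα : α 1 = 1) {k : ℕ}
    (h : ∀ l : List H, l.length < k → proj (D (word l)) = 0) (l : List H) (hl : l.length ≤ k) :
    D (word l) = TensorAlgebra.ι ℂ (proj (D (word l))) := by
  induction hn : l.length using Nat.strong_induction_on generalizing l with
  | _ n ih =>
    cases l with
    | nil => rw [word_nil, hD.map_one]; simp
    | cons x l =>
      simp only [List.length_cons] at hn hl
      rw [hD.map_word hα, Finset.sum_range_succ, Finset.sum_eq_zero]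
      · simp [hD.map_one]
      · intro i hi
        have hi := Finset.mem_range.1 hi
        rw [h (x :: l.take i) (by simp; omega), ih (l.drop i).length (by simp; omega) _
          (by simp; omega) rfl, h (l.drop i) (by simp; omega)]
        simp

theorem IsCohom.map_ι {F : TensorAlgebra ℂ H →ₗ[ℂ] TensorAlgebra ℂ H} (hF : IsCohom F) (x : H) :
    F (TensorAlgebra.ι ℂ x) = TensorAlgebra.ι ℂ (proj (F (TensorAlgebra.ι ℂ x))) := by
  have := hF.map_word x []
  simpa [hF.map_one, word_singleton] using this

/-- A unipotent coalgebra morphism is invertible. -/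
theorem IsCohom.exists_inverse {F : TensorAlgebra ℂ H →ₗ[ℂ] TensorAlgebra ℂ H} (hF : IsCohom F)
    (h1 : ∀ x, proj (F (TensorAlgebra.ι ℂ x)) = x) :
    ∃ G : TensorAlgebra ℂ H →ₗ[ℂ] TensorAlgebra ℂ H,
      F ∘ₗ G = LinearMap.id ∧ G ∘ₗ F = LinearMap.id := by
  have h0 : ∀ t ∈ fil 0, F t = t := by
    intro t ht
    obtain ⟨c, rfl⟩ := eq_smul_one_of_mem_fil_zero ht
    rw [map_smul, hF.map_one]
  have hinj : Function.Injective F := by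
    rw [injective_iff_map_eq_zero]
    intro t ht
    obtain ⟨n, hn⟩ := exists_mem_fil t
    induction n with
    | zero => rw [← h0 t hn, ht]
    | succ n ih =>
      refine ih ?_
      have := hF.sub_mem_fil h1 hn
      rw [ht, zero_sub] at this
      simpa using neg_mem this
  have hsurj : Function.Surjective F := by
    intro t
    obtain ⟨n, hn⟩ := exists_mem_fil t
    induction n generalizing t with
    | zero => exact ⟨t, h0 t hn⟩
    | succ n ih =>
      obtain ⟨s, hs⟩ := ih (F t - t) (hF.sub_mem_fil h1 hn)
      exact ⟨t - s, by rw [map_sub, hs]; abel⟩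
  let e := LinearEquiv.ofBijective F ⟨hinj, hsurj⟩
  exact ⟨e.symm.toLinearMap, LinearMap.ext fun t => e.apply_symm_apply t,
    LinearMap.ext fun t => e.symm_apply_apply t⟩

/-! ### The exponential of a coderivation -/

/-- The exponential of a linear map that lowers the length filtration. -/
def expMap (X : TensorAlgebra ℂ H →ₗ[ℂ] TensorAlgebra ℂ H) :
    TensorAlgebra ℂ H →ₗ[ℂ] TensorAlgebra ℂ H :=
  glue (fun n => ∑ j ∈ Finset.range (n + 1), ((j.factorial : ℂ)⁻¹) • X ^ j)

section Exp

variable {X : TensorAlgebra ℂ H →ₗ[ℂ] TensorAlgebra ℂ H}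

theorem pow_mem_fil (hX : ∀ n, ∀ t ∈ fil (n + 1), X t ∈ fil n) (n j : ℕ)
    {t : TensorAlgebra ℂ H} (ht : t ∈ fil (n + j)) : (X ^ j) t ∈ fil n := by
  induction j generalizing t with
  | zero => simpa using ht
  | succ j ih =>
    rw [pow_succ, Module.End.mul_apply]
    exact ih (hX _ _ ht)

theorem pow_eq_zero_of_lt (hX1 : X 1 = 0) (hX : ∀ n, ∀ t ∈ fil (n + 1), X t ∈ fil n) {n j : ℕ}
    (h : n < j) {t : TensorAlgebra ℂ H} (ht : t ∈ fil n) : (X ^ j) t = 0 := by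
  obtain ⟨i, rfl⟩ := Nat.exists_eq_add_of_lt h
  have h2 : (X ^ n) t ∈ fil 0 := pow_mem_fil hX 0 n (by simpa using ht)
  obtain ⟨c, hc⟩ := eq_smul_one_of_mem_fil_zero h2
  have : n + i + 1 = i + (1 + n) := by ring
  rw [this, pow_add, pow_add, Module.End.mul_apply, Module.End.mul_apply, hc]
  simp [hX1]

theorem expMap_apply (hX1 : X 1 = 0) (hX : ∀ n, ∀ t ∈ fil (n + 1), X t ∈ fil n) {n : ℕ}
    {t : TensorAlgebra ℂ H} (ht : t ∈ fil n) :
    expMap X t = ∑ j ∈ Finset.range (n + 1), ((j.factorial : ℂ)⁻¹) • (X ^ j) t := by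
  have : expMap X t = (∑ j ∈ Finset.range (n + 1), ((j.factorial : ℂ)⁻¹) • X ^ j) t := by
    refine eq_on_fil (fun l hl => ?_) ht
    rw [expMap, glue_word, LinearMap.sum_apply, LinearMap.sum_apply]
    refine Finset.sum_subset (Finset.range_mono (by omega)) fun k _ hk => ?_
    rw [LinearMap.smul_apply, pow_eq_zero_of_lt hX1 hX (n := l.length) (by simpa using hk)
      (word_mem_fil le_rfl), smul_zero]
  rw [this, LinearMap.sum_apply]
  rfl

theorem comp_expMap {M : Type*} [AddCommGroup M] [Module ℂ M] {φ : TensorAlgebra ℂ H →ₗ[ℂ] M}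
    (hX1 : X 1 = 0) (hX : ∀ n, ∀ t ∈ fil (n + 1), X t ∈ fil n) (h : φ ∘ₗ X = 0) :
    φ ∘ₗ expMap X = φ := by
  refine ext_word fun l => ?_
  rw [LinearMap.comp_apply, expMap_apply hX1 hX (word_mem_fil le_rfl), Finset.sum_range_succ',
    map_add, map_sum, Finset.sum_eq_zero]
  · simp
  · intro j _
    rw [pow_succ', Module.End.mul_apply, map_smul]
    have := LinearMap.congr_fun h ((X ^ j) (word l))
    simp only [LinearMap.comp_apply, LinearMap.zero_apply] at this
    rw [this, smul_zero]

theorem expMap_comm {G : TensorAlgebra ℂ H →ₗ[ℂ] TensorAlgebra ℂ H}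
    (hX1 : X 1 = 0) (hX : ∀ n, ∀ t ∈ fil (n + 1), X t ∈ fil n)
    (hG : ∀ n, ∀ t ∈ fil n, G t ∈ fil n) (h : X ∘ₗ G = G ∘ₗ X) :
    expMap X ∘ₗ G = G ∘ₗ expMap X := by
  refine ext_word fun l => ?_
  have hl : word l ∈ fil l.length := word_mem_fil le_rfl
  rw [LinearMap.comp_apply, LinearMap.comp_apply, expMap_apply hX1 hX hl,
    expMap_apply hX1 hX (hG _ _ hl), map_sum]
  refine Finset.sum_congr rfl fun j _ => ?_
  have : Commute X G := h
  rw [map_smul, ← Module.End.mul_apply, ← Module.End.mul_apply, (this.pow_left j).eq]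

theorem deconc_pow (hX : IsCoder LinearMap.id X) (j : ℕ) :
    deconc ∘ₗ (X ^ j) = ∑ p ∈ Finset.HasAntidiagonal.antidiagonal j,
      (j.choose p.1) • (TensorProduct.map (X ^ p.1) (X ^ p.2) ∘ₗ deconc) := by
  set U : Module.End ℂ (TensorAlgebra ℂ H ⊗[ℂ] TensorAlgebra ℂ H) :=
    TensorProduct.map X LinearMap.id with hU
  set V : Module.End ℂ (TensorAlgebra ℂ H ⊗[ℂ] TensorAlgebra ℂ H) :=
    TensorProduct.map LinearMap.id X with hV
  have hUV : Commute U V := by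
    change U ∘ₗ V = V ∘ₗ U
    rw [hU, hV, ← TensorProduct.map_comp, ← TensorProduct.map_comp]; simp
  have h1 : deconc ∘ₗ (X ^ j) = ((U + V) ^ j : Module.End ℂ _) ∘ₗ deconc := by
    induction j with
    | zero => ext t; simp
    | succ j ih =>
      have e' : (U + V) ^ (j + 1) = ((U + V) ^ j : Module.End ℂ _) ∘ₗ (U + V) := pow_succ (U + V) j
      have e2 : X ^ (j + 1) = (X ^ j) ∘ₗ X := pow_succ X j
      rw [e2, ← LinearMap.comp_assoc, ih, LinearMap.comp_assoc, hX.deconc_comp,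
        ← LinearMap.comp_assoc, e']
  have h2 : ∀ a b : ℕ, (U ^ a * V ^ b : Module.End ℂ _) = TensorProduct.map (X ^ a) (X ^ b) := by
    intro a b
    have hUa : U ^ a = TensorProduct.map (X ^ a) LinearMap.id := by
      induction a with
      | zero => exact TensorProduct.map_id.symm
      | succ a ih =>
        rw [pow_succ, ih, hU, pow_succ]
        change _ ∘ₗ _ = _
        rw [← TensorProduct.map_comp]; rfl
    have hVb : V ^ b = TensorProduct.map LinearMap.id (X ^ b) := by
      induction b with
      | zero => exact TensorProduct.map_id.symm
      | succ b ih =>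
        rw [pow_succ, ih, hV, pow_succ]
        change _ ∘ₗ _ = _
        rw [← TensorProduct.map_comp]; rfl
    rw [hUa, hVb]
    change _ ∘ₗ _ = _
    rw [← TensorProduct.map_comp]; simp
  rw [h1, hUV.add_pow']
  ext t
  simp [h2]

theorem isCohom_expMap (hX : IsCoder LinearMap.id X)
    (hX' : ∀ n, ∀ t ∈ fil (n + 1), X t ∈ fil n) : IsCohom (expMap X) where
  deconc_comp := by
    refine ext_word fun l => ?_
    set n := l.length with hn
    set S : TensorAlgebra ℂ H →ₗ[ℂ] TensorAlgebra ℂ H :=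
      ∑ j ∈ Finset.range (n + 1), ((j.factorial : ℂ)⁻¹) • X ^ j with hS
    have hEF : ∀ t ∈ fil n, expMap X t = S t := by
      intro t ht
      rw [expMap_apply hX.map_one hX' ht, hS, LinearMap.sum_apply]
      rfl
    have hR : TensorProduct.map (expMap X) (expMap X) (deconc (word l)) =
        ∑ p ∈ Finset.range (n + 1) ×ˢ Finset.range (n + 1),
          ((p.1.factorial : ℂ)⁻¹ * (p.2.factorial : ℂ)⁻¹) •
            TensorProduct.map (X ^ p.1) (X ^ p.2) (deconc (word l)) := by
      simp only [deconc_word, map_sum, TensorProduct.map_tmul, Finset.smul_sum]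
      rw [Finset.sum_comm]
      refine Finset.sum_congr rfl fun i _ => ?_
      rw [hEF _ (word_mem_fil (by simp [hn])), hEF _ (word_mem_fil (by simp [hn])), hS,
        LinearMap.sum_apply, LinearMap.sum_apply, TensorProduct.sum_tmul, Finset.sum_product]
      refine Finset.sum_congr rfl fun a _ => ?_
      rw [TensorProduct.tmul_sum]
      refine Finset.sum_congr rfl fun b _ => ?_
      rw [LinearMap.smul_apply, LinearMap.smul_apply, TensorProduct.smul_tmul_smul]
    have hz : ∀ a b : ℕ, n < a + b →
        TensorProduct.map (X ^ a) (X ^ b) (deconc (word l)) = 0 := by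
      intro a b hab
      rw [deconc_word, map_sum]
      refine Finset.sum_eq_zero fun i hi => ?_
      have hi := Finset.mem_range.1 hi
      rw [TensorProduct.map_tmul]
      by_cases hia : i < a
      · rw [pow_eq_zero_of_lt hX.map_one hX' hia (word_mem_fil (by simp)), TensorProduct.zero_tmul]
      · rw [pow_eq_zero_of_lt (n := n - i) (j := b) hX.map_one hX' (by omega)
          (word_mem_fil (by simp [hn])), TensorProduct.tmul_zero]
    rw [LinearMap.comp_apply, LinearMap.comp_apply, hR,
      expMap_apply hX.map_one hX' (word_mem_fil le_rfl), map_sum]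
    have hL : ∀ j, deconc (((j.factorial : ℂ)⁻¹) • (X ^ j) (word l)) =
        ∑ p ∈ Finset.HasAntidiagonal.antidiagonal j, ((p.1.factorial : ℂ)⁻¹ * (p.2.factorial : ℂ)⁻¹) •
            TensorProduct.map (X ^ p.1) (X ^ p.2) (deconc (word l)) := by
      intro j
      have := LinearMap.congr_fun (deconc_pow hX j) (word l)
      rw [LinearMap.comp_apply] at this
      rw [map_smul, this, LinearMap.sum_apply, Finset.smul_sum]
      refine Finset.sum_congr rfl fun p hp => ?_
      have hp := Finset.HasAntidiagonal.mem_antidiagonal.1 hp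
      rw [LinearMap.smul_apply, LinearMap.comp_apply, ← Nat.cast_smul_eq_nsmul ℂ, smul_smul]
      congr 1
      subst hp
      have h0 : (((p.1 + p.2).choose p.1 : ℕ) : ℂ) * (p.1.factorial : ℂ) * (p.2.factorial : ℂ) =
          ((p.1 + p.2).factorial : ℂ) := by
        rw [Nat.choose_symm_add]
        exact_mod_cast Nat.add_choose_mul_factorial_mul_factorial p.1 p.2
      have h1 : (((p.1 + p.2).factorial : ℕ) : ℂ) ≠ 0 := by
        exact_mod_cast Nat.factorial_ne_zero _
      have h2 : ((p.1.factorial : ℕ) : ℂ) ≠ 0 := by exact_mod_cast Nat.factorial_ne_zero _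
      have h3 : ((p.2.factorial : ℕ) : ℂ) ≠ 0 := by exact_mod_cast Nat.factorial_ne_zero _
      rw [inv_mul_eq_iff_eq_mul₀ h1, ← h0]
      field_simp
    rw [Finset.sum_congr rfl fun j _ => hL j, Finset.sum_sigma']
    refine Finset.sum_of_injOn (fun s => s.2) ?_ ?_ ?_ ?_
    · rintro ⟨j, p⟩ h ⟨j', p'⟩ h' e
      simp at h h' e
      subst e
      simp; omega
    · rintro ⟨j, p⟩ h
      simp at h ⊢
      omega
    · intro p hp hp'
      rw [hz, smul_zero]
      by_contra hlt
      refine hp' ⟨⟨p.1 + p.2, p⟩, ?_, rfl⟩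
      simp; omega
    · rintro ⟨j, p⟩ h
      rfl
  map_one := by
    rw [expMap_apply hX.map_one hX' (n := 0) (by rw [← word_nil]; exact word_mem_fil (by simp))]
    simp
  counit_comp := comp_expMap hX.map_one hX' hX.counit_comp

end Exp

/-! ### Words in a subspace -/

/-- The span of the words with letters in `K`. -/
def tens (K : Submodule ℂ H) : Submodule ℂ (TensorAlgebra ℂ H) :=
  Submodule.span ℂ (word '' {l | ∀ x ∈ l, x ∈ K})

theorem word_mem_tens {K : Submodule ℂ H} {l : List H} (h : ∀ x ∈ l, x ∈ K) : word l ∈ tens K :=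
  Submodule.subset_span ⟨l, h, rfl⟩

theorem tens_le_comap {M : Type*} [AddCommGroup M] [Module ℂ M] {φ : TensorAlgebra ℂ H →ₗ[ℂ] M}
    {K : Submodule ℂ H} {S : Submodule ℂ M}
    (h : ∀ l : List H, (∀ x ∈ l, x ∈ K) → φ (word l) ∈ S)
    {t : TensorAlgebra ℂ H} (ht : t ∈ tens K) : φ t ∈ S := by
  have : tens K ≤ S.comap φ := by
    rw [tens, Submodule.span_le]
    rintro _ ⟨l, hl, rfl⟩
    exact h l hl
  exact this ht

theorem one_mem_tens (K : Submodule ℂ H) : 1 ∈ tens K := by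
  rw [← word_nil]; exact word_mem_tens (by simp)

theorem ι_mul_mem_tens {K : Submodule ℂ H} {x : H} (hx : x ∈ K) {t : TensorAlgebra ℂ H}
    (ht : t ∈ tens K) : TensorAlgebra.ι ℂ x * t ∈ tens K :=
  tens_le_comap (φ := LinearMap.mulLeft ℂ (TensorAlgebra.ι ℂ x))
    (fun l hl => by
      rw [LinearMap.mulLeft_apply, ← word_cons]
      exact word_mem_tens (by simpa [hx] using hl)) ht

theorem IsCohom.mem_tens {F : TensorAlgebra ℂ H →ₗ[ℂ] TensorAlgebra ℂ H} (hF : IsCohom F)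
    {K K' : Submodule ℂ H} (h : ∀ t ∈ tens K, proj (F t) ∈ K')
    {t : TensorAlgebra ℂ H} (ht : t ∈ tens K) : F t ∈ tens K' := by
  refine tens_le_comap (fun l hl => ?_) ht
  clear ht t
  induction hk : l.length using Nat.strong_induction_on generalizing l with
  | _ k ih =>
    cases l with
    | nil => rw [word_nil, hF.map_one]; exact one_mem_tens _
    | cons x l =>
      rw [hF.map_word]
      refine sum_mem fun i hi => ?_
      simp only [List.mem_cons, forall_eq_or_imp, List.length_cons] at hl hk
      refine ι_mul_mem_tens (h _ (word_mem_tens ?_))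
        (ih (l.drop i).length (by simp; omega) _ (fun y hy => hl.2 y (List.mem_of_mem_drop hy)) rfl)
      simp only [List.mem_cons, forall_eq_or_imp]
      exact ⟨hl.1, fun y hy => hl.2 y (List.mem_of_mem_take hy)⟩

/-- A coderivation after a coalgebra morphism keeps the letters in a subspace. -/
theorem IsCoder.mem_tens {α D F : TensorAlgebra ℂ H →ₗ[ℂ] TensorAlgebra ℂ H} (hD : IsCoder α D)
    (hα : α 1 = 1) (hF : IsCohom F) {K K' : Submodule ℂ H} (hFK : ∀ t ∈ tens K, F t ∈ tens K')
    (hαK : ∀ t ∈ tens K, proj (α (F t)) ∈ K') (h : ∀ t ∈ tens K, proj (D (F t)) ∈ K')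
    {t : TensorAlgebra ℂ H} (ht : t ∈ tens K) : D (F t) ∈ tens K' := by
  have hDF : D ∘ₗ F = conv (TensorAlgebra.ι ℂ ∘ₗ (proj ∘ₗ D ∘ₗ F)) F +
      conv (TensorAlgebra.ι ℂ ∘ₗ (proj ∘ₗ α ∘ₗ F)) (D ∘ₗ F) := by
    nth_rw 1 [hD.eq_conv]
    rw [LinearMap.add_comp, hF.conv_comp, hF.conv_comp]
    simp only [LinearMap.comp_assoc, LinearMap.id_comp]
  refine tens_le_comap (φ := D ∘ₗ F) (fun l hl => ?_) ht
  clear ht t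
  induction hk : l.length using Nat.strong_induction_on generalizing l with
  | _ k ih =>
    rw [hDF, LinearMap.add_apply, conv_word, conv_word]
    have h1 : ∀ i, ∀ x ∈ l.take i, x ∈ K := fun i x hx => hl x (List.mem_of_mem_take hx)
    have h2 : ∀ i, ∀ x ∈ l.drop i, x ∈ K := fun i x hx => hl x (List.mem_of_mem_drop hx)
    refine add_mem (sum_mem fun i hi => ?_) (sum_mem fun i hi => ?_)
    · exact ι_mul_mem_tens (h _ (word_mem_tens (h1 i))) (hFK _ (word_mem_tens (h2 i)))
    · by_cases hi0 : i = 0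
      · subst hi0; simp [hF.map_one, hα]
      · by_cases hl0 : l.length = 0
        · have : l = [] := List.length_eq_zero_iff.1 hl0
          subst this; simp [hF.map_one, hα]
        · exact ι_mul_mem_tens (hαK _ (word_mem_tens (h1 i)))
            (ih (l.drop i).length (by rw [List.length_drop]; omega) _ (h2 i) rfl)

/-! ### Bilinear forms -/

/-- The pairing `∑ ω (φ (x₁ ⋯ x_i), ψ (x_{i+1} ⋯ x_n))`. -/
def pairing (ω : H →ₗ[ℂ] H →ₗ[ℂ] ℂ) (φ ψ : TensorAlgebra ℂ H →ₗ[ℂ] H) :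
    TensorAlgebra ℂ H →ₗ[ℂ] ℂ :=
  TensorProduct.lift ω ∘ₗ TensorProduct.map φ ψ ∘ₗ deconc

section Pairing

variable (ω : H →ₗ[ℂ] H →ₗ[ℂ] ℂ)

theorem pairing_word (φ ψ : TensorAlgebra ℂ H →ₗ[ℂ] H) (l : List H) : pairing ω φ ψ (word l) =
    ∑ i ∈ Finset.range (l.length + 1), ω (φ (word (l.take i))) (ψ (word (l.drop i))) := by
  simp [pairing, deconc_word]

theorem IsCohom.pairing_comp {F : TensorAlgebra ℂ H →ₗ[ℂ] TensorAlgebra ℂ H} (hF : IsCohom F)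
    (φ ψ : TensorAlgebra ℂ H →ₗ[ℂ] H) :
    pairing ω φ ψ ∘ₗ F = pairing ω (φ ∘ₗ F) (ψ ∘ₗ F) := by
  rw [pairing, LinearMap.comp_assoc, LinearMap.comp_assoc, hF.deconc_comp, pairing,
    TensorProduct.map_comp, LinearMap.comp_assoc]

theorem IsCoder.pairing_comp {α D : TensorAlgebra ℂ H →ₗ[ℂ] TensorAlgebra ℂ H} (hD : IsCoder α D)
    (φ ψ : TensorAlgebra ℂ H →ₗ[ℂ] H) :
    pairing ω φ ψ ∘ₗ D = pairing ω (φ ∘ₗ D) ψ + pairing ω (φ ∘ₗ α) (ψ ∘ₗ D) := by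
  rw [pairing, LinearMap.comp_assoc, LinearMap.comp_assoc, hD.deconc_comp, pairing, pairing,
    LinearMap.add_comp, LinearMap.comp_add, LinearMap.comp_add, TensorProduct.map_comp,
    ← LinearMap.comp_assoc deconc, ← TensorProduct.map_comp, LinearMap.comp_id,
    LinearMap.comp_assoc]

end Pairing

end TensorCoalgebra

open TensorCoalgebra

/-! ### Multilinear maps as linear maps on the tensor algebra -/

section Multi

variable {H : Type*} [AddCommGroup H] [Module ℂ H]

/-- The linear map on the tensor algebra with components `g_k`. -/
def MultiOps.lin (g : MultiOps H) : TensorAlgebra ℂ H →ₗ[ℂ] H := ofMultilinear g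

theorem MultiOps.lin_word (g : MultiOps H) (l : List H) : g.lin (word l) = g.on l :=
  ofMultilinear_word g l

theorem MultiOps.lin_word_ofFn (g : MultiOps H) {n : ℕ} (v : Fin n → H) :
    g.lin (word (List.ofFn v)) = g n v := by
  rw [← tprod_eq_word]; exact ofMultilinear_tprod g v

theorem MultiOps.lin_one (g : MultiOps H) (hg : g 0 = 0) : g.lin 1 = 0 := by
  rw [← word_nil, lin_word, MultiOps.on]
  simp [hg]

/-- The components of a linear map on the tensor algebra. -/
def TensorCoalgebra.toOps (φ : TensorAlgebra ℂ H →ₗ[ℂ] H) : MultiOps H :=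
  fun n => φ.compMultilinearMap (TensorAlgebra.tprod ℂ H n)

theorem TensorCoalgebra.toOps_on (φ : TensorAlgebra ℂ H →ₗ[ℂ] H) (l : List H) :
    (toOps φ).on l = φ (word l) := by
  rw [MultiOps.on, toOps, LinearMap.compMultilinearMap_apply, tprod_get]

theorem TensorCoalgebra.lin_toOps (φ : TensorAlgebra ℂ H →ₗ[ℂ] H) : (toOps φ).lin = φ :=
  ext_word fun l => by rw [MultiOps.lin_word, toOps_on]

theorem TensorCoalgebra.toOps_zero {φ : TensorAlgebra ℂ H →ₗ[ℂ] H} (h : φ 1 = 0) :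
    toOps φ 0 = 0 := by
  ext v
  rw [toOps, LinearMap.compMultilinearMap_apply, tprod_eq_word]
  simp [h]

namespace TensorCoalgebra

/-- The algebra map induced by a linear map. -/
def tmap (g : H →ₗ[ℂ] H) : TensorAlgebra ℂ H →ₗ[ℂ] TensorAlgebra ℂ H :=
  (TensorAlgebra.lift ℂ (TensorAlgebra.ι ℂ ∘ₗ g)).toLinearMap

theorem tmap_word (g : H →ₗ[ℂ] H) (l : List H) : tmap g (word l) = word (l.map g) := by
  induction l with
  | nil => simp [tmap]
  | cons x l ih =>
    rw [List.map_cons, word_cons, word_cons, ← ih]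
    simp [tmap]

@[simp] theorem tmap_one (g : H →ₗ[ℂ] H) : tmap g 1 = 1 := by simp [tmap]

@[simp] theorem tmap_ι (g : H →ₗ[ℂ] H) (x : H) :
    tmap g (TensorAlgebra.ι ℂ x) = TensorAlgebra.ι ℂ (g x) := by simp [tmap]

@[simp] theorem tmap_mul (g : H →ₗ[ℂ] H) (s t : TensorAlgebra ℂ H) :
    tmap g (s * t) = tmap g s * tmap g t := by simp [tmap]

theorem isCohom_tmap (g : H →ₗ[ℂ] H) : IsCohom (tmap g) where
  deconc_comp := ext_word fun l => by
    simp [tmap_word, deconc_word]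
  map_one := by simp
  counit_comp := ext_word fun l => by
    cases l with
    | nil => simp
    | cons x l => simp

theorem proj_comp_tmap (g : H →ₗ[ℂ] H) : proj ∘ₗ tmap g = g ∘ₗ proj := by
  refine ext_word fun l => ?_
  rw [LinearMap.comp_apply, LinearMap.comp_apply, tmap_word]
  rcases l with _ | ⟨x, _ | ⟨y, l⟩⟩
  · simp
  · simp
  · rw [proj_word _ (by simp), proj_word _ (by simp), map_zero]

theorem tmap_comp (g h : H →ₗ[ℂ] H) : tmap (g ∘ₗ h) = tmap g ∘ₗ tmap h := by
  refine ext_word fun l => ?_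
  simp [tmap_word]

theorem tmap_id : tmap (LinearMap.id : H →ₗ[ℂ] H) = LinearMap.id := by
  refine ext_word fun l => ?_
  simp [tmap_word]

/-! ### Sums over compositions -/

theorem sum_composition_succ {M : Type*} [AddCommMonoid M] (n : ℕ) (G : List ℕ → M) :
    ∑ c : Composition (n + 1), G c.blocks =
      ∑ i : Fin (n + 1), ∑ c : Composition (n - i), G ((i + 1 : ℕ) :: c.blocks) := by
  rw [← Fintype.sum_sigma']
  symm
  refine Fintype.sum_bijective
    (fun s : (Σ i : Fin (n + 1), Composition (n - i)) =>
      (⟨(s.1 + 1 : ℕ) :: s.2.blocks, by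
        intro i hi
        rcases List.mem_cons.1 hi with rfl | hi
        · omega
        · exact s.2.blocks_pos hi, by
        rw [List.sum_cons, s.2.blocks_sum]; have := s.1.2; omega⟩ : Composition (n + 1)))
    ⟨?_, ?_⟩ _ _ (fun s => rfl)
  · rintro ⟨i, c⟩ ⟨i', c'⟩ h
    have h := congrArg Composition.blocks h
    simp only [List.cons.injEq, Nat.add_right_cancel_iff] at h
    have hi : i = i' := Fin.ext h.1
    subst hi
    rw [Composition.ext h.2]
  · intro c
    rcases hb : c.blocks with _ | ⟨a, b⟩
    · have := c.blocks_sum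
      rw [hb] at this; simp at this
    · have hsum := c.blocks_sum
      rw [hb, List.sum_cons] at hsum
      have ha : 0 < a := c.blocks_pos (by rw [hb]; simp)
      refine ⟨⟨⟨a - 1, by omega⟩, ⟨b, fun hi => c.blocks_pos (by rw [hb]; simp [hi]), ?_⟩⟩, ?_⟩
      · simp only; omega
      · refine Composition.ext (Eq.trans ?_ hb.symm)
        simp only [List.cons.injEq, and_true]
        omega

theorem cohom_word_eq_sum {f : TensorAlgebra ℂ H →ₗ[ℂ] H} (hf : f 1 = 0) (n : ℕ) (l : List H)
    (hl : l.length = n) : cohom f (word l) =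
      ∑ c : Composition n, word ((l.splitWrtCompositionAux c.blocks).map (fun b => f (word b))) := by
  have hF := isCohom_cohom hf
  have hp : ∀ t, proj (cohom f t) = f t := fun t => LinearMap.congr_fun (proj_comp_cohom hf) t
  induction n using Nat.strong_induction_on generalizing l with
  | _ n ih =>
    cases n with
    | zero =>
      have : l = [] := List.length_eq_zero_iff.1 hl
      subst this
      rw [word_nil, hF.map_one, Fintype.sum_eq_single (Composition.ones 0)]
      · simp [List.splitWrtCompositionAux]
      · intro c hc
        refine absurd (Composition.ext ?_) hc
        rcases hb : c.blocks with _ | ⟨a, b⟩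
        · simp
        · have h1 : 0 < a := c.blocks_pos (by rw [hb]; simp)
          have h2 := c.blocks_sum
          rw [hb, List.sum_cons] at h2
          omega
    | succ n =>
      cases l with
      | nil => simp at hl
      | cons x l =>
        simp only [List.length_cons, Nat.add_right_cancel_iff] at hl
        rw [hF.map_word, sum_composition_succ n (fun bl => word
          (((x :: l).splitWrtCompositionAux bl).map (fun b => f (word b)))), hl,
          Finset.sum_range]
        refine Finset.sum_congr rfl fun i _ => ?_
        rw [ih (n - i) (by omega) (l.drop i) (by simp [hl]), Finset.mul_sum]
        refine Finset.sum_congr rfl fun c _ => ?_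
        rw [List.splitWrtCompositionAux_cons, List.map_cons, word_cons, hp]
        rfl

theorem ofFn_embedding {β : Type*} {n : ℕ} (c : Composition n) (v : Fin n → β) :
    (List.ofFn v).splitWrtCompositionAux c.blocks =
      List.ofFn (fun i : Fin c.length => List.ofFn (v ∘ c.embedding i)) := by
  refine List.ext_getElem ?_ fun i h1 h2 => ?_
  · simp [List.length_splitWrtCompositionAux]
  · rw [List.length_ofFn] at h2
    refine Eq.trans (List.getElem_splitWrtComposition' (List.ofFn v) c h1) ?_
    refine List.ext_getElem ?_ fun j h3 h4 => ?_
    · have hle := c.sizeUpTo_le (i + 1)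
      have := c.sizeUpTo_succ' ⟨i, h2⟩
      simp at this ⊢
      omega
    · simp
      rfl

theorem blockSum_eq (g f : MultiOps H) (hf : f 0 = 0) {n : ℕ} (v : Fin n → H) :
    g.blockSum f v = g.lin (cohom f.lin (word (List.ofFn v))) := by
  rw [cohom_word_eq_sum (f.lin_one hf) n _ (by simp), map_sum, MultiOps.blockSum]
  refine Finset.sum_congr rfl fun c _ => ?_
  rw [ofFn_embedding, List.map_ofFn, MultiOps.lin_word_ofFn]
  congr 1
  ext i
  simp [MultiOps.lin_word_ofFn]

/-! ### Sums over planar trees -/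

/-- The part of `φ` on words of length at least two. -/
def higher (φ : TensorAlgebra ℂ H →ₗ[ℂ] H) : TensorAlgebra ℂ H →ₗ[ℂ] H :=
  glue (fun n => if n ≤ 1 then 0 else φ)

theorem higher_word_of_le (φ : TensorAlgebra ℂ H →ₗ[ℂ] H) {l : List H} (h : l.length ≤ 1) :
    higher φ (word l) = 0 := by
  rw [higher, glue_word, if_pos h]; rfl

theorem higher_word_of_lt (φ : TensorAlgebra ℂ H →ₗ[ℂ] H) {l : List H} (h : 1 < l.length) :
    higher φ (word l) = φ (word l) := by
  rw [higher, glue_word, if_neg (by omega)]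

theorem sum_planarTree {M : Type*} [AddCommMonoid M] {n : ℕ} (hn : n ≠ 1) (φ : PlanarTree n → M) :
    ∑ Γ, φ Γ = ∑ c : {c : Composition n // 2 ≤ c.length},
      ∑ b : (i : Fin c.1.length) → PlanarTree (c.1.blocksFun i), φ (.node c.1 c.2 b) := by
  rw [← Fintype.sum_sigma']
  symm
  refine Fintype.sum_bijective
    (fun s : (Σ c : {c : Composition n // 2 ≤ c.length},
      ((i : Fin c.1.length) → PlanarTree (c.1.blocksFun i))) => PlanarTree.node s.1.1 s.1.2 s.2)
    ⟨?_, ?_⟩ _ _ (fun s => rfl)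
  · rintro ⟨⟨c, hc⟩, b⟩ ⟨⟨c', hc'⟩, b'⟩ h
    simp only [PlanarTree.node.injEq] at h
    obtain ⟨rfl, h⟩ := h
    rw [eq_of_heq h]
  · intro Γ
    cases Γ with
    | leaf => exact absurd rfl hn
    | node c hc b => exact ⟨⟨⟨c, hc⟩, b⟩, rfl⟩

theorem sum_planarTree_one {M : Type*} [AddCommMonoid M] (φ : PlanarTree 1 → M) :
    ∑ Γ, φ Γ = φ .leaf := by
  refine Fintype.sum_eq_single _ fun Γ hΓ => ?_
  cases Γ with
  | leaf => exact absurd rfl hΓ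
  | node c hc b => have := c.length_le; omega

theorem blocksFun_lt {n : ℕ} (c : Composition n) (hc : 2 ≤ c.length) (i : Fin c.length) :
    c.blocksFun i < n := by
  have hn : 0 < n := by have := c.length_le; omega
  refine (Composition.ne_single_iff hn).1 ?_ i
  rintro rfl
  rw [Composition.single_length] at hc
  omega

theorem sum_node_edgeValue (m : MultiOps H) (R : H →ₗ[ℂ] H) {e : TensorAlgebra ℂ H →ₗ[ℂ] H}
    (he1 : e 1 = 0) {n : ℕ} (v : Fin n → H)
    (h : ∀ k < n, ∀ u : Fin k → H,
      ∑ Γ : PlanarTree k, ConformalBackground.edgeValue m R Γ u = e (word (List.ofFn u))) :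
    ∑ c : {c : Composition n // 2 ≤ c.length},
      ∑ b : (i : Fin c.1.length) → PlanarTree (c.1.blocksFun i),
        m c.1.length (fun i => ConformalBackground.edgeValue m R (b i) (v ∘ c.1.embedding i)) =
      higher m.lin (cohom e (word (List.ofFn v))) := by
  have h1 : ∀ c : {c : Composition n // 2 ≤ c.length},
      ∑ b : (i : Fin c.1.length) → PlanarTree (c.1.blocksFun i),
        m c.1.length (fun i => ConformalBackground.edgeValue m R (b i) (v ∘ c.1.embedding i)) =
      higher m.lin (word (((List.ofFn v).splitWrtCompositionAux c.1.blocks).map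
        (fun b => e (word b)))) := by
    rintro ⟨c, hc⟩
    rw [ofFn_embedding, List.map_ofFn, higher_word_of_lt _ (by rw [List.length_ofFn]; exact hc),
      MultiOps.lin_word_ofFn]
    refine ((m c.length).map_sum (fun i Γ =>
      ConformalBackground.edgeValue m R Γ (v ∘ c.embedding i))).symm.trans ?_
    congr 1
    ext i
    exact h _ (blocksFun_lt c hc i) _
  rw [Finset.sum_congr rfl fun c _ => h1 c, cohom_word_eq_sum he1 n _ (by simp), map_sum]
  rw [← Finset.sum_subtype (Finset.univ.filter fun c : Composition n => 2 ≤ c.length) (by simp)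
    (fun c : Composition n => higher m.lin (word
      (((List.ofFn v).splitWrtCompositionAux c.blocks).map (fun b => e (word b)))))]
  refine Finset.sum_filter_of_ne fun c _ hne => ?_
  by_contra hlt
  refine hne (higher_word_of_le _ ?_)
  rw [List.length_map, List.length_splitWrtCompositionAux, Composition.blocks_length]
  omega

/-- The operators of the trees with an internal root edge sum to the solution of
`e = proj - R ∘ m_{≥ 2} ∘ e`. -/
theorem sum_edgeValue (m : MultiOps H) (R : H →ₗ[ℂ] H) {e : TensorAlgebra ℂ H →ₗ[ℂ] H}
    (he1 : e 1 = 0) (he : ∀ t, e t = proj t - R (higher m.lin (cohom e t)))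
    {n : ℕ} (v : Fin n → H) :
    ∑ Γ : PlanarTree n, ConformalBackground.edgeValue m R Γ v = e (word (List.ofFn v)) := by
  induction n using Nat.strong_induction_on with
  | _ n ih =>
    by_cases hn : n = 1
    · subst hn
      have hF := isCohom_cohom he1
      have h1 : higher m.lin (cohom e (TensorAlgebra.ι ℂ (v 0))) = 0 := by
        rw [hF.map_ι, ← word_singleton, higher_word_of_le _ (by simp)]
      rw [sum_planarTree_one, he, List.ofFn_succ, List.ofFn_zero, word_singleton, h1]
      simp [ConformalBackground.edgeValue]
    · rw [sum_planarTree hn, he, proj_word _ (by simpa using hn), zero_sub,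
        ← sum_node_edgeValue m R he1 v ih, map_sum, ← Finset.sum_neg_distrib]
      refine Finset.sum_congr rfl fun c _ => ?_
      rw [map_sum, ← Finset.sum_neg_distrib]
      rfl

theorem sum_treeValue (m : MultiOps H) (R : H →ₗ[ℂ] H) {e : TensorAlgebra ℂ H →ₗ[ℂ] H}
    (he1 : e 1 = 0) (he : ∀ t, e t = proj t - R (higher m.lin (cohom e t)))
    {n : ℕ} (hn : n ≠ 1) (v : Fin n → H) :
    ∑ Γ : PlanarTree n, ConformalBackground.treeValue m R Γ v =
      higher m.lin (cohom e (word (List.ofFn v))) := by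
  rw [sum_planarTree hn, ← sum_node_edgeValue m R he1 v (fun k _ u => sum_edgeValue m R he1 he u)]
  rfl

end TensorCoalgebra

end Multi

namespace TensorCoalgebra

variable {H : Type*} [AddCommGroup H] [Module ℂ H]

theorem isCoder_zero (α : TensorAlgebra ℂ H →ₗ[ℂ] TensorAlgebra ℂ H) : IsCoder α 0 :=
  ⟨by simp, by simp, by simp⟩

theorem IsCoder.smul {α D : TensorAlgebra ℂ H →ₗ[ℂ] TensorAlgebra ℂ H} (hD : IsCoder α D) (c : ℂ) :
    IsCoder α (c • D) where
  deconc_comp := by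
    rw [LinearMap.comp_smul, hD.deconc_comp, TensorProduct.map_smul_left,
      TensorProduct.map_smul_right, ← smul_add, LinearMap.smul_comp]
  map_one := by simp [hD.map_one]
  counit_comp := by rw [LinearMap.comp_smul, hD.counit_comp, smul_zero]

/-- The anticommutator of two odd coderivations is an even coderivation. -/
theorem IsCoder.anticomm {α D D' : TensorAlgebra ℂ H →ₗ[ℂ] TensorAlgebra ℂ H}
    (hD : IsCoder α D) (hD' : IsCoder α D') (hα : α ∘ₗ α = LinearMap.id)
    (h : α ∘ₗ D = -(D ∘ₗ α)) (h' : α ∘ₗ D' = -(D' ∘ₗ α)) :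
    IsCoder LinearMap.id (D ∘ₗ D' + D' ∘ₗ D) where
  deconc_comp := by
    have key : ∀ {A A' : TensorAlgebra ℂ H →ₗ[ℂ] TensorAlgebra ℂ H}, IsCoder α A → IsCoder α A' →
        deconc ∘ₗ (A ∘ₗ A') = (TensorProduct.map (A ∘ₗ A') LinearMap.id +
          TensorProduct.map (A ∘ₗ α) A' + TensorProduct.map (α ∘ₗ A') A +
          TensorProduct.map LinearMap.id (A ∘ₗ A')) ∘ₗ deconc := by
      intro A A' hA hA'
      rw [← LinearMap.comp_assoc, hA.deconc_comp, LinearMap.comp_assoc, hA'.deconc_comp,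
        ← LinearMap.comp_assoc]
      congr 1
      rw [LinearMap.add_comp, LinearMap.comp_add, LinearMap.comp_add, ← TensorProduct.map_comp,
        ← TensorProduct.map_comp, ← TensorProduct.map_comp, ← TensorProduct.map_comp, hα]
      simp only [LinearMap.comp_id, LinearMap.id_comp]
      abel
    have neg : ∀ φ ψ : TensorAlgebra ℂ H →ₗ[ℂ] TensorAlgebra ℂ H,
        TensorProduct.map (-φ) ψ = -TensorProduct.map φ ψ := by
      intro φ ψ; ext a b; simp [TensorProduct.neg_tmul]
    rw [LinearMap.comp_add, key hD hD', key hD' hD, ← LinearMap.add_comp, h, h', neg, neg,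
      TensorProduct.map_add_left, TensorProduct.map_add_right]
    congr 1
    abel
  map_one := by simp [hD.map_one, hD'.map_one]
  counit_comp := by
    rw [LinearMap.comp_add, ← LinearMap.comp_assoc, ← LinearMap.comp_assoc, hD.counit_comp,
      hD'.counit_comp]; simp

theorem IsCoder.sq_eq_zero {α D : TensorAlgebra ℂ H →ₗ[ℂ] TensorAlgebra ℂ H}
    (hD : IsCoder α D) (hα : α ∘ₗ α = LinearMap.id) (h : α ∘ₗ D = -(D ∘ₗ α))
    (h0 : proj ∘ₗ D ∘ₗ D = 0) : D ∘ₗ D = 0 := by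
  have := (hD.anticomm hD hα h h).ext rfl (isCoder_zero _)
    (by rw [LinearMap.comp_add, h0]; simp)
  rw [← two_smul ℂ] at this
  exact (smul_eq_zero.1 this).resolve_left two_ne_zero

theorem coder_word (α : TensorAlgebra ℂ H →ₗ[ℂ] TensorAlgebra ℂ H) (m : TensorAlgebra ℂ H →ₗ[ℂ] H)
    (hm : m 1 = 0) (l : List H) : coder α m (word l) =
      ∑ j ∈ Finset.range l.length, ∑ b ∈ Finset.Icc 1 (l.length - j),
        α (word (l.take j)) *
          (TensorAlgebra.ι ℂ (m (word ((l.drop j).take b))) * word (l.drop (j + b))) := by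
  rw [coder, conv_word, Finset.sum_range_succ]
  have h0 : conv (TensorAlgebra.ι ℂ ∘ₗ m) LinearMap.id (word (l.drop l.length)) = 0 := by
    simp [conv_one_apply, hm]
  rw [h0, mul_zero, add_zero]
  refine Finset.sum_congr rfl fun j _ => ?_
  rw [conv_word, Finset.mul_sum, Finset.sum_range_succ', List.length_drop,
    ← Finset.Ico_add_one_right_eq_Icc, Finset.sum_Ico_eq_sum_range]
  simp [hm, List.drop_drop, add_comm]

end TensorCoalgebra

namespace ConformalBackground

variable {H : Type*} [AddCommGroup H] [Module ℂ H] (B : ConformalBackground H)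

/-- The decomposition of `H` into its homogeneous parts. -/
def decomp : (DirectSum ℤ fun d => B.deg d) ≃ₗ[ℂ] H :=
  LinearEquiv.ofBijective (DirectSum.coeLinearMap B.deg) B.isInternal

/-- The operator which multiplies the elements of degree `d` by `z ^ d`. -/
def scale (z : ℂ) : H →ₗ[ℂ] H :=
  DirectSum.toModule ℂ ℤ H (fun d => (z ^ d) • (B.deg d).subtype) ∘ₗ B.decomp.symm.toLinearMap

theorem decomp_lof (d : ℤ) (x : B.deg d) :
    B.decomp (DirectSum.lof ℂ ℤ (fun d => B.deg d) d x) = x :=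
  DirectSum.coeLinearMap_lof B.deg d x

theorem decomp_symm_of_mem {d : ℤ} {x : H} (hx : x ∈ B.deg d) :
    B.decomp.symm x = DirectSum.lof ℂ ℤ (fun d => B.deg d) d ⟨x, hx⟩ := by
  rw [LinearEquiv.symm_apply_eq, decomp_lof]

theorem scale_of_mem (z : ℂ) {d : ℤ} {x : H} (hx : x ∈ B.deg d) : B.scale z x = z ^ d • x := by
  rw [scale, LinearMap.comp_apply, LinearEquiv.coe_coe, B.decomp_symm_of_mem hx,
    DirectSum.toModule_lof]
  rfl

theorem ext_deg {M : Type*} [AddCommGroup M] [Module ℂ M] {φ ψ : H →ₗ[ℂ] M}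
    (h : ∀ d, ∀ x ∈ B.deg d, φ x = ψ x) : φ = ψ := by
  have : φ ∘ₗ B.decomp.toLinearMap = ψ ∘ₗ B.decomp.toLinearMap := by
    refine DirectSum.linearMap_ext ℂ fun d => ?_
    ext x
    simpa [decomp_lof] using h d x x.2
  ext x
  simpa using LinearMap.congr_fun this (B.decomp.symm x)

theorem ext_homog {M : Type*} [AddCommGroup M] [Module ℂ M] {φ ψ : TensorAlgebra ℂ H →ₗ[ℂ] M}
    (h : ∀ l : List B.Homog, φ (word (B.vecs l)) = ψ (word (B.vecs l))) : φ = ψ := by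
  refine ext_word fun l => ?_
  induction l generalizing φ ψ with
  | nil => exact h []
  | cons x l ih =>
    have : φ ∘ₗ LinearMap.mulRight ℂ (word l) ∘ₗ TensorAlgebra.ι ℂ =
        ψ ∘ₗ LinearMap.mulRight ℂ (word l) ∘ₗ TensorAlgebra.ι ℂ := by
      refine B.ext_deg fun d y hy => ?_
      refine ih (φ := φ ∘ₗ LinearMap.mulLeft ℂ (TensorAlgebra.ι ℂ y))
        (ψ := ψ ∘ₗ LinearMap.mulLeft ℂ (TensorAlgebra.ι ℂ y)) fun l' => ?_
      simpa [vecs] using h (⟨d, y, hy⟩ :: l')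
    simpa using LinearMap.congr_fun this x

theorem mem_deg_of_scale {d : ℤ} {y : H} (h : B.scale 2 y = (2 : ℂ) ^ d • y) : y ∈ B.deg d := by
  have h1 : ∀ c : DirectSum ℤ fun d => B.deg d, ∀ e : ℤ,
      (B.decomp.symm (B.scale 2 (B.decomp c))) e = (2 : ℂ) ^ e • c e := by
    intro c e
    induction c using DirectSum.induction_on with
    | zero => simp
    | of i x =>
      have hx : B.decomp (DirectSum.of (fun d => B.deg d) i x) = x := by
        rw [← DirectSum.lof_eq_of ℂ, decomp_lof]
      rw [hx, B.scale_of_mem 2 x.2, map_smul, B.decomp_symm_of_mem x.2, DirectSum.smul_apply,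
        DirectSum.lof_eq_of]
      by_cases hie : i = e
      · subst hie; rfl
      · rw [DirectSum.of_eq_of_ne _ _ _ (Ne.symm hie)]; simp
    | add a b ha hb => simp only [map_add, DirectSum.add_apply, ha, hb, smul_add]
  set c := B.decomp.symm y with hc
  have hy : B.decomp c = y := by simp [hc]
  have h2 : ∀ e, e ≠ d → c e = 0 := by
    intro e he
    have := h1 c e
    rw [hy, h, map_smul, DirectSum.smul_apply, ← hc] at this
    have h3 : ((2 : ℂ) ^ d - (2 : ℂ) ^ e) • c e = 0 := by rw [sub_smul, this, sub_self]
    refine (smul_eq_zero.1 h3).resolve_left fun h4 => he ?_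
    have h5 : (2 : ℝ) ^ d = (2 : ℝ) ^ e := by
      simpa [norm_zpow] using congrArg norm (sub_eq_zero.1 h4)
    exact (zpow_right_injective₀ (by norm_num) (by norm_num) h5).symm
  have h6 : c = DirectSum.of (fun d => B.deg d) d (c d) := by
    refine DFinsupp.ext fun e => ?_
    by_cases he : e = d
    · subst he; rw [DirectSum.of_eq_same]
    · rw [DirectSum.of_eq_of_ne _ _ _ he]; exact h2 e he
  rw [← hy, h6, ← DirectSum.lof_eq_of ℂ, decomp_lof]
  exact (c d).2

/-- The grading involution. -/
abbrev sgn : H →ₗ[ℂ] H := B.scale (-1)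

theorem scale_scale (z z' : ℂ) : B.scale z ∘ₗ B.scale z' = B.scale (z * z') := by
  refine B.ext_deg fun d x hx => ?_
  rw [LinearMap.comp_apply, B.scale_of_mem z' hx, map_smul, B.scale_of_mem z hx,
    B.scale_of_mem _ hx, smul_smul, mul_zpow, mul_comm]

theorem scale_one : B.scale 1 = LinearMap.id := by
  refine B.ext_deg fun d x hx => ?_
  rw [B.scale_of_mem _ hx]; simp

theorem sgn_comp_sgn : B.sgn ∘ₗ B.sgn = LinearMap.id := by
  rw [scale_scale, neg_mul_neg, one_mul, scale_one]

theorem sgn_sgn (x : H) : B.sgn (B.sgn x) = x := LinearMap.congr_fun B.sgn_comp_sgn x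

theorem eq_zero_of_ω {x : H} (h : ∀ y, B.ω y x = 0) : x = 0 :=
  B.ω_nondeg x fun y => by rw [B.ω_skew y x, h y, neg_zero]

theorem scale_of_opHasDegree {e : ℤ} {g : H →ₗ[ℂ] H} (hg : B.OpHasDegree e g) {z : ℂ} (hz : z ≠ 0) :
    B.scale z ∘ₗ g = z ^ e • (g ∘ₗ B.scale z) := by
  refine B.ext_deg fun d x hx => ?_
  simp only [LinearMap.comp_apply, LinearMap.smul_apply, B.scale_of_mem z hx,
    B.scale_of_mem z (hg d x hx), map_smul, smul_smul]
  rw [zpow_add₀ hz, mul_comm]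

theorem sgn_of_opHasDegree_neg_one {g : H →ₗ[ℂ] H} (hg : B.OpHasDegree (-1) g) (x : H) :
    B.sgn (g x) = -g (B.sgn x) := by
  have := LinearMap.congr_fun (B.scale_of_opHasDegree hg (z := -1) (by norm_num)) x
  simpa using this

theorem sgn_of_opHasDegree_one {g : H →ₗ[ℂ] H} (hg : B.OpHasDegree 1 g) (x : H) :
    B.sgn (g x) = -g (B.sgn x) := by
  have := LinearMap.congr_fun (B.scale_of_opHasDegree hg (z := -1) (by norm_num)) x
  simpa using this

theorem tmap_scale_vecs {z : ℂ} (hz : z ≠ 0) (l : List B.Homog) :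
    tmap (B.scale z) (word (B.vecs l)) = z ^ B.totalDeg l • word (B.vecs l) := by
  induction l with
  | nil => simp [vecs, totalDeg]
  | cons o l ih =>
    have hv : B.vecs (o :: l) = (o.2 : H) :: B.vecs l := rfl
    have hd : B.totalDeg (o :: l) = o.1 + B.totalDeg l := by simp [totalDeg]
    rw [hv, word_cons, tmap_mul, ih, tmap_ι, B.scale_of_mem z o.2.2, hd, zpow_add₀ hz, map_smul,
      smul_mul_smul_comm]

/-- A linear map on the tensor algebra with components of degree `e`. -/
def Deg (e : ℤ) (φ : TensorAlgebra ℂ H →ₗ[ℂ] H) : Prop :=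
  ∀ z : ℂ, z ≠ 0 → B.scale z ∘ₗ φ = z ^ e • (φ ∘ₗ tmap (B.scale z))

theorem deg_lin {e : ℤ} {g : MultiOps H} (hg : B.HasDegree e g) : B.Deg e g.lin := by
  intro z hz
  refine B.ext_homog fun l => ?_
  have h := hg l
  rw [LinearMap.comp_apply, LinearMap.smul_apply, LinearMap.comp_apply, B.tmap_scale_vecs hz,
    map_smul, MultiOps.lin_word, B.scale_of_mem z h, smul_smul, zpow_add₀ hz, mul_comm]

theorem hasDegree_of_deg {e : ℤ} {g : MultiOps H} (hg : B.Deg e g.lin) : B.HasDegree e g := by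
  intro l
  refine B.mem_deg_of_scale ?_
  have h := LinearMap.congr_fun (hg 2 two_ne_zero) (word (B.vecs l))
  rw [LinearMap.comp_apply, LinearMap.smul_apply, LinearMap.comp_apply,
    B.tmap_scale_vecs two_ne_zero, map_smul, MultiOps.lin_word, smul_smul] at h
  rw [h, zpow_add₀ two_ne_zero, mul_comm]

theorem insertSum_eq (g m : MultiOps H) (hm : m 0 = 0) (l : List B.Homog) :
    B.insertSum g m l = g.lin (coder (tmap B.sgn) m.lin (word (B.vecs l))) := by
  rw [coder_word _ _ (m.lin_one hm), map_sum, insertSum]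
  have hlen : (B.vecs l).length = l.length := by simp [vecs]
  rw [hlen]
  refine Finset.sum_congr rfl fun j _ => ?_
  rw [map_sum]
  refine Finset.sum_congr rfl fun b _ => ?_
  have h1 : (B.vecs l).take j = B.vecs (l.take j) := by simp [vecs, List.map_take]
  have h2 : ((B.vecs l).drop j).take b = B.vecs ((l.drop j).take b) := by
    simp [vecs, List.map_take, List.map_drop]
  have h3 : (B.vecs l).drop (j + b) = B.vecs (l.drop (j + b)) := by
    simp [vecs, List.map_drop]
  rw [h1, h2, h3, B.tmap_scale_vecs (by norm_num), ← word_cons, smul_mul_assoc, ← word_append,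
    map_smul, MultiOps.lin_word, MultiOps.lin_word]

/-- The bilinear form `ω` on words of length two. -/
abbrev form : TensorAlgebra ℂ H →ₗ[ℂ] ℂ := pairing B.ω proj proj

/-- The operator `D` is the coderivation of a cyclic `A∞`-structure with linear part `Q`. -/
structure IsAlg (D : TensorAlgebra ℂ H →ₗ[ℂ] TensorAlgebra ℂ H) : Prop where
  coder : IsCoder (tmap B.sgn) D
  deg : ∀ z : ℂ, z ≠ 0 → tmap (B.scale z) ∘ₗ D = z • (D ∘ₗ tmap (B.scale z))
  cyclic : B.form ∘ₗ D = 0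
  sq : D ∘ₗ D = 0
  linear : ∀ x, D (TensorAlgebra.ι ℂ x) = TensorAlgebra.ι ℂ (B.Q x)

/-- The operator `F` is a symplectic coalgebra morphism of degree zero. -/
structure IsSymp (F : TensorAlgebra ℂ H →ₗ[ℂ] TensorAlgebra ℂ H) : Prop where
  cohom : IsCohom F
  deg : ∀ z : ℂ, z ≠ 0 → tmap (B.scale z) ∘ₗ F = F ∘ₗ tmap (B.scale z)
  symp : B.form ∘ₗ F = B.form

variable {B}

theorem IsSymp.comp {F G : TensorAlgebra ℂ H →ₗ[ℂ] TensorAlgebra ℂ H} (hF : B.IsSymp F)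
    (hG : B.IsSymp G) : B.IsSymp (F ∘ₗ G) where
  cohom := hF.cohom.comp hG.cohom
  deg z hz := by
    rw [← LinearMap.comp_assoc, hF.deg z hz, LinearMap.comp_assoc, hG.deg z hz,
      LinearMap.comp_assoc]
  symp := by rw [← LinearMap.comp_assoc, hF.symp, hG.symp]

theorem IsSymp.of_inverse {F G : TensorAlgebra ℂ H →ₗ[ℂ] TensorAlgebra ℂ H} (hF : B.IsSymp F)
    (hFG : F ∘ₗ G = LinearMap.id) (hGF : G ∘ₗ F = LinearMap.id) : B.IsSymp G where
  cohom := hF.cohom.of_inverse hFG hGF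
  deg z hz := by
    have h : G ∘ₗ (F ∘ₗ tmap (B.scale z)) ∘ₗ G = tmap (B.scale z) ∘ₗ G := by
      rw [← LinearMap.comp_assoc, ← LinearMap.comp_assoc, hGF, LinearMap.id_comp]
    rw [← h, ← hF.deg z hz, LinearMap.comp_assoc, hFG, LinearMap.comp_id]
  symp := by
    nth_rw 1 [← hF.symp]
    rw [LinearMap.comp_assoc, hFG, LinearMap.comp_id]

theorem tmap_sgn_comp : tmap B.sgn ∘ₗ tmap B.sgn = LinearMap.id := by
  rw [← tmap_comp, B.sgn_comp_sgn, tmap_id]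

theorem IsAlg.conj {D F G : TensorAlgebra ℂ H →ₗ[ℂ] TensorAlgebra ℂ H} (hD : B.IsAlg D)
    (hF : B.IsSymp F) (hFG : F ∘ₗ G = LinearMap.id) (hGF : G ∘ₗ F = LinearMap.id)
    (hlin : ∀ x, F (D (G (TensorAlgebra.ι ℂ x))) = TensorAlgebra.ι ℂ (B.Q x)) :
    B.IsAlg (F ∘ₗ D ∘ₗ G) where
  coder := hD.coder.conj hF.cohom hFG hGF (hF.deg (-1) (by norm_num)).symm
  deg z hz := by
    have hG := hF.of_inverse hFG hGF
    rw [← LinearMap.comp_assoc, hF.deg z hz, LinearMap.comp_assoc, ← LinearMap.comp_assoc G,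
      hD.deg z hz, LinearMap.smul_comp, LinearMap.comp_smul, LinearMap.comp_assoc G, hG.deg z hz]
    simp only [LinearMap.comp_assoc]
  cyclic := by
    rw [← LinearMap.comp_assoc, hF.symp, ← LinearMap.comp_assoc, hD.cyclic, LinearMap.zero_comp]
  sq := by
    have : (F ∘ₗ D ∘ₗ G) ∘ₗ F ∘ₗ D ∘ₗ G = F ∘ₗ D ∘ₗ (G ∘ₗ F) ∘ₗ D ∘ₗ G := by
      simp only [LinearMap.comp_assoc]
    rw [this, hGF, LinearMap.id_comp, ← LinearMap.comp_assoc G, hD.sq]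
    simp
  linear := hlin

/-- Corestrictions of degree `e` give coderivations of degree `e`. -/
theorem coder_deg {e : ℤ} {m : TensorAlgebra ℂ H →ₗ[ℂ] H} (hm1 : m 1 = 0) (hm : B.Deg e m)
    (w : ℂ) {z : ℂ} (hz : z ≠ 0) :
    tmap (B.scale z) ∘ₗ coder (tmap (B.scale w)) m =
      z ^ e • (coder (tmap (B.scale w)) m ∘ₗ tmap (B.scale z)) := by
  have hc : IsCoder (tmap (B.scale w)) (coder (tmap (B.scale w)) m) :=
    isCoder_coder (isCohom_tmap _) hm1
  have h1 : tmap (B.scale z) ∘ₗ tmap (B.scale z⁻¹) = LinearMap.id := by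
    rw [← tmap_comp, scale_scale, mul_inv_cancel₀ hz, scale_one, tmap_id]
  have h2 : tmap (B.scale z⁻¹) ∘ₗ tmap (B.scale z) = LinearMap.id := by
    rw [← tmap_comp, scale_scale, inv_mul_cancel₀ hz, scale_one, tmap_id]
  have h3 : tmap (B.scale z) ∘ₗ tmap (B.scale w) = tmap (B.scale w) ∘ₗ tmap (B.scale z) := by
    rw [← tmap_comp, ← tmap_comp, scale_scale, scale_scale, mul_comm]
  have h4 := (hc.conj (isCohom_tmap _) h1 h2 h3).ext (by simp) (hc.smul (z ^ e)) (by
    rw [← LinearMap.comp_assoc, proj_comp_tmap, LinearMap.comp_assoc,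
      ← LinearMap.comp_assoc _ _ proj, proj_comp_coder (isCohom_tmap _) hm1,
      ← LinearMap.comp_assoc, hm z hz, LinearMap.smul_comp, LinearMap.comp_assoc, h1,
      LinearMap.comp_id, LinearMap.comp_smul, proj_comp_coder (isCohom_tmap _) hm1])
  rw [← LinearMap.smul_comp, ← h4, LinearMap.comp_assoc, LinearMap.comp_assoc, h2,
    LinearMap.comp_id]

theorem cohom_deg {f : TensorAlgebra ℂ H →ₗ[ℂ] H} (hf1 : f 1 = 0) (hf : B.Deg 0 f)
    {z : ℂ} (hz : z ≠ 0) : tmap (B.scale z) ∘ₗ cohom f = cohom f ∘ₗ tmap (B.scale z) := by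
  have hF := isCohom_cohom hf1
  refine ((isCohom_tmap _).comp hF).ext (hF.comp (isCohom_tmap _)) ?_
  rw [← LinearMap.comp_assoc, proj_comp_tmap, LinearMap.comp_assoc, proj_comp_cohom hf1,
    ← LinearMap.comp_assoc, proj_comp_cohom hf1, hf z hz]
  simp

theorem form_comp_coder {α D : TensorAlgebra ℂ H →ₗ[ℂ] TensorAlgebra ℂ H} (hD : IsCoder α D) :
    B.form ∘ₗ D = pairing B.ω (proj ∘ₗ D) proj + pairing B.ω (proj ∘ₗ α) (proj ∘ₗ D) :=
  hD.pairing_comp B.ω proj proj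

theorem pairing_proj_right (φ : TensorAlgebra ℂ H →ₗ[ℂ] H) (l : List H) (x : H) :
    pairing B.ω φ proj (word (l ++ [x])) = B.ω (φ (word l)) x := by
  rw [pairing_word, Finset.sum_eq_single l.length]
  · simp
  · intro i hi hne
    have hi := Finset.mem_range.1 hi
    rw [proj_word (List.drop i (l ++ [x]))]
    · simp
    · simp at hi ⊢; omega
  · simp

theorem pairing_proj_left (ψ : TensorAlgebra ℂ H →ₗ[ℂ] H) (g : H →ₗ[ℂ] H) (x : H) (l : List H) :
    pairing B.ω (g ∘ₗ proj) ψ (word (x :: l)) = B.ω (g x) (ψ (word l)) := by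
  rw [pairing_word, Finset.sum_eq_single 1]
  · simp
  · intro i hi hne
    have hi := Finset.mem_range.1 hi
    rw [LinearMap.comp_apply, proj_word (List.take i (x :: l))]
    · simp
    · simp at hi ⊢; omega
  · simp

end ConformalBackground

namespace ConformalBackground

variable {H : Type*} [AddCommGroup H] [Module ℂ H] {B : ConformalBackground H}

/-! ### The master equation and the `A∞`-relations -/

theorem vecs_append (l l' : List B.Homog) : B.vecs (l ++ l') = B.vecs l ++ B.vecs l' := by
  simp [vecs]

theorem vecs_cons (o : B.Homog) (l : List B.Homog) : B.vecs (o :: l) = (o.2 : H) :: B.vecs l := rfl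

theorem totalDeg_append (l l' : List B.Homog) :
    B.totalDeg (l ++ l') = B.totalDeg l + B.totalDeg l' := by
  simp [totalDeg]

theorem totalDeg_cons (o : B.Homog) (l : List B.Homog) :
    B.totalDeg (o :: l) = o.1 + B.totalDeg l := by
  simp [totalDeg]

theorem totalDeg_take_add_drop (l : List B.Homog) (i : ℕ) :
    B.totalDeg (l.take i) + B.totalDeg (l.drop i) = B.totalDeg l := by
  rw [← totalDeg_append, List.take_append_drop]

theorem neg_one_zpow_mul_self (d : ℤ) : (-1 : ℂ) ^ d * (-1 : ℂ) ^ d = 1 := by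
  rw [← mul_zpow]; simp

theorem IsCyclic.rotate {m : MultiOps H} (hm : B.IsCyclic m) (z y : B.Homog)
    (a c : List B.Homog) :
    B.ω z.2 (m.on (B.vecs (a ++ y :: c))) =
      (-1 : ℂ) ^ (y.1 + B.totalDeg a) * B.ω y.2 (m.on (B.vecs (c ++ z :: a))) := by
  induction a generalizing z c with
  | nil => simpa [totalDeg] using hm z y c
  | cons x a ih =>
    have h1 := hm z x (a ++ y :: c)
    have h2 := ih x (c ++ [z])
    have e1 : a ++ y :: c ++ [z] = a ++ y :: (c ++ [z]) := by simp
    have e2 : c ++ [z] ++ x :: a = c ++ z :: x :: a := by simp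
    rw [e1] at h1
    rw [e2] at h2
    rw [List.cons_append, h1, h2, totalDeg_cons, ← mul_assoc, ← zpow_add₀ (by norm_num)]
    congr 2
    ring

/-- The contraction of the vertices with inputs `I` and `J`. -/
def arcPairing (m : MultiOps H) (I J : List B.Homog) : ℂ :=
  (-1 : ℂ) ^ B.totalDeg I * B.ω (m.on (B.vecs I)) (m.on (B.vecs J))

theorem arcPairing_comm (m : MultiOps H) {I J : List B.Homog}
    (h : B.totalDeg I + B.totalDeg J = -1) : arcPairing m I J = arcPairing m J I := by
  have hJ : B.totalDeg J = -1 - B.totalDeg I := by omega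
  rw [arcPairing, arcPairing, hJ, B.ω_skew (m.on (B.vecs I)), zpow_sub₀ (by norm_num)]
  have h1 : ((-1 : ℂ) ^ B.totalDeg I)⁻¹ = (-1 : ℂ) ^ B.totalDeg I :=
    inv_eq_of_mul_eq_one_left (neg_one_zpow_mul_self _)
  rw [div_eq_mul_inv, h1]
  simp

theorem ω_insert {m : MultiOps H} (hdeg : B.HasDegree 1 m) (hm : B.IsCyclic m) (z : B.Homog)
    (a I c : List B.Homog) :
    (-1 : ℂ) ^ B.totalDeg a *
      B.ω z.2 (m.on (B.vecs a ++ m.on (B.vecs I) :: B.vecs c)) =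
      -arcPairing m I (c ++ z :: a) := by
  have h := hm.rotate z ⟨_, m.on (B.vecs I), hdeg I⟩ a c
  rw [vecs_append, vecs_cons] at h
  rw [h, arcPairing, zpow_add₀ (by norm_num), zpow_add₀ (by norm_num), zpow_one]
  linear_combination (-1 : ℂ) ^ B.totalDeg I * (-1) *
    B.ω (m.on (B.vecs I)) (m.on (B.vecs (c ++ z :: a))) * neg_one_zpow_mul_self (B.totalDeg a)

theorem ω_insertSum {m : MultiOps H} (hdeg : B.HasDegree 1 m) (hm : B.IsCyclic m) (z : B.Homog)
    (l : List B.Homog) : B.ω z.2 (B.insertSum m m l) =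
      -∑ j ∈ Finset.range l.length, ∑ b ∈ Finset.Icc 1 (l.length - j),
        arcPairing m ((l.drop j).take b) (l.drop (j + b) ++ z :: l.take j) := by
  rw [insertSum, map_sum, ← Finset.sum_neg_distrib]
  refine Finset.sum_congr rfl fun j _ => ?_
  rw [map_sum, ← Finset.sum_neg_distrib]
  refine Finset.sum_congr rfl fun b _ => ?_
  rw [map_smul, smul_eq_mul, ω_insert hdeg hm]

/-- The vertices in the `p`-th contraction of the `r`-th rotation of `l`. -/
def rotationArc (m : MultiOps H) (l : List B.Homog) (r p : ℕ) : ℂ :=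
  arcPairing m ((l.drop r ++ l.take r).take p) ((l.drop r ++ l.take r).drop p)

theorem bracketSS_eq {m : MultiOps H} {l : List B.Homog} (hl : B.totalDeg l = -1) :
    B.bracketSS m l = -∑ x ∈ Finset.range l.length ×ˢ Finset.Ico 1 l.length,
      rotationArc m l x.1 x.2 := by
  rw [bracketSS, Finset.sum_product, ← Finset.sum_neg_distrib]
  refine Finset.sum_congr rfl fun r _ => ?_
  have hs : (-1 : ℂ) ^ (B.totalDeg (l.take r) * B.totalDeg (l.drop r)) = 1 := by
    have h1 := totalDeg_take_add_drop l r
    rw [hl] at h1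
    refine Even.neg_one_zpow ?_
    rw [Int.even_mul]
    by_contra hcon
    rw [not_or, Int.not_even_iff_odd, Int.not_even_iff_odd] at hcon
    have := hcon.1.add_odd hcon.2
    rw [h1] at this
    exact absurd this (by decide)
  have hlen : (l.drop r ++ l.take r).length = l.length := by simp; omega
  rw [hs, one_mul, contraction, hlen, ← Finset.sum_neg_distrib]
  refine Finset.sum_congr rfl fun p _ => ?_
  rw [rotationArc, arcPairing, zpow_add₀ (by norm_num), zpow_one]
  ring

theorem rotationArc_swap (m : MultiOps H) {l : List B.Homog} (hl : B.totalDeg l = -1) {r p : ℕ}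
    (hr : r < l.length) (hp : p < l.length) (h : l.length ≤ r + p) :
    rotationArc m l r p = rotationArc m l (r + p - l.length) (l.length - p) := by
  set r' := r + p - l.length with hr'
  have e1 : (l.drop r ++ l.take r).take p = l.drop r ++ l.take r' := by
    rw [List.take_append, List.take_of_length_le (by simp; omega), List.take_take]
    congr 2
    simp; omega
  have e2 : (l.drop r ++ l.take r).drop p = (l.drop r').take (r - r') := by
    rw [List.drop_append, List.drop_eq_nil_of_le (by simp; omega), List.nil_append,
      List.drop_take]
    have : p - (l.drop r).length = r' := by simp; omega
    rw [this]
  have e3 : (l.drop r' ++ l.take r').take (l.length - p) = (l.drop r').take (r - r') := by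
    have : l.length - p = r - r' := by omega
    rw [List.take_append_of_le_length (by simp; omega), this]
  have e4 : (l.drop r' ++ l.take r').drop (l.length - p) = l.drop r ++ l.take r' := by
    rw [List.drop_append_of_le_length (by simp; omega), List.drop_drop]
    congr 2; omega
  rw [rotationArc, rotationArc, e1, e2, e3, e4]
  refine arcPairing_comm m ?_
  rw [← e1, ← e2, totalDeg_take_add_drop, totalDeg_append, add_comm, totalDeg_take_add_drop, hl]

theorem rotationArc_of_lt (m : MultiOps H) (l : List B.Homog) (z : B.Homog) {r p : ℕ}
    (h : r + p ≤ l.length) : rotationArc m (l ++ [z]) r p =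
      arcPairing m ((l.drop r).take p) (l.drop (r + p) ++ z :: l.take r) := by
  have e1 : ((l ++ [z]).drop r ++ (l ++ [z]).take r).take p = (l.drop r).take p := by
    rw [List.take_append_of_le_length (by simp; omega),
      List.drop_append_of_le_length (by omega), List.take_append_of_le_length (by simp; omega)]
  have e2 : ((l ++ [z]).drop r ++ (l ++ [z]).take r).drop p =
      l.drop (r + p) ++ z :: l.take r := by
    rw [List.drop_append_of_le_length (by simp; omega), List.drop_drop,
      List.drop_append_of_le_length (by omega), List.take_append_of_le_length (by omega)]
    simp
  rw [rotationArc, e1, e2]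

/-- The master equation for a cyclic action gives the `A∞`-relations. -/
theorem insertSum_eq_zero {m : MultiOps H} (hdeg : B.HasDegree 1 m) (hm : B.IsCyclic m)
    (hS : B.MasterEquation m) (l : List B.Homog) : B.insertSum m m l = 0 := by
  refine B.eq_zero_of_ω fun y => ?_
  have : B.ω.flip (B.insertSum m m l) = 0 := by
    refine B.ext_deg fun d y hy => ?_
    set z : B.Homog := ⟨d, y, hy⟩ with hz
    change B.ω z.2 (B.insertSum m m l) = 0
    rw [ω_insertSum hdeg hm]
    by_cases ht : B.totalDeg (l ++ [z]) = -1
    · set n := (l ++ [z]).length with hn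
      have hn' : n = l.length + 1 := by simp [hn]
      have h0 := hS (l ++ [z])
      rw [bracketSS_eq ht, ← hn,
        ← Finset.sum_filter_add_sum_filter_not _ (fun x : ℕ × ℕ => x.1 + x.2 < n)] at h0
      have hsw : ∑ x ∈ Finset.range n ×ˢ Finset.Ico 1 n with ¬ (x.1 + x.2 < n),
          rotationArc m (l ++ [z]) x.1 x.2 =
          ∑ x ∈ Finset.range n ×ˢ Finset.Ico 1 n with x.1 + x.2 < n,
          rotationArc m (l ++ [z]) x.1 x.2 := by
        refine Finset.sum_nbij' (fun x => (x.1 + x.2 - n, n - x.2))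
          (fun x => (x.1 + x.2, n - x.2)) ?_ ?_ ?_ ?_ ?_
        · rintro ⟨r, p⟩ h; simp at h ⊢; omega
        · rintro ⟨r, p⟩ h; simp at h ⊢; omega
        · rintro ⟨r, p⟩ h; simp at h ⊢; omega
        · rintro ⟨r, p⟩ h; simp at h ⊢; omega
        · rintro ⟨r, p⟩ h
          simp only [Finset.mem_filter, Finset.mem_product, Finset.mem_range, Finset.mem_Ico] at h
          exact rotationArc_swap m ht (by omega) (by omega) (by omega)
      have hre : ∑ x ∈ Finset.range n ×ˢ Finset.Ico 1 n with x.1 + x.2 < n,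
          rotationArc m (l ++ [z]) x.1 x.2 =
          ∑ j ∈ Finset.range l.length, ∑ b ∈ Finset.Icc 1 (l.length - j),
            arcPairing m ((l.drop j).take b) (l.drop (j + b) ++ z :: l.take j) := by
        rw [Finset.sum_sigma']
        refine Finset.sum_nbij' (fun x => (⟨x.1, x.2⟩ : Σ _ : ℕ, ℕ)) (fun x => (x.1, x.2))
          ?_ ?_ ?_ ?_ ?_
        · rintro ⟨r, p⟩ h; simp at h ⊢; omega
        · rintro ⟨r, p⟩ h; simp at h ⊢; omega
        · rintro ⟨r, p⟩ h; rfl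
        · rintro ⟨r, p⟩ h; rfl
        · rintro ⟨r, p⟩ h
          simp only [Finset.mem_filter, Finset.mem_product, Finset.mem_range, Finset.mem_Ico] at h
          exact rotationArc_of_lt m l z (by omega)
      rw [hsw, hre] at h0
      linear_combination (1 / 2 : ℂ) * h0
    · rw [neg_eq_zero]
      refine Finset.sum_eq_zero fun j _ => Finset.sum_eq_zero fun b _ => ?_
      rw [arcPairing]
      by_contra hne
      have h1 := B.ω_deg _ _ _ (hdeg _) _ (hdeg _) (right_ne_zero_of_mul hne)
      refine ht ?_
      have h2 := totalDeg_take_add_drop l j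
      have h3 := totalDeg_take_add_drop (l.drop j) b
      rw [List.drop_drop] at h3
      rw [totalDeg_append, totalDeg_cons] at h1
      rw [totalDeg_append, totalDeg_cons]
      simp only [totalDeg, List.map_nil, List.sum_nil] at h1 h2 h3 ⊢
      omega
  exact LinearMap.congr_fun this y

/-! ### From multilinear maps to coderivations and coalgebra morphisms -/

/-- The coderivation of a collection of multilinear maps. -/
abbrev opCoder (B : ConformalBackground H) (m : MultiOps H) :
    TensorAlgebra ℂ H →ₗ[ℂ] TensorAlgebra ℂ H :=
  coder (tmap B.sgn) m.lin

theorem isCoder_opCoder {m : MultiOps H} (hm : m 0 = 0) : IsCoder (tmap B.sgn) (B.opCoder m) :=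
  isCoder_coder (isCohom_tmap _) (m.lin_one hm)

theorem proj_opCoder {m : MultiOps H} (hm : m 0 = 0) : proj ∘ₗ B.opCoder m = m.lin :=
  proj_comp_coder (isCohom_tmap _) (m.lin_one hm)

theorem form_opCoder {m : MultiOps H} (h0 : m 0 = 0) (hm : B.IsCyclic m) :
    B.form ∘ₗ B.opCoder m = 0 := by
  rw [form_comp_coder (isCoder_opCoder h0), proj_opCoder h0, proj_comp_tmap]
  refine B.ext_homog fun l => ?_
  rw [LinearMap.add_apply, LinearMap.zero_apply]
  rcases List.eq_nil_or_concat l with rfl | ⟨l', o, rfl⟩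
  · have e' : B.vecs ([] : List B.Homog) = [] := rfl
    rw [e', pairing_word, pairing_word]
    simp [m.lin_one h0]
  · rw [List.concat_eq_append, vecs_append]
    have hr : pairing B.ω m.lin proj (word (B.vecs l' ++ B.vecs [o])) =
      B.ω (m.lin (word (B.vecs l'))) o.2 := pairing_proj_right m.lin (B.vecs l') o.2
    rw [hr]
    cases l' with
    | nil =>
      have := pairing_proj_left (B := B) m.lin B.sgn o.2 []
      simp only [word_nil, m.lin_one h0, map_zero] at this
      have e : B.vecs [] ++ B.vecs [o] = [(o.2 : H)] := rfl
      have e' : B.vecs ([] : List B.Homog) = [] := rfl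
      rw [e, this, e', word_nil, m.lin_one h0]; simp
    | cons o' l' =>
      rw [vecs_cons, List.cons_append, pairing_proj_left, ← vecs_append, B.scale_of_mem _ o'.2.2,
        MultiOps.lin_word, MultiOps.lin_word, ← vecs_cons, B.ω_skew o.2, hm o o' l', map_smul,
        LinearMap.smul_apply, smul_eq_mul]
      ring

theorem isAlg_opCoder {m : MultiOps H} (hm : B.IsCyclicAction m)
    (hsq : proj ∘ₗ B.opCoder m ∘ₗ B.opCoder m = 0) : B.IsAlg (B.opCoder m) := by
  have hdeg : ∀ z : ℂ, z ≠ 0 →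
      tmap (B.scale z) ∘ₗ B.opCoder m = z • (B.opCoder m ∘ₗ tmap (B.scale z)) := by
    intro z hz
    have := coder_deg (m.lin_one hm.zero) (B.deg_lin hm.degree) (-1) hz
    rwa [zpow_one] at this
  refine ⟨isCoder_opCoder hm.zero, hdeg, form_opCoder hm.zero hm.cyclic, ?_, ?_⟩
  · refine (isCoder_opCoder hm.zero).sq_eq_zero tmap_sgn_comp ?_ hsq
    rw [hdeg (-1) (by norm_num)]
    ext t; simp
  · intro x
    have h := (isCoder_opCoder (B := B) hm.zero).map_word (by simp) x []
    have hp := LinearMap.congr_fun (proj_opCoder (B := B) hm.zero) (TensorAlgebra.ι ℂ x)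
    rw [LinearMap.comp_apply, ← word_singleton, MultiOps.lin_word, hm.kinetic] at hp
    rw [word_singleton] at hp h
    rw [h]
    simp [hp, (isCoder_opCoder (B := B) hm.zero).map_one]

theorem isAlg_of_master {m : MultiOps H} (hm : B.IsCyclicAction m) (hS : B.MasterEquation m) :
    B.IsAlg (B.opCoder m) := by
  refine isAlg_opCoder hm ?_
  rw [← LinearMap.comp_assoc, proj_opCoder hm.zero]
  refine B.ext_homog fun l => ?_
  rw [LinearMap.comp_apply, ← B.insertSum_eq m m hm.zero, insertSum_eq_zero hm.degree hm.cyclic hS,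
    LinearMap.zero_apply]

theorem form_word (l : List H) : B.form (word l) =
    ∑ i ∈ Finset.range (l.length + 1), B.ω (proj (word (l.take i))) (proj (word (l.drop i))) :=
  pairing_word B.ω proj proj l

theorem form_comp_cohom {F : TensorAlgebra ℂ H →ₗ[ℂ] TensorAlgebra ℂ H} (hF : IsCohom F)
    {l : List H} (hl : l ≠ []) : B.form (F (word l)) =
      ∑ k ∈ Finset.Ico 1 l.length, B.ω (proj (F (word (l.take k)))) (proj (F (word (l.drop k)))) := by
  have h := LinearMap.congr_fun (hF.pairing_comp B.ω proj proj) (word l)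
  rw [LinearMap.comp_apply, pairing_word] at h
  rw [h, Finset.sum_range_succ, Finset.sum_range_eq_add_Ico _ (List.length_pos_iff.2 hl)]
  simp [hF.map_one]

theorem form_cohom_pair {F : TensorAlgebra ℂ H →ₗ[ℂ] TensorAlgebra ℂ H} (hF : IsCohom F)
    (x y : H) : B.form (F (word [x, y])) =
      B.ω (proj (F (TensorAlgebra.ι ℂ x))) (proj (F (TensorAlgebra.ι ℂ y))) := by
  rw [form_comp_cohom hF (by simp)]
  simp

theorem form_pair (x y : H) : B.form (word [x, y]) = B.ω x y := by
  simpa using form_cohom_pair (B := B) isCohom_id x y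

theorem ofFn_vecs (l : List B.Homog) :
    List.ofFn (fun i : Fin l.length => ((l.get i).2 : H)) = B.vecs l := by
  refine List.ext_getElem (by simp [vecs]) fun i h1 h2 => ?_
  simp [vecs]

theorem form_word_eq_zero {l : List H} (hl : 3 ≤ l.length) : B.form (word l) = 0 := by
  rw [form_word]
  refine Finset.sum_eq_zero fun i _ => ?_
  by_cases hi : i = 1
  · rw [proj_word (l.drop i) (by simp; omega)]; simp
  · rw [proj_word (l.take i) (by simp; omega)]; simp

theorem isSymp_of_morphism {m m' f : MultiOps H} (hf : B.IsCyclicMorphism m m' f) :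
    B.IsSymp (cohom f.lin) := by
  have h1 := f.lin_one hf.zero
  have hF := isCohom_cohom h1
  have hp : ∀ t, proj (cohom f.lin t) = f.lin t := fun t => LinearMap.congr_fun (proj_comp_cohom h1) t
  refine ⟨hF, fun z hz => cohom_deg h1 (B.deg_lin hf.degree) hz, ext_word fun l => ?_⟩
  rcases l with _ | ⟨x, _ | ⟨y, _ | ⟨y', l⟩⟩⟩
  · simp [hF.map_one]
  · rw [LinearMap.comp_apply, form_comp_cohom hF (by simp), form_word]
    simp [Finset.sum_range_succ]
  · rw [LinearMap.comp_apply, form_cohom_pair hF, form_pair, hp, hp, ← hf.symplectic x y,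
      ← MultiOps.lin_word, ← MultiOps.lin_word, word_singleton, word_singleton]
  · rw [LinearMap.comp_apply, form_comp_cohom hF (by simp), form_word_eq_zero (by simp),
      ← hf.symplectic_higher (x :: y :: y' :: l) (by simp)]
    simp only [hp, MultiOps.lin_word]

theorem intertwine_of_morphism {m m' f : MultiOps H} (h0 : m 0 = 0) (h0' : m' 0 = 0)
    (hf : B.IsCyclicMorphism m m' f) :
    B.opCoder m' ∘ₗ cohom f.lin = cohom f.lin ∘ₗ B.opCoder m := by
  have h1 := f.lin_one hf.zero
  have hs := isSymp_of_morphism hf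
  refine comp_eq_comp_of_proj (isCohom_tmap _) (isCoder_opCoder h0) (isCoder_opCoder h0') hs.cohom
    (hs.deg (-1) (by norm_num)).symm ?_
  rw [← LinearMap.comp_assoc, ← LinearMap.comp_assoc, proj_opCoder h0', proj_comp_cohom h1]
  refine B.ext_homog fun l => ?_
  have h := hf.morphism l
  rw [blockSum_eq _ _ hf.zero, B.insertSum_eq _ _ h0] at h
  rw [LinearMap.comp_apply, LinearMap.comp_apply, ← h, ofFn_vecs]

theorem isCyclicMorphism_of {m m' : MultiOps H} (h0 : m 0 = 0) (h0' : m' 0 = 0)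
    {F : TensorAlgebra ℂ H →ₗ[ℂ] TensorAlgebra ℂ H} (hF : B.IsSymp F)
    (h : B.opCoder m' ∘ₗ F = F ∘ₗ B.opCoder m) :
    B.IsCyclicMorphism m m' (toOps (proj ∘ₗ F)) := by
  have h1 : (proj ∘ₗ F) 1 = 0 := by simp [hF.cohom.map_one]
  have hFe : cohom (proj ∘ₗ F) = F :=
    (isCohom_cohom h1).ext hF.cohom (proj_comp_cohom h1)
  refine ⟨toOps_zero h1, B.hasDegree_of_deg ?_, fun l => ?_, fun x y => ?_, fun l hl => ?_⟩
  · rw [lin_toOps]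
    intro z hz
    rw [← LinearMap.comp_assoc, ← proj_comp_tmap, LinearMap.comp_assoc, hF.deg z hz, zpow_zero,
      one_smul, LinearMap.comp_assoc]
  · rw [blockSum_eq _ _ (toOps_zero h1), B.insertSum_eq _ _ h0, lin_toOps, hFe,
      ← proj_opCoder (B := B) h0', ofFn_vecs]
    exact congrArg proj (LinearMap.congr_fun h (word (B.vecs l)))
  · have := LinearMap.congr_fun hF.symp (word [x, y])
    rw [LinearMap.comp_apply, form_cohom_pair hF.cohom, form_pair] at this
    rw [toOps_on, toOps_on, word_singleton, word_singleton]
    exact this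
  · have := LinearMap.congr_fun hF.symp (word l)
    rw [LinearMap.comp_apply, form_comp_cohom hF.cohom (by rintro rfl; simp at hl),
      form_word_eq_zero hl] at this
    simpa [toOps_on] using this

end ConformalBackground

namespace ConformalBackground

variable {H : Type*} [AddCommGroup H] [Module ℂ H] {B : ConformalBackground H}

/-! ### Gauge fixing field redefinitions -/

theorem IsGaugeRedefinition.proj_cohom {p : H →ₗ[ℂ] H} {m n f : MultiOps H}
    (h : B.IsGaugeRedefinition p m n f) (x : H) :
    proj (cohom f.lin (TensorAlgebra.ι ℂ x)) = x := by
  have h1 := f.lin_one h.morphism.zero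
  have := LinearMap.congr_fun (proj_comp_cohom h1) (TensorAlgebra.ι ℂ x)
  rw [LinearMap.comp_apply] at this
  rw [this, ← word_singleton, MultiOps.lin_word, h.linear_part]

theorem IsGaugeRedefinition.isAlg {p : H →ₗ[ℂ] H} {m n f : MultiOps H} (h0 : m 0 = 0)
    (hm : B.IsAlg (B.opCoder m)) (h : B.IsGaugeRedefinition p m n f) :
    B.IsAlg (B.opCoder n) := by
  refine isAlg_opCoder h.action ?_
  obtain ⟨G, -, hGF⟩ := (isSymp_of_morphism h.morphism).cohom.exists_inverse h.proj_cohom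
  have hi := intertwine_of_morphism h.action.zero h0 h.morphism
  have h2 : cohom f.lin ∘ₗ B.opCoder n ∘ₗ B.opCoder n = 0 := by
    rw [← LinearMap.comp_assoc, ← hi, LinearMap.comp_assoc, ← hi, ← LinearMap.comp_assoc, hm.sq,
      LinearMap.zero_comp]
  have h3 : B.opCoder n ∘ₗ B.opCoder n = 0 := by
    have : B.opCoder n ∘ₗ B.opCoder n =
        (G ∘ₗ cohom f.lin) ∘ₗ (B.opCoder n ∘ₗ B.opCoder n) := by
      rw [hGF, LinearMap.id_comp]
    rw [this, LinearMap.comp_assoc, h2, LinearMap.comp_zero]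
  rw [h3, LinearMap.comp_zero]

/-! ### Propagators -/

theorem IsCyclicAction.Q_symm {m : MultiOps H} (hm : B.IsCyclicAction m) (x y : H) :
    B.ω (B.Q x) y = -B.ω (B.sgn x) (B.Q y) := by
  have h : B.ω ∘ₗ B.Q = -((B.ω.compl₂ B.Q) ∘ₗ B.sgn) := by
    refine B.ext_deg fun d x hx => ?_
    refine B.ext_deg fun e y hy => ?_
    have := hm.cyclic ⟨e, y, hy⟩ ⟨d, x, hx⟩ []
    simp only [vecs, List.map_cons, List.map_nil, List.nil_append, hm.kinetic] at this
    rw [LinearMap.comp_apply, B.ω_skew y, this]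
    simp [B.scale_of_mem _ hx]
  exact LinearMap.congr_fun (LinearMap.congr_fun h x) y

/-- A propagator: a contracting homotopy of `Q` onto its cohomology compatible with `ω`. -/
structure IsHodge (B : ConformalBackground H) (R : H →ₗ[ℂ] H) : Prop where
  degree : B.OpHasDegree (-1) R
  R_R : ∀ x, R (R x) = 0
  R_Q_R : ∀ x, R (B.Q (R x)) = R x
  Q_R_Q : ∀ x, B.Q (R (B.Q x)) = B.Q x
  Q_symm : ∀ x y, B.ω (B.Q x) y = -B.ω (B.sgn x) (B.Q y)
  R_symm : ∀ x y, B.ω (R x) y = B.ω (B.sgn x) (R y)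

theorem isHodge_of_isPropagator {p R : H →ₗ[ℂ] H} {m : MultiOps H} (hm : B.IsCyclicAction m)
    (hp : B.IsFieldProjection p) (ht : B.IsProper p) (hR : B.IsPropagator p R) : B.IsHodge R := by
  obtain ⟨t, -, htp, hpt, -, hQ⟩ := ht
  obtain ⟨hdeg, hpR, hRp, π, -, -, hpπ, -, hcπ, hRc, hcR, hπR⟩ := hR
  have hQ' : ∀ x, B.Q x = B.kineticBlock p (x + t x) - t (B.kineticBlock p (x + t x)) := by
    intro x
    have := LinearMap.congr_fun hQ x
    simpa using this
  have hRt : ∀ x, R (t x) = 0 := fun x => by rw [← hpt, hRp]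
  have htR : ∀ x, t (R x) = 0 := fun x => by rw [← hpR, htp]
  have hcp : ∀ x, B.kineticBlock p (p x) = B.kineticBlock p x := by
    intro x; simp [kineticBlock, hp.idem]
  have hRQ : ∀ x, R (B.Q x) = p (x + t x) - π (x + t x) := by
    intro x; rw [hQ', map_sub, hRt, sub_zero, hRc]
  have hQR : ∀ x, B.Q (R x) = B.kineticBlock p (R x) - t (B.kineticBlock p (R x)) := by
    intro x; rw [hQ', htR, add_zero]
  have hsp : ∀ x, B.sgn (p x) = p (B.sgn x) := by
    intro x
    have := LinearMap.congr_fun (B.scale_of_opHasDegree hp.degree (z := -1) (by norm_num)) x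
    simpa using this
  have hcs : ∀ a b, p a = a → p b = b →
      B.ω (B.kineticBlock p a) b = -B.ω (B.sgn a) (B.kineticBlock p b) := by
    intro a b ha hb
    have e1 : B.kineticBlock p a = B.Q a - p (B.Q a) := by simp [kineticBlock, ha]
    have e2 : B.kineticBlock p b = B.Q b - p (B.Q b) := by simp [kineticBlock, hb]
    have z1 : B.ω (p (B.Q a)) b = 0 := by
      have := hp.isotropic_fields (B.Q a) b; rwa [hb] at this
    have z2 : B.ω (B.sgn a) (p (B.Q b)) = 0 := by
      have := hp.isotropic_fields (B.sgn a) (B.Q b); rwa [← hsp, ha] at this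
    rw [e1, e2, map_sub, LinearMap.sub_apply, z1, map_sub, z2, sub_zero, sub_zero, hm.Q_symm]
  have hcR' : ∀ v x, B.ω (B.kineticBlock p (R v)) (R x) = B.ω v (R x) := by
    intro v x; rw [hcR, hpR, hπR, sub_zero]
  refine ⟨hdeg, fun x => ?_, fun x => ?_, fun x => ?_, hm.Q_symm, fun x y => ?_⟩
  · rw [← hpR x, hRp]
  · rw [hRQ, htR, add_zero, hpR, hπR, sub_zero]
  · set y := x + t x with hy
    have hpu : p (R (B.Q x)) = R (B.Q x) := hpR _
    have hcu : B.kineticBlock p (R (B.Q x)) = B.kineticBlock p y := by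
      rw [hRQ, ← hy, map_sub, hcp, hcπ, sub_zero]
    rw [hQR, hcu, hQ' x]
  · have h1 : ∀ v, B.ω v (R y) = B.ω (R (B.sgn v)) y := by
      intro v
      rw [← hcR', hcs _ _ (hpR v) (hpR y), B.sgn_of_opHasDegree_neg_one hdeg, map_neg,
        LinearMap.neg_apply, neg_neg, B.ω_skew (B.kineticBlock p (R y)), hcR',
        ← B.ω_skew y]
    rw [h1, B.sgn_sgn]

namespace IsHodge

variable {R R' : H →ₗ[ℂ] H}

theorem onShell_apply (R : H →ₗ[ℂ] H) (x : H) : B.onShell R x = x - B.Q (R x) - R (B.Q x) := rfl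

theorem P_Q (hR : B.IsHodge R) (x : H) : B.onShell R (B.Q x) = 0 := by
  rw [onShell_apply, hR.Q_R_Q, B.Q_sq]; simp

theorem Q_P (hR : B.IsHodge R) (x : H) : B.Q (B.onShell R x) = 0 := by
  rw [onShell_apply, map_sub, map_sub, hR.Q_R_Q, B.Q_sq]; simp

theorem P_R (hR : B.IsHodge R) (x : H) : B.onShell R (R x) = 0 := by
  rw [onShell_apply, hR.R_R, hR.R_Q_R]; simp

theorem R_P (hR : B.IsHodge R) (x : H) : R (B.onShell R x) = 0 := by
  rw [onShell_apply, map_sub, map_sub, hR.R_R, hR.R_Q_R]; simp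

theorem P_P (hR : B.IsHodge R) (x : H) : B.onShell R (B.onShell R x) = B.onShell R x := by
  nth_rw 1 [onShell_apply]
  rw [hR.R_P, hR.Q_P]; simp

theorem sgn_Q (B : ConformalBackground H) (x : H) : B.sgn (B.Q x) = -B.Q (B.sgn x) :=
  B.sgn_of_opHasDegree_one (fun d x hx => B.Q_deg d x hx) x

theorem adj_Q_R (hR : B.IsHodge R) (x y : H) :
    B.ω (B.Q (R x)) y = B.ω x (R (B.Q y)) := by
  rw [hR.Q_symm, B.sgn_of_opHasDegree_neg_one hR.degree, map_neg, LinearMap.neg_apply, neg_neg,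
    hR.R_symm, B.sgn_sgn]

theorem adj_R_Q (hR : B.IsHodge R) (x y : H) : B.ω (R (B.Q x)) y = B.ω x (B.Q (R y)) := by
  rw [hR.R_symm, sgn_Q, map_neg, LinearMap.neg_apply, hR.Q_symm, neg_neg, B.sgn_sgn]

theorem P_symm (hR : B.IsHodge R) (x y : H) : B.ω (B.onShell R x) y = B.ω x (B.onShell R y) := by
  rw [onShell_apply, onShell_apply]
  simp only [map_sub, LinearMap.sub_apply]
  rw [hR.adj_Q_R, hR.adj_R_Q]; ring

theorem scale_Q (B : ConformalBackground H) {z : ℂ} (hz : z ≠ 0) (x : H) :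
    B.scale z (B.Q x) = z • B.Q (B.scale z x) := by
  have := LinearMap.congr_fun (B.scale_of_opHasDegree (g := B.Q) (e := 1) B.Q_deg hz) x
  simpa using this

theorem scale_R (hR : B.IsHodge R) {z : ℂ} (hz : z ≠ 0) (x : H) :
    B.scale z (R x) = z⁻¹ • R (B.scale z x) := by
  have := LinearMap.congr_fun (B.scale_of_opHasDegree hR.degree hz) x
  simpa using this

theorem scale_Q_R (hR : B.IsHodge R) {z : ℂ} (hz : z ≠ 0) (x : H) :
    B.scale z (B.Q (R x)) = B.Q (R (B.scale z x)) := by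
  rw [scale_Q B hz, hR.scale_R hz, map_smul, smul_smul, mul_inv_cancel₀ hz, one_smul]

theorem scale_R_Q (hR : B.IsHodge R) {z : ℂ} (hz : z ≠ 0) (x : H) :
    B.scale z (R (B.Q x)) = R (B.Q (B.scale z x)) := by
  rw [hR.scale_R hz, scale_Q B hz, map_smul, smul_smul, inv_mul_cancel₀ hz, one_smul]

theorem scale_P (hR : B.IsHodge R) {z : ℂ} (hz : z ≠ 0) (x : H) :
    B.scale z (B.onShell R x) = B.onShell R (B.scale z x) := by
  rw [onShell_apply, onShell_apply, map_sub, map_sub, hR.scale_Q_R hz, hR.scale_R_Q hz]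

/-- The linear symplectic map which carries the propagator `R` to the propagator `R'`. -/
def transfer (B : ConformalBackground H) (R R' : H →ₗ[ℂ] H) : H →ₗ[ℂ] H :=
  B.onShell R' ∘ₗ B.onShell R + B.Q ∘ₗ R + R' ∘ₗ B.Q

theorem transfer_apply (R R' : H →ₗ[ℂ] H) (x : H) :
    transfer B R R' x = B.onShell R' (B.onShell R x) + B.Q (R x) + R' (B.Q x) := rfl

theorem transfer_Q (hR : B.IsHodge R) (x : H) : transfer B R R' (B.Q x) = B.Q x := by
  rw [transfer_apply, hR.P_Q, hR.Q_R_Q, B.Q_sq]; simp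

theorem Q_transfer (hR' : B.IsHodge R') (x : H) : B.Q (transfer B R R' x) = B.Q x := by
  rw [transfer_apply, map_add, map_add, hR'.Q_P, hR'.Q_R_Q, B.Q_sq]; simp

theorem transfer_R (hR : B.IsHodge R) (hR' : B.IsHodge R') (x : H) :
    transfer B R R' (R x) = R' (transfer B R R' x) := by
  rw [transfer_apply, transfer_apply, hR.P_R, hR.R_R, map_add, map_add, hR'.R_P, hR'.R_R]; simp

theorem transfer_P (hR : B.IsHodge R) (x : H) :
    transfer B R R' (B.onShell R x) = B.onShell R' (B.onShell R x) := by
  rw [transfer_apply, hR.P_P, hR.R_P, hR.Q_P]; simp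

theorem transfer_transfer (hR : B.IsHodge R) (hR' : B.IsHodge R') (x : H) :
    transfer B R R' (transfer B R' R x) = x := by
  have h1 : B.onShell R (transfer B R' R x) = B.onShell R (B.onShell R' x) := by
    rw [transfer_apply, map_add, map_add, hR.P_P, hR.P_Q, hR.P_R]; simp
  have h2 : R (transfer B R' R x) = R (B.Q (R' x)) := by
    rw [transfer_apply, map_add, map_add, hR.R_P, hR.R_R]; simp
  have h3 : B.onShell R' (B.onShell R (B.onShell R' x)) = B.onShell R' x := by
    rw [onShell_apply R, hR'.Q_P, map_sub, map_sub, hR'.P_P, hR'.P_Q]; simp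
  rw [transfer_apply, h1, h2, h3, Q_transfer hR, hR.Q_R_Q, onShell_apply]
  abel

theorem transfer_symp (hR : B.IsHodge R) (hR' : B.IsHodge R') (x y : H) :
    B.ω (transfer B R R' x) (transfer B R R' y) = B.ω x y := by
  have h : ∀ x y, B.ω (transfer B R R' x) y = B.ω x (transfer B R' R y) := by
    intro x y
    rw [transfer_apply, transfer_apply]
    simp only [map_add, LinearMap.add_apply]
    rw [hR'.P_symm, hR.P_symm, hR.adj_Q_R, hR'.adj_R_Q]; ring
  rw [h, transfer_transfer hR' hR]

theorem scale_transfer (hR : B.IsHodge R) (hR' : B.IsHodge R') {z : ℂ} (hz : z ≠ 0) (x : H) :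
    B.scale z (transfer B R R' x) = transfer B R R' (B.scale z x) := by
  rw [transfer_apply, transfer_apply, map_add, map_add, hR'.scale_P hz, hR.scale_P hz,
    hR.scale_Q_R hz, hR'.scale_R_Q hz]

end IsHodge

theorem isSymp_tmap {g : H →ₗ[ℂ] H} (hg : ∀ x y, B.ω (g x) (g y) = B.ω x y)
    (hs : ∀ z : ℂ, z ≠ 0 → ∀ x, B.scale z (g x) = g (B.scale z x)) : B.IsSymp (tmap g) where
  cohom := isCohom_tmap g
  deg z hz := by
    rw [← tmap_comp, ← tmap_comp]
    congr 1
    ext x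
    exact hs z hz x
  symp := by
    rw [(isCohom_tmap g).pairing_comp, proj_comp_tmap]
    refine ext_word fun l => ?_
    rw [pairing_word, pairing_word]
    simp [hg]

/-! ### Tree operators -/

/-- `E` is the sum over the planar trees with vertices `D` and propagator `-R`. -/
structure IsTree (R : H →ₗ[ℂ] H) (D E : TensorAlgebra ℂ H →ₗ[ℂ] TensorAlgebra ℂ H) : Prop where
  cohom : IsCohom E
  proj_eq : ∀ t, proj (E t) = proj t - R (higher (proj ∘ₗ D) (E t))

theorem proj_add_higher_one (R : H →ₗ[ℂ] H) (φ : TensorAlgebra ℂ H →ₗ[ℂ] H) :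
    (proj + R ∘ₗ higher φ : TensorAlgebra ℂ H →ₗ[ℂ] H) 1 = 0 := by
  rw [← word_nil, LinearMap.add_apply, LinearMap.comp_apply, higher_word_of_le _ (by simp)]
  simp

/-- The coalgebra morphism inverse to the sum over the planar trees. -/
def treeInv (R : H →ₗ[ℂ] H) (D : TensorAlgebra ℂ H →ₗ[ℂ] TensorAlgebra ℂ H) :
    TensorAlgebra ℂ H →ₗ[ℂ] TensorAlgebra ℂ H :=
  cohom (proj + R ∘ₗ higher (proj ∘ₗ D))

theorem isCohom_treeInv (R : H →ₗ[ℂ] H) (D : TensorAlgebra ℂ H →ₗ[ℂ] TensorAlgebra ℂ H) :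
    IsCohom (treeInv R D) :=
  isCohom_cohom (proj_add_higher_one R _)

theorem proj_treeInv (R : H →ₗ[ℂ] H) (D : TensorAlgebra ℂ H →ₗ[ℂ] TensorAlgebra ℂ H)
    (t : TensorAlgebra ℂ H) :
    proj (treeInv R D t) = proj t + R (higher (proj ∘ₗ D) t) :=
  LinearMap.congr_fun (proj_comp_cohom (proj_add_higher_one R (proj ∘ₗ D))) t

theorem exists_treeInv_inverse (R : H →ₗ[ℂ] H)
    (D : TensorAlgebra ℂ H →ₗ[ℂ] TensorAlgebra ℂ H) :
    ∃ E, treeInv R D ∘ₗ E = LinearMap.id ∧ E ∘ₗ treeInv R D = LinearMap.id := by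
  refine (isCohom_treeInv R D).exists_inverse fun x => ?_
  rw [proj_treeInv, ← word_singleton, higher_word_of_le _ (by simp), word_singleton]
  simp

theorem exists_isTree (R : H →ₗ[ℂ] H) (D : TensorAlgebra ℂ H →ₗ[ℂ] TensorAlgebra ℂ H) :
    ∃ E, IsTree R D E := by
  obtain ⟨E, hGE, hEG⟩ := exists_treeInv_inverse R D
  refine ⟨E, (isCohom_treeInv R D).of_inverse hGE hEG, fun t => ?_⟩
  have h2 := congrArg proj (LinearMap.congr_fun hGE t)
  rw [LinearMap.comp_apply, proj_treeInv, LinearMap.id_apply] at h2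
  rw [← h2]
  simp

theorem IsTree.comp_treeInv {R : H →ₗ[ℂ] H} {D E : TensorAlgebra ℂ H →ₗ[ℂ] TensorAlgebra ℂ H}
    (hE : IsTree R D E) : E ∘ₗ treeInv R D = LinearMap.id := by
  have key : treeInv R D ∘ₗ E = LinearMap.id := by
    refine ((isCohom_treeInv R D).comp hE.cohom).ext isCohom_id ?_
    ext t
    simp [hE.proj_eq, proj_treeInv]
  obtain ⟨G, -, hG'⟩ := exists_treeInv_inverse R D
  have : E = G := by
    rw [← LinearMap.id_comp E, ← hG', LinearMap.comp_assoc, key, LinearMap.comp_id]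
  rw [this, hG']

theorem higher_transport (φ : TensorAlgebra ℂ H →ₗ[ℂ] H) (g g' : H →ₗ[ℂ] H) :
    higher (g ∘ₗ φ ∘ₗ tmap g') = g ∘ₗ higher φ ∘ₗ tmap g' := by
  refine ext_word fun l => ?_
  rw [LinearMap.comp_apply, LinearMap.comp_apply, tmap_word]
  by_cases h : l.length ≤ 1
  · rw [higher_word_of_le _ h, higher_word_of_le _ (by simpa using h), map_zero]
  · rw [higher_word_of_lt _ (by omega), higher_word_of_lt _ (by simp; omega)]
    simp [tmap_word]

theorem IsTree.transport {R R' g g' : H →ₗ[ℂ] H}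
    {D E : TensorAlgebra ℂ H →ₗ[ℂ] TensorAlgebra ℂ H} (hE : IsTree R D E)
    (hgg : g ∘ₗ g' = LinearMap.id) (hgg' : g' ∘ₗ g = LinearMap.id)
    (hRg : ∀ x, g (R x) = R' (g x)) :
    IsTree R' (tmap g ∘ₗ D ∘ₗ tmap g') (tmap g ∘ₗ E ∘ₗ tmap g') where
  cohom := (isCohom_tmap g).comp (hE.cohom.comp (isCohom_tmap g'))
  proj_eq t := by
    have h1 : ∀ s, proj (tmap g s) = g (proj s) := LinearMap.congr_fun (proj_comp_tmap g)
    have h2 : proj ∘ₗ tmap g ∘ₗ D ∘ₗ tmap g' = g ∘ₗ (proj ∘ₗ D) ∘ₗ tmap g' := by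
      rw [← LinearMap.comp_assoc, proj_comp_tmap]; rfl
    have h3 : ∀ s, tmap g' (tmap g s) = s := by
      intro s
      have : tmap g' ∘ₗ tmap g = LinearMap.id := by rw [← tmap_comp, hgg', tmap_id]
      exact LinearMap.congr_fun this s
    have h4 : proj (tmap g' t) = g' (proj t) := LinearMap.congr_fun (proj_comp_tmap g') t
    have h5 : g (g' (proj t)) = proj t := LinearMap.congr_fun hgg (proj t)
    rw [h2, higher_transport]
    simp only [LinearMap.comp_apply, h1, h3]
    rw [hE.proj_eq, map_sub, h4, h5, hRg]

theorem IsAlg.proj_eq {D : TensorAlgebra ℂ H →ₗ[ℂ] TensorAlgebra ℂ H} (hD : B.IsAlg D)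
    (t : TensorAlgebra ℂ H) : proj (D t) = B.Q (proj t) + higher (proj ∘ₗ D) t := by
  have : proj ∘ₗ D = B.Q ∘ₗ proj + higher (proj ∘ₗ D) := by
    refine ext_word fun l => ?_
    rw [LinearMap.add_apply, LinearMap.comp_apply, LinearMap.comp_apply]
    rcases l with _ | ⟨x, _ | ⟨y, l⟩⟩
    · rw [higher_word_of_le _ (by simp)]; simp [hD.coder.map_one]
    · rw [higher_word_of_le _ (by simp), word_singleton, hD.linear]; simp
    · rw [higher_word_of_lt _ (by simp), proj_word (x :: y :: l) (by simp)]; simp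
  exact LinearMap.congr_fun this t

end ConformalBackground

namespace TensorCoalgebra

variable {H : Type*} [AddCommGroup H] [Module ℂ H]

/-! ### Coderivations extending linear maps -/

/-- The coderivation, twisted by `w`, which extends the linear map `g`. -/
def lcoder (w g : H →ₗ[ℂ] H) : TensorAlgebra ℂ H →ₗ[ℂ] TensorAlgebra ℂ H :=
  coder (tmap w) (g ∘ₗ proj)

theorem isCoder_lcoder (w g : H →ₗ[ℂ] H) : IsCoder (tmap w) (lcoder w g) :=
  isCoder_coder (isCohom_tmap w) (by simp)

theorem proj_lcoder (w g : H →ₗ[ℂ] H) (t : TensorAlgebra ℂ H) :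
    proj (lcoder w g t) = g (proj t) :=
  LinearMap.congr_fun (proj_comp_coder (isCohom_tmap w) (m := g ∘ₗ proj) (by simp)) t

theorem lcoder_ι_mul (w g : H →ₗ[ℂ] H) (x : H) (t : TensorAlgebra ℂ H) :
    lcoder w g (TensorAlgebra.ι ℂ x * t) =
      TensorAlgebra.ι ℂ (g x) * t + TensorAlgebra.ι ℂ (w x) * lcoder w g t := by
  have : lcoder w g ∘ₗ LinearMap.mulLeft ℂ (TensorAlgebra.ι ℂ x) =
      LinearMap.mulLeft ℂ (TensorAlgebra.ι ℂ (g x)) +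
        LinearMap.mulLeft ℂ (TensorAlgebra.ι ℂ (w x)) ∘ₗ lcoder w g := by
    refine ext_word fun l => ?_
    have hp : ∀ s, proj (tmap w s) = w (proj s) := LinearMap.congr_fun (proj_comp_tmap w)
    rw [LinearMap.comp_apply, LinearMap.mulLeft_apply, ← word_cons,
      (isCoder_lcoder w g).map_word (by simp), Finset.sum_range_succ', Finset.sum_eq_zero]
    · simp [proj_lcoder]
    · intro i hi
      have hi := Finset.mem_range.1 hi
      rw [proj_lcoder, hp, proj_word _ (by rw [List.length_cons, List.length_take]; omega)]
      simp
  exact LinearMap.congr_fun this t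

theorem lcoder_one (w g : H →ₗ[ℂ] H) : lcoder w g 1 = 0 := (isCoder_lcoder w g).map_one

theorem lcoder_ι (w g : H →ₗ[ℂ] H) (x : H) :
    lcoder w g (TensorAlgebra.ι ℂ x) = TensorAlgebra.ι ℂ (g x) := by
  have := lcoder_ι_mul w g x 1
  simpa [lcoder_one] using this

theorem lcoder_mul_ι (w g : H →ₗ[ℂ] H) (t : TensorAlgebra ℂ H) (y : H) :
    lcoder w g (t * TensorAlgebra.ι ℂ y) =
      lcoder w g t * TensorAlgebra.ι ℂ y + tmap w t * TensorAlgebra.ι ℂ (g y) := by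
  induction t using word_induction with
  | word l =>
    induction l with
    | nil => simp [lcoder_ι, lcoder_one]
    | cons x l ih =>
      rw [word_cons, mul_assoc, lcoder_ι_mul, ih, lcoder_ι_mul, tmap_mul, tmap_ι]
      simp only [mul_add, add_mul, mul_assoc, add_assoc]
  | zero => simp
  | add a b ha hb => simp only [add_mul, map_add, ha, hb]; abel
  | smul c a ha => simp only [smul_mul_assoc, map_smul, ha, smul_add]

theorem lcoder_eq_zero (w : H →ₗ[ℂ] H) {g : H →ₗ[ℂ] H} {t : TensorAlgebra ℂ H}
    (ht : t ∈ tens (LinearMap.ker g)) : lcoder w g t = 0 := by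
  rw [← Submodule.mem_bot ℂ]
  refine tens_le_comap (fun l hl => ?_) ht
  rw [Submodule.mem_bot]
  induction l with
  | nil => simp [lcoder_one]
  | cons x l ih =>
    simp only [List.mem_cons, forall_eq_or_imp, LinearMap.mem_ker] at hl
    rw [word_cons, lcoder_ι_mul, hl.1, ih hl.2]
    simp

theorem lcoder_mem_fil (w g : H →ₗ[ℂ] H) {n : ℕ} {t : TensorAlgebra ℂ H} (ht : t ∈ fil n) :
    lcoder w g t ∈ fil n :=
  (isCoder_lcoder w g).mem_fil (by simp) ht

theorem tmap_mem_fil (g : H →ₗ[ℂ] H) {n : ℕ} {t : TensorAlgebra ℂ H} (ht : t ∈ fil n) :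
    tmap g t ∈ fil n :=
  (isCohom_tmap g).mem_fil ht

theorem tmap_mem_tens (g : H →ₗ[ℂ] H) (t : TensorAlgebra ℂ H) :
    tmap g t ∈ tens (LinearMap.range g) := by
  induction t using word_induction with
  | word l =>
    rw [tmap_word]
    exact word_mem_tens (by simp)
  | zero => simp
  | add a b ha hb => rw [map_add]; exact add_mem ha hb
  | smul c a ha => rw [map_smul]; exact Submodule.smul_mem _ _ ha

theorem lcoder_tmap {P : H →ₗ[ℂ] H} (hP : ∀ x, P (P x) = P x) (t : TensorAlgebra ℂ H) :
    lcoder LinearMap.id (LinearMap.id - P) (tmap P t) = 0 := by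
  refine lcoder_eq_zero _ ?_
  refine tens_le_comap (φ := LinearMap.id) (fun l hl => word_mem_tens fun x hx => ?_)
    (tmap_mem_tens P t)
  obtain ⟨y, rfl⟩ := hl x hx
  simp [hP]

/-! ### The projection onto the kernel of an operator with eigenvalues `0, 1, 2, …` -/

section KerProj

variable {M M' : Type*} [AddCommGroup M] [Module ℂ M] [AddCommGroup M'] [Module ℂ M']

/-- The product `∏_{1 ≤ b ≤ a} (1 - L / b)`. -/
def kerProj (L : Module.End ℂ M) : ℕ → Module.End ℂ M
  | 0 => 1
  | a + 1 => (1 - ((a : ℂ) + 1)⁻¹ • L) * kerProj L a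

theorem commute_kerProj (L : Module.End ℂ M) (a : ℕ) : Commute L (kerProj L a) := by
  induction a with
  | zero => exact Commute.one_right L
  | succ a ih =>
    exact ((Commute.one_right L).sub_right ((Commute.refl L).smul_right _)).mul_right ih

theorem kerProj_succ_apply (L : Module.End ℂ M) (a : ℕ) (v : M) :
    kerProj L (a + 1) v = kerProj L a v - ((a : ℂ) + 1)⁻¹ • L (kerProj L a v) := rfl

theorem kerProj_intertwine {L : Module.End ℂ M} {L' : Module.End ℂ M'} (A : M →ₗ[ℂ] M')
    (h : ∀ v, L' (A v) = A (L v)) (a : ℕ) (v : M) : kerProj L' a (A v) = A (kerProj L a v) := by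
  induction a with
  | zero => rfl
  | succ a ih => rw [kerProj_succ_apply, kerProj_succ_apply, ih, h, map_sub, map_smul]

theorem kerProj_shift {L : Module.End ℂ M} {L' : Module.End ℂ M'} (A : M →ₗ[ℂ] M')
    (h : ∀ v, L' (A v) = A (v + L v)) (a : ℕ) (v : M) :
    kerProj L' (a + 1) (A v) = -((a : ℂ) + 1)⁻¹ • A (L (kerProj L a v)) := by
  induction a with
  | zero => rw [kerProj_succ_apply]; simp [kerProj, h]
  | succ a ih =>
    have h1 : (a : ℂ) + 1 ≠ 0 := by exact_mod_cast Nat.succ_ne_zero a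
    have h2 : (a : ℂ) + 1 + 1 ≠ 0 := by exact_mod_cast Nat.succ_ne_zero (a + 1)
    rw [kerProj_succ_apply, ih, kerProj_succ_apply L, map_smul, h]
    push_cast
    simp only [map_sub, map_smul, map_add, smul_sub, smul_add, smul_smul]
    match_scalars <;> field_simp
    all_goals ring

/-- `∑_{1 ≤ b ≤ a} b⁻¹ ∏_{c < b} (1 - L / c)`. -/
def kerProjInv (L : Module.End ℂ M) (a : ℕ) : Module.End ℂ M :=
  ∑ b ∈ Finset.range a, ((b : ℂ) + 1)⁻¹ • kerProj L b

theorem apply_kerProjInv (L : Module.End ℂ M) (a : ℕ) (v : M) :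
    L (kerProjInv L a v) = v - kerProj L a v := by
  induction a with
  | zero => simp [kerProjInv, kerProj]
  | succ a ih =>
    have : kerProjInv L (a + 1) v = kerProjInv L a v + ((a : ℂ) + 1)⁻¹ • kerProj L a v := by
      rw [kerProjInv, Finset.sum_range_succ]; rfl
    rw [this, map_add, ih, map_smul, kerProj_succ_apply]
    abel

theorem kerProj_mem {L : Module.End ℂ M} {S : Submodule ℂ M} (h : ∀ v ∈ S, L v ∈ S) (a : ℕ)
    {v : M} (hv : v ∈ S) : kerProj L a v ∈ S := by
  induction a with
  | zero => exact hv
  | succ a ih => exact sub_mem ih (Submodule.smul_mem _ _ (h _ ih))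

theorem kerProjInv_mem {L : Module.End ℂ M} {S : Submodule ℂ M} (h : ∀ v ∈ S, L v ∈ S) (a : ℕ)
    {v : M} (hv : v ∈ S) : kerProjInv L a v ∈ S := by
  rw [kerProjInv, LinearMap.sum_apply]
  exact sum_mem fun b _ => Submodule.smul_mem _ _ (kerProj_mem h b hv)

end KerProj

/-- On words of length at most `a`, the kernel of the derivation of `1 - P` is the image of
`P ⊗ ⋯ ⊗ P`. -/
theorem kerProj_lcoder {P : H →ₗ[ℂ] H} (hP : ∀ x, P (P x) = P x) {a : ℕ} {t : TensorAlgebra ℂ H}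
    (ht : t ∈ fil a) : kerProj (lcoder LinearMap.id (LinearMap.id - P)) a t = tmap P t := by
  set L : Module.End ℂ (TensorAlgebra ℂ H) := lcoder LinearMap.id (LinearMap.id - P) with hL
  have hLP : ∀ t, L (tmap P t) = 0 := lcoder_tmap hP
  have hLι : ∀ x t, L (TensorAlgebra.ι ℂ x * t) =
      TensorAlgebra.ι ℂ (x - P x) * t + TensorAlgebra.ι ℂ x * L t := fun x t =>
    lcoder_ι_mul _ _ x t
  refine eq_on_fil (fun l hl => ?_) ht
  clear ht t
  induction l generalizing a with
  | nil =>
    rw [word_nil, tmap_one]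
    have := kerProj_intertwine (L := (0 : Module.End ℂ ℂ)) (L' := L)
      (LinearMap.toSpanSingleton ℂ _ 1) (fun v => by simp [hL, lcoder_one]) a 1
    have h0 : kerProj (0 : Module.End ℂ ℂ) a 1 = 1 := by
      clear this
      induction a with
      | zero => rfl
      | succ a ih => rw [kerProj_succ_apply, ih (by simp)]; simp
    rw [h0] at this
    simpa using this
  | cons x l ih =>
    cases a with
    | zero => simp at hl
    | succ a =>
      simp only [List.length_cons, add_le_add_iff_right] at hl
      have h1 := kerProj_intertwine (L := L) (L' := L)
        (LinearMap.mulLeft ℂ (TensorAlgebra.ι ℂ (P x)))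
        (fun v => by simp [hLι, hP]) (a + 1) (word l)
      have h2 := kerProj_shift (L := L) (L' := L)
        (LinearMap.mulLeft ℂ (TensorAlgebra.ι ℂ (x - P x)))
        (fun v => by
          rw [LinearMap.mulLeft_apply, hLι, LinearMap.mulLeft_apply, mul_add]
          simp [hP]) a (word l)
      rw [ih hl, hLP] at h2
      rw [ih (by omega)] at h1
      simp only [LinearMap.mulLeft_apply, mul_zero, smul_zero] at h1 h2
      have : word (x :: l) = TensorAlgebra.ι ℂ (P x) * word l +
          TensorAlgebra.ι ℂ (x - P x) * word l := by
        rw [← add_mul, ← map_add, word_cons]; simp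
      rw [this, map_add, h1, h2, map_add, tmap_mul, tmap_mul, tmap_ι, tmap_ι]
      simp [hP]

/-- The Laplacian on multilinear maps: `L φ = φ L + (1 - P) φ`. -/
def laplace (P : H →ₗ[ℂ] H) : Module.End ℂ (TensorAlgebra ℂ H →ₗ[ℂ] H) where
  toFun φ := φ ∘ₗ lcoder LinearMap.id (LinearMap.id - P) + (LinearMap.id - P) ∘ₗ φ
  map_add' φ ψ := by rw [LinearMap.add_comp, LinearMap.comp_add]; abel
  map_smul' c φ := by rw [LinearMap.smul_comp, LinearMap.comp_smul, smul_add]; rfl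

theorem laplace_apply (P : H →ₗ[ℂ] H) (φ : TensorAlgebra ℂ H →ₗ[ℂ] H) (t : TensorAlgebra ℂ H) :
    laplace P φ t = φ (lcoder LinearMap.id (LinearMap.id - P) t) + (φ t - P (φ t)) := rfl

/-- Precomposition with the powers of an operator. -/
theorem kerProj_comp {M N : Type*} [AddCommGroup M] [Module ℂ M] [AddCommGroup N] [Module ℂ N]
    (L : Module.End ℂ M) (φ : M →ₗ[ℂ] N) (a : ℕ) (t : M) :
    kerProj (LinearMap.lcomp ℂ N L : Module.End ℂ (M →ₗ[ℂ] N)) a φ t = φ (kerProj L a t) := by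
  induction a generalizing t with
  | zero => rfl
  | succ a ih =>
    have hc : L (kerProj L a t) = kerProj L a (L t) :=
      LinearMap.congr_fun (commute_kerProj L a).eq t
    rw [kerProj_succ_apply, kerProj_succ_apply, LinearMap.sub_apply, LinearMap.smul_apply,
      LinearMap.lcomp_apply, ih, ih, map_sub, map_smul, hc]

theorem kerProj_laplace {P : H →ₗ[ℂ] H} (hP : ∀ x, P (P x) = P x) {a : ℕ}
    {φ : TensorAlgebra ℂ H →ₗ[ℂ] H}
    (hφ : ∀ t ∈ fil a, t ∈ tens (LinearMap.range P) → P (φ t) = 0)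
    {t : TensorAlgebra ℂ H} (ht : t ∈ fil a) : kerProj (laplace P) (a + 1) φ t = 0 := by
  set L : Module.End ℂ (TensorAlgebra ℂ H) := lcoder LinearMap.id (LinearMap.id - P) with hL
  have h1 := kerProj_intertwine (L := LinearMap.lcomp ℂ H L) (L' := laplace P)
    (LinearMap.compRight ℂ (M := TensorAlgebra ℂ H) P)
    (fun v => by ext1 s; simp [laplace_apply, hP, ← hL]) (a + 1) φ
  have h2 := kerProj_shift (L := LinearMap.lcomp ℂ H L) (L' := laplace P)
    (LinearMap.compRight ℂ (M := TensorAlgebra ℂ H) (LinearMap.id - P))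
    (fun v => by ext1 s; simp [laplace_apply, hP, ← hL]; abel) a φ
  have h3 : φ = LinearMap.compRight ℂ (M := TensorAlgebra ℂ H) P φ +
      LinearMap.compRight ℂ (M := TensorAlgebra ℂ H) (LinearMap.id - P) φ := by
    ext1 s; simp
  have hLP : L (tmap P t) = 0 := lcoder_tmap hP t
  have h4 : kerProj L a (L t) = 0 := by
    have hc : L (kerProj L a t) = kerProj L a (L t) :=
      LinearMap.congr_fun (commute_kerProj L a).eq t
    rw [← hc, kerProj_lcoder hP ht, hLP]
  rw [h3, map_add, h1, h2]
  simp only [LinearMap.add_apply, LinearMap.smul_apply, LinearMap.compRight_apply,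
    LinearMap.comp_apply, LinearMap.lcomp_apply, kerProj_comp]
  rw [h4, kerProj_lcoder hP (fil_mono (Nat.le_succ a) ht),
    hφ _ (tmap_mem_fil P ht) (tmap_mem_tens P t)]
  simp

end TensorCoalgebra

namespace ConformalBackground

variable {H : Type*} [AddCommGroup H] [Module ℂ H] {B : ConformalBackground H}

/-! ### Deformation cochains -/

/-- Cyclic symmetry of the corestriction of a coderivation twisted by the sign `w`. -/
def Cyc (B : ConformalBackground H) (w : ℂ) (φ : TensorAlgebra ℂ H →ₗ[ℂ] H) : Prop :=
  ∀ (x y : H) (t : TensorAlgebra ℂ H), B.ω (φ (TensorAlgebra.ι ℂ x * t)) y =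
    -B.ω (B.scale w x) (φ (t * TensorAlgebra.ι ℂ y))

theorem form_comp_coder_word (w : ℂ) {φ : TensorAlgebra ℂ H →ₗ[ℂ] H} (h1 : φ 1 = 0) (x y : H)
    (l : List H) : B.form (coder (tmap (B.scale w)) φ (word (x :: (l ++ [y])))) =
      B.ω (φ (TensorAlgebra.ι ℂ x * word l)) y +
        B.ω (B.scale w x) (φ (word l * TensorAlgebra.ι ℂ y)) := by
  have hc := isCoder_coder (isCohom_tmap (B.scale w)) h1
  have := LinearMap.congr_fun (form_comp_coder (B := B) hc) (word (x :: (l ++ [y])))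
  rw [LinearMap.comp_apply] at this
  rw [this, proj_comp_coder (isCohom_tmap (B.scale w)) h1, proj_comp_tmap, LinearMap.add_apply,
    ← List.cons_append, pairing_proj_right, List.cons_append, pairing_proj_left, word_append,
    word_cons, word_singleton]

theorem cyc_of_form {w : ℂ} {φ : TensorAlgebra ℂ H →ₗ[ℂ] H} (h1 : φ 1 = 0)
    (h : B.form ∘ₗ coder (tmap (B.scale w)) φ = 0) : B.Cyc w φ := by
  intro x y t
  have : (B.ω.flip y) ∘ₗ φ ∘ₗ LinearMap.mulLeft ℂ (TensorAlgebra.ι ℂ x) =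
      -(B.ω (B.scale w x) ∘ₗ φ ∘ₗ LinearMap.mulRight ℂ (TensorAlgebra.ι ℂ y)) := by
    refine ext_word fun l => ?_
    have h2 := LinearMap.congr_fun h (word (x :: (l ++ [y])))
    rw [LinearMap.comp_apply, form_comp_coder_word w h1, LinearMap.zero_apply] at h2
    simpa using eq_neg_of_add_eq_zero_left h2
  simpa using LinearMap.congr_fun this t

theorem form_of_cyc {w : ℂ} {φ : TensorAlgebra ℂ H →ₗ[ℂ] H} (h1 : φ 1 = 0) (h : B.Cyc w φ) :
    B.form ∘ₗ coder (tmap (B.scale w)) φ = 0 := by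
  have hc := isCoder_coder (isCohom_tmap (B.scale w)) h1
  refine ext_word fun l => ?_
  rcases l with _ | ⟨x, l⟩
  · rw [LinearMap.comp_apply, word_nil, hc.map_one, map_zero, LinearMap.zero_apply]
  · rcases l.eq_nil_or_concat with rfl | ⟨l, y, rfl⟩
    · have h2 := hc.map_word (by simp) x []
      rw [LinearMap.comp_apply, h2]
      have : ∀ z : H, B.form (TensorAlgebra.ι ℂ z) = 0 := by
        intro z
        rw [← word_singleton, pairing_word]
        simp [Finset.sum_range_succ]
      simp [hc.map_one, this]
    · rw [LinearMap.comp_apply, List.concat_eq_append, form_comp_coder_word w h1, h x y]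
      simp

variable {R : H →ₗ[ℂ] H}

theorem deg_comp_proj {e : ℤ} {g : H →ₗ[ℂ] H} (hg : B.OpHasDegree e g) : B.Deg e (g ∘ₗ proj) := by
  intro z hz
  rw [← LinearMap.comp_assoc, B.scale_of_opHasDegree hg hz, LinearMap.smul_comp,
    LinearMap.comp_assoc, LinearMap.comp_assoc, proj_comp_tmap]

theorem lcoder_sgn_deg {e : ℤ} {g : H →ₗ[ℂ] H} (hg : B.OpHasDegree e g) {z : ℂ} (hz : z ≠ 0) :
    tmap (B.scale z) ∘ₗ lcoder B.sgn g = z ^ e • (lcoder B.sgn g ∘ₗ tmap (B.scale z)) :=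
  coder_deg (by simp) (deg_comp_proj hg) (-1) hz

theorem lcoder_sgn_anti {g : H →ₗ[ℂ] H} (hg : ∀ x, B.sgn (g x) = -g (B.sgn x)) :
    tmap B.sgn ∘ₗ lcoder B.sgn g = -(lcoder B.sgn g ∘ₗ tmap B.sgn) := by
  ext1 t
  induction t using word_induction with
  | word l =>
    induction l with
    | nil => simp [lcoder_one]
    | cons x l ih =>
      simp only [LinearMap.comp_apply, LinearMap.neg_apply] at ih ⊢
      rw [word_cons, lcoder_ι_mul, map_add, tmap_mul, tmap_mul, tmap_mul, ih]
      simp only [tmap_ι, lcoder_ι_mul, hg, map_neg, neg_mul, mul_neg]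
      abel
  | zero => simp
  | add a b ha hb => rw [map_add, map_add, ha, hb]
  | smul c a ha => rw [map_smul, map_smul, ha]

namespace IsHodge

theorem sgn_R (hR : B.IsHodge R) (x : H) : B.sgn (R x) = -R (B.sgn x) :=
  B.sgn_of_opHasDegree_neg_one hR.degree x

/-- The anticommutator of the coderivations of `Q` and `R` is the derivation of `1 - P`. -/
theorem lcoder_anticomm (hR : B.IsHodge R) :
    lcoder B.sgn B.Q ∘ₗ lcoder B.sgn R + lcoder B.sgn R ∘ₗ lcoder B.sgn B.Q =
      lcoder LinearMap.id (LinearMap.id - B.onShell R) := by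
  have h1 := (isCoder_lcoder B.sgn B.Q).anticomm (isCoder_lcoder B.sgn R) tmap_sgn_comp
    (lcoder_sgn_anti (sgn_Q B)) (lcoder_sgn_anti hR.sgn_R)
  have h2 := isCoder_lcoder LinearMap.id (LinearMap.id - B.onShell R)
  rw [tmap_id] at h2
  refine h1.ext rfl h2 ?_
  ext1 t
  simp only [LinearMap.comp_apply, LinearMap.add_apply, map_add, proj_lcoder, LinearMap.sub_apply,
    LinearMap.id_apply, onShell_apply]
  abel

theorem lcoder_Q_sq (B : ConformalBackground H) (t : TensorAlgebra ℂ H) :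
    lcoder B.sgn B.Q (lcoder B.sgn B.Q t) = 0 := by
  have := (isCoder_lcoder B.sgn B.Q).sq_eq_zero tmap_sgn_comp (lcoder_sgn_anti (sgn_Q B)) (by
    ext1 t; simp [proj_lcoder, B.Q_sq])
  exact LinearMap.congr_fun this t

theorem lcoder_apply (hR : B.IsHodge R) (t : TensorAlgebra ℂ H) :
    lcoder LinearMap.id (LinearMap.id - B.onShell R) t =
      lcoder B.sgn B.Q (lcoder B.sgn R t) + lcoder B.sgn R (lcoder B.sgn B.Q t) :=
  (LinearMap.congr_fun hR.lcoder_anticomm t).symm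

theorem lcoder_comm_Q (hR : B.IsHodge R) (t : TensorAlgebra ℂ H) :
    lcoder LinearMap.id (LinearMap.id - B.onShell R) (lcoder B.sgn B.Q t) =
      lcoder B.sgn B.Q (lcoder LinearMap.id (LinearMap.id - B.onShell R) t) := by
  rw [hR.lcoder_apply, hR.lcoder_apply, map_add, lcoder_Q_sq, lcoder_Q_sq, map_zero]
  abel

theorem lcoder_comm_scale (hR : B.IsHodge R) {z : ℂ} (hz : z ≠ 0) (t : TensorAlgebra ℂ H) :
    tmap (B.scale z) (lcoder LinearMap.id (LinearMap.id - B.onShell R) t) =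
      lcoder LinearMap.id (LinearMap.id - B.onShell R) (tmap (B.scale z) t) := by
  have h1 : ∀ s, _ = _ := LinearMap.congr_fun (lcoder_sgn_deg (B := B) (e := 1) B.Q_deg hz)
  have h2 : ∀ s, _ = _ := LinearMap.congr_fun (lcoder_sgn_deg hR.degree hz)
  simp only [LinearMap.comp_apply, LinearMap.smul_apply] at h1 h2
  rw [hR.lcoder_apply, hR.lcoder_apply, map_add, h1, h2, h2, h1]
  simp only [map_smul, smul_smul, zpow_one, zpow_neg]
  rw [mul_inv_cancel₀ hz, inv_mul_cancel₀ hz, one_smul, one_smul]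

end IsHodge

/-- The cyclic cochains of degree one which vanish on words of length at most `j` and are closed on
words of length at most `j + 1`. -/
def cochains (B : ConformalBackground H) (j : ℕ) : Submodule ℂ (TensorAlgebra ℂ H →ₗ[ℂ] H) where
  carrier := {φ | (∀ t ∈ fil j, φ t = 0) ∧ B.Cyc (-1) φ ∧ B.Deg 1 φ ∧
    ∀ t ∈ fil (j + 1), B.Q (φ t) + φ (lcoder B.sgn B.Q t) = 0}
  add_mem' := by
    rintro φ ψ ⟨h1, h2, h3, h4⟩ ⟨h1', h2', h3', h4'⟩
    refine ⟨fun t ht => by simp [h1 t ht, h1' t ht], fun x y t => ?_, fun z hz => ?_,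
      fun t ht => ?_⟩
    · simp only [LinearMap.add_apply, map_add, h2 x y t, h2' x y t]; ring
    · rw [LinearMap.comp_add, h3 z hz, h3' z hz, LinearMap.add_comp, smul_add]
    · simp only [LinearMap.add_apply, map_add]
      rw [add_add_add_comm, h4 t ht, h4' t ht, add_zero]
  zero_mem' := ⟨fun t _ => rfl, fun x y t => by simp, fun z hz => by simp, fun t _ => by simp⟩
  smul_mem' := by
    rintro c φ ⟨h1, h2, h3, h4⟩
    refine ⟨fun t ht => by simp [h1 t ht], fun x y t => ?_, fun z hz => ?_, fun t ht => ?_⟩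
    · simp only [LinearMap.smul_apply, map_smul, h2 x y t, smul_neg]
    · rw [LinearMap.comp_smul, h3 z hz, LinearMap.smul_comp, smul_comm]
    · simp only [LinearMap.smul_apply, map_smul]
      rw [← smul_add, h4 t ht, smul_zero]

theorem laplace_mem_cochains (hR : B.IsHodge R) {j : ℕ} {φ : TensorAlgebra ℂ H →ₗ[ℂ] H}
    (hφ : φ ∈ B.cochains j) : laplace (B.onShell R) φ ∈ B.cochains j := by
  obtain ⟨h1, h2, h3, h4⟩ := hφ
  refine ⟨fun t ht => ?_, fun x y t => ?_, fun z hz => ?_, fun t ht => ?_⟩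
  · rw [laplace_apply, h1 t ht, h1 _ (lcoder_mem_fil _ _ ht)]; simp
  · have h2 : ∀ (x y : H) (t : TensorAlgebra ℂ H), B.ω (φ (TensorAlgebra.ι ℂ x * t)) y =
          -B.ω (B.scale (-1) x) (φ (t * TensorAlgebra.ι ℂ y)) := h2
    rw [laplace_apply, laplace_apply, lcoder_ι_mul, lcoder_mul_ι, tmap_id]
    simp only [map_add, sub_mul, mul_sub, map_sub, LinearMap.add_apply, LinearMap.sub_apply,
      LinearMap.id_apply, h2, hR.P_symm, hR.scale_P (show (-1 : ℂ) ≠ 0 by norm_num)]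
    ring
  · ext1 t
    have h : ∀ s, B.scale z (φ s) = z ^ (1 : ℤ) • φ (tmap (B.scale z) s) :=
      LinearMap.congr_fun (h3 z hz)
    simp only [LinearMap.comp_apply, LinearMap.smul_apply, laplace_apply, map_add, map_sub,
      hR.scale_P hz, h, hR.lcoder_comm_scale hz, map_smul, smul_add, smul_sub]
  · have h5 := h4 _ (lcoder_mem_fil LinearMap.id (LinearMap.id - B.onShell R) ht)
    have h6 := h4 t ht
    have h7 : B.onShell R (φ (lcoder B.sgn B.Q t)) = 0 := by
      rw [eq_neg_of_add_eq_zero_right h6, map_neg, hR.P_Q, neg_zero]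
    rw [laplace_apply, laplace_apply, hR.lcoder_comm_Q, h7, map_add, map_sub, hR.Q_P, sub_zero,
      sub_zero, add_add_add_comm, h5, h6, add_zero]

/-- The homotopy `X = φ R - R φ`. -/
def homotopy (B : ConformalBackground H) (R : H →ₗ[ℂ] H) (φ : TensorAlgebra ℂ H →ₗ[ℂ] H) :
    TensorAlgebra ℂ H →ₗ[ℂ] H :=
  φ ∘ₗ lcoder B.sgn R - R ∘ₗ φ

theorem homotopy_apply (R : H →ₗ[ℂ] H) (φ : TensorAlgebra ℂ H →ₗ[ℂ] H) (t : TensorAlgebra ℂ H) :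
    B.homotopy R φ t = φ (lcoder B.sgn R t) - R (φ t) := rfl

section Homotopy

variable {j : ℕ} {φ : TensorAlgebra ℂ H →ₗ[ℂ] H}

theorem homotopy_eq_zero (hφ : φ ∈ B.cochains j) {t : TensorAlgebra ℂ H} (ht : t ∈ fil j) :
    B.homotopy R φ t = 0 := by
  rw [homotopy_apply, hφ.1 t ht, hφ.1 _ (lcoder_mem_fil _ _ ht)]; simp

theorem homotopy_cyc (hR : B.IsHodge R) (hφ : φ ∈ B.cochains j) :
    B.Cyc 1 (B.homotopy R φ) := by
  intro x y t
  have h : ∀ s, B.sgn (φ s) = -φ (tmap B.sgn s) := fun s => by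
    have := LinearMap.congr_fun (hφ.2.2.1 (-1) (by norm_num)) s
    simpa using this
  have h2 : ∀ (x y : H) (t : TensorAlgebra ℂ H), B.ω (φ (TensorAlgebra.ι ℂ x * t)) y =
      -B.ω (B.scale (-1) x) (φ (t * TensorAlgebra.ι ℂ y)) := hφ.2.1
  rw [homotopy_apply, homotopy_apply, lcoder_ι_mul, lcoder_mul_ι, B.scale_one]
  simp only [map_add, map_sub, LinearMap.add_apply, LinearMap.sub_apply, LinearMap.id_apply, h2]
  rw [hR.R_symm (φ _), h, tmap_mul, tmap_ι, map_neg, LinearMap.neg_apply, h2, hR.sgn_R, map_neg,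
    LinearMap.neg_apply, hR.R_symm]
  simp only [B.sgn_sgn]
  ring

theorem homotopy_deg (hR : B.IsHodge R) (hφ : φ ∈ B.cochains j) : B.Deg 0 (B.homotopy R φ) := by
  intro z hz
  ext1 t
  have h : ∀ s, B.scale z (φ s) = z ^ (1 : ℤ) • φ (tmap (B.scale z) s) :=
    LinearMap.congr_fun (hφ.2.2.1 z hz)
  have h2 : ∀ s, _ = _ := LinearMap.congr_fun (lcoder_sgn_deg hR.degree hz)
  simp only [LinearMap.comp_apply, LinearMap.smul_apply] at h2
  simp only [LinearMap.comp_apply, homotopy_apply, map_sub, h, h2,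
    hR.scale_R hz, map_smul, smul_smul, zpow_one, zpow_neg, zpow_zero, one_smul]
  rw [mul_inv_cancel₀ hz, inv_mul_cancel₀ hz, one_smul, one_smul]

theorem homotopy_closed (hR : B.IsHodge R) (hφ : φ ∈ B.cochains j) {t : TensorAlgebra ℂ H}
    (ht : t ∈ fil (j + 1)) :
    B.homotopy R φ (lcoder B.sgn B.Q t) - B.Q (B.homotopy R φ t) =
      laplace (B.onShell R) φ t := by
  have h1 := eq_neg_of_add_eq_zero_left (hφ.2.2.2 t ht)
  have h2 := eq_neg_of_add_eq_zero_left (hφ.2.2.2 _ (lcoder_mem_fil B.sgn R ht))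
  have h3 := eq_neg_of_add_eq_zero_right (hφ.2.2.2 t ht)
  rw [homotopy_apply, homotopy_apply, laplace_apply, hR.lcoder_apply, map_sub, map_add, h2, h3,
    IsHodge.onShell_apply, map_neg]
  abel

theorem homotopy_mem_range {t : TensorAlgebra ℂ H} (ht : t ∈ tens (LinearMap.ker R)) :
    B.homotopy R φ t ∈ LinearMap.range R := by
  rw [homotopy_apply, lcoder_eq_zero _ ht, map_zero, zero_sub]
  exact neg_mem ⟨_, rfl⟩

end Homotopy

end ConformalBackground

namespace TensorCoalgebra

variable {H : Type*} [AddCommGroup H] [Module ℂ H]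

/-! ### Comparison of coalgebra morphisms -/

theorem IsCohom.eq_add_of_proj_eq {F F' : TensorAlgebra ℂ H →ₗ[ℂ] TensorAlgebra ℂ H}
    (hF : IsCohom F) (hF' : IsCohom F') {n : ℕ}
    (h : ∀ t ∈ fil n, proj (F t) = proj (F' t)) {t : TensorAlgebra ℂ H} (ht : t ∈ fil (n + 1)) :
    F t = F' t + TensorAlgebra.ι ℂ (proj (F t) - proj (F' t)) := by
  refine eq_on_fil (φ := F) (ψ := F' + TensorAlgebra.ι ℂ ∘ₗ (proj ∘ₗ F - proj ∘ₗ F'))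
    (fun l hl => ?_) ht
  clear ht t
  change F (word l) = F' (word l) + TensorAlgebra.ι ℂ (proj (F (word l)) - proj (F' (word l)))
  induction hk : l.length using Nat.strong_induction_on generalizing l with
  | _ k ih =>
    cases l with
    | nil => simp [hF.map_one, hF'.map_one]
    | cons x l =>
      simp only [List.length_cons] at hl hk
      have aux : ∀ A A' S u u' : TensorAlgebra ℂ H, A = S + u → A' = S + u' → A = A' + (u - u') := by
        rintro _ _ S u u' rfl rfl; abel
      have e := hF.map_word x l
      have e' := hF'.map_word x l
      rw [Finset.sum_range_succ, List.take_length, List.drop_length, word_nil] at e e'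
      rw [hF.map_one, mul_one] at e
      rw [hF'.map_one, mul_one] at e'
      rw [map_sub]
      refine aux _ _ _ _ _ (e.trans (congrArg (· + _) (Finset.sum_congr rfl fun i hi => ?_))) e'
      have hi := Finset.mem_range.1 hi
      have h1 := h (word (x :: l.take i)) (word_mem_fil (by simp; omega))
      have h2 := h (word (l.drop i)) (word_mem_fil (by simp; omega))
      rw [h1, ih (l.drop i).length (by simp; omega) _ (by simp; omega) rfl, h2]
      simp

theorem IsCohom.eq_of_proj_eq {F F' : TensorAlgebra ℂ H →ₗ[ℂ] TensorAlgebra ℂ H}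
    (hF : IsCohom F) (hF' : IsCohom F') {n : ℕ}
    (h : ∀ t ∈ fil n, proj (F t) = proj (F' t)) {t : TensorAlgebra ℂ H} (ht : t ∈ fil n) :
    F t = F' t := by
  rw [hF.eq_add_of_proj_eq hF' h (fil_mono (Nat.le_succ n) ht), h t ht]
  simp

theorem IsCohom.eq_on_tens {F F' : TensorAlgebra ℂ H →ₗ[ℂ] TensorAlgebra ℂ H}
    (hF : IsCohom F) (hF' : IsCohom F') {K : Submodule ℂ H}
    (h : ∀ t ∈ tens K, proj (F t) = proj (F' t)) {t : TensorAlgebra ℂ H} (ht : t ∈ tens K) :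
    F t = F' t := by
  rw [← sub_eq_zero, ← LinearMap.sub_apply, ← Submodule.mem_bot ℂ]
  refine tens_le_comap (fun l hl => ?_) ht
  rw [Submodule.mem_bot, LinearMap.sub_apply, sub_eq_zero]
  clear ht t
  induction hk : l.length using Nat.strong_induction_on generalizing l with
  | _ k ih =>
    cases l with
    | nil => rw [word_nil, hF.map_one, hF'.map_one]
    | cons x l =>
      simp only [List.mem_cons, forall_eq_or_imp, List.length_cons] at hl hk
      rw [hF.map_word, hF'.map_word]
      refine Finset.sum_congr rfl fun i _ => ?_
      rw [ih (l.drop i).length (by simp; omega) _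
        (fun y hy => hl.2 y (List.mem_of_mem_drop hy)) rfl, h _ (word_mem_tens ?_)]
      simp only [List.mem_cons, forall_eq_or_imp]
      exact ⟨hl.1, fun y hy => hl.2 y (List.mem_of_mem_take hy)⟩

theorem proj_mem_of_mem_tens {K : Submodule ℂ H} {t : TensorAlgebra ℂ H} (ht : t ∈ tens K) :
    proj t ∈ K := by
  refine tens_le_comap (fun l hl => ?_) ht
  rcases l with _ | ⟨x, _ | ⟨y, l⟩⟩
  · simp
  · simpa [word_singleton] using hl
  · rw [proj_word _ (by simp)]; exact zero_mem _

theorem IsCoder.apply_of_proj_eq_zero {α D : TensorAlgebra ℂ H →ₗ[ℂ] TensorAlgebra ℂ H}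
    (hD : IsCoder α D) (hα : α 1 = 1) {j : ℕ} (h : ∀ t ∈ fil j, proj (D t) = 0)
    {t : TensorAlgebra ℂ H} (ht : t ∈ fil (j + 1)) : D t = TensorAlgebra.ι ℂ (proj (D t)) :=
  eq_on_fil (φ := D) (ψ := TensorAlgebra.ι ℂ ∘ₗ proj ∘ₗ D)
    (fun l hl => hD.map_word_of_proj_eq_zero hα (k := j + 1)
      (fun l hl => h _ (word_mem_fil (by omega))) l hl) ht

theorem higher_eq_zero (φ : TensorAlgebra ℂ H →ₗ[ℂ] H) {t : TensorAlgebra ℂ H} (ht : t ∈ fil 1) :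
    higher φ t = 0 :=
  eq_on_fil (ψ := 0) (fun l hl => by rw [higher_word_of_le _ hl]; rfl) ht

theorem higher_eq_self {φ : TensorAlgebra ℂ H →ₗ[ℂ] H} (h : ∀ t ∈ fil 1, φ t = 0) :
    higher φ = φ := by
  refine ext_word fun l => ?_
  by_cases hl : l.length ≤ 1
  · rw [higher_word_of_le _ hl, h _ (word_mem_fil hl)]
  · rw [higher_word_of_lt _ (by omega)]

theorem higher_sub (φ ψ : TensorAlgebra ℂ H →ₗ[ℂ] H) : higher (φ - ψ) = higher φ - higher ψ := by
  refine ext_word fun l => ?_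
  rw [LinearMap.sub_apply]
  by_cases hl : l.length ≤ 1
  · rw [higher_word_of_le _ hl, higher_word_of_le _ hl, higher_word_of_le _ hl, sub_zero]
  · rw [higher_word_of_lt _ (by omega), higher_word_of_lt _ (by omega),
      higher_word_of_lt _ (by omega), LinearMap.sub_apply]

end TensorCoalgebra

namespace ConformalBackground

variable {H : Type*} [AddCommGroup H] [Module ℂ H] {B : ConformalBackground H} {R : H →ₗ[ℂ] H}

/-! ### The difference of two algebras -/

/-- The algebras `D` and `D'` have the same tree amplitudes on `P`-states. -/
def SameAmplitudes (B : ConformalBackground H) (R : H →ₗ[ℂ] H)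
    (D D' : TensorAlgebra ℂ H →ₗ[ℂ] TensorAlgebra ℂ H) : Prop :=
  ∀ E E', IsTree R D E → IsTree R D' E' → ∀ t ∈ tens (LinearMap.range (B.onShell R)),
    B.onShell R (proj (D (E t))) = B.onShell R (proj (D' (E' t)))

section Difference

variable {D D' : TensorAlgebra ℂ H →ₗ[ℂ] TensorAlgebra ℂ H} {j : ℕ}

theorem coder_proj_sub (hD : B.IsAlg D) (hD' : B.IsAlg D') :
    coder (tmap B.sgn) (proj ∘ₗ D' - proj ∘ₗ D) = D' - D := by
  rw [coder_sub, ← hD'.coder.eq_coder (isCohom_tmap _), ← hD.coder.eq_coder (isCohom_tmap _)]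

theorem IsAlg.eq_add_of_eq (hD : B.IsAlg D) (hD' : B.IsAlg D') (h : ∀ t ∈ fil j, D t = D' t)
    {t : TensorAlgebra ℂ H} (ht : t ∈ fil (j + 1)) :
    D' t = D t + TensorAlgebra.ι ℂ ((proj ∘ₗ D' - proj ∘ₗ D) t) := by
  have h1 : (proj ∘ₗ D' - proj ∘ₗ D) 1 = 0 := by simp [hD.coder.map_one, hD'.coder.map_one]
  have hc := isCoder_coder (isCohom_tmap B.sgn) h1
  rw [coder_proj_sub hD hD'] at hc
  have := hc.apply_of_proj_eq_zero (by simp) (fun t ht => by simp [h t ht]) ht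
  rw [LinearMap.sub_apply, map_sub, sub_eq_iff_eq_add'] at this
  exact this

theorem IsAlg.proj_deg (hD : B.IsAlg D) : B.Deg 1 (proj ∘ₗ D) := by
  intro z hz
  rw [← LinearMap.comp_assoc, ← proj_comp_tmap, LinearMap.comp_assoc, hD.deg z hz, zpow_one,
    LinearMap.comp_smul, LinearMap.comp_assoc]

theorem IsAlg.sub_lcoder_mem_fil (hD : B.IsAlg D) {t : TensorAlgebra ℂ H} (ht : t ∈ fil (j + 1)) :
    D t - lcoder B.sgn B.Q t ∈ fil j := by
  have h1 : (proj ∘ₗ D - B.Q ∘ₗ proj) 1 = 0 := by simp [hD.coder.map_one]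
  have hc := isCoder_coder (isCohom_tmap B.sgn) h1
  rw [coder_sub, ← hD.coder.eq_coder (isCohom_tmap _)] at hc
  refine hc.mem_fil_of_lower (by simp) (fun x => ?_) ht
  have h2 : proj (TensorCoalgebra.coder (tmap B.sgn) (B.Q ∘ₗ proj) (TensorAlgebra.ι ℂ x)) = B.Q x := by
    have := proj_lcoder B.sgn B.Q (TensorAlgebra.ι ℂ x)
    rwa [proj_ι] at this
  rw [LinearMap.sub_apply, map_sub, h2, hD.linear, proj_ι, sub_self]

theorem sub_mem_cochains (hD : B.IsAlg D) (hD' : B.IsAlg D') (h : ∀ t ∈ fil j, D t = D' t) :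
    proj ∘ₗ D' - proj ∘ₗ D ∈ B.cochains j := by
  have h0 : ∀ t ∈ fil j, (proj ∘ₗ D' - proj ∘ₗ D) t = 0 := fun t ht => by simp [h t ht]
  have h1 : (proj ∘ₗ D' - proj ∘ₗ D) 1 = 0 := by simp [hD.coder.map_one, hD'.coder.map_one]
  refine ⟨h0, cyc_of_form h1 ?_, fun z hz => ?_, fun t ht => ?_⟩
  · rw [coder_proj_sub hD hD', LinearMap.comp_sub, hD.cyclic, hD'.cyclic, sub_zero]
  · rw [LinearMap.comp_sub, hD.proj_deg z hz, hD'.proj_deg z hz, LinearMap.sub_comp, smul_sub]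
  · have e1 := hD.eq_add_of_eq hD' h ht
    have e2 := hD.eq_add_of_eq hD' h (hD.coder.mem_fil (by simp) ht)
    have s1 : D' (D' t) = 0 := LinearMap.congr_fun hD'.sq t
    have s2 : D (D t) = 0 := LinearMap.congr_fun hD.sq t
    rw [e1, map_add, e2, s2, zero_add, hD'.linear, ← map_add] at s1
    have s3 := (TensorAlgebra.ι_leftInverse (R := ℂ)).injective (s1.trans (map_zero _).symm)
    have s4 := h0 _ (hD.sub_lcoder_mem_fil ht)
    rw [map_sub, sub_eq_zero] at s4
    rw [← s4, add_comm, s3]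

theorem IsTree.proj_ι {E : TensorAlgebra ℂ H →ₗ[ℂ] TensorAlgebra ℂ H} (hE : IsTree R D E) (x : H) :
    proj (E (TensorAlgebra.ι ℂ x)) = x := by
  rw [hE.proj_eq, higher_eq_zero _ (hE.cohom.mem_fil (ι_mem_fil x)), map_zero, sub_zero,
    TensorCoalgebra.proj_ι]

/-- Trees with the same vertices of low order agree on short words. -/
theorem IsTree.eq_add_of_eq {E E' : TensorAlgebra ℂ H →ₗ[ℂ] TensorAlgebra ℂ H}
    (hE : IsTree R D E) (hE' : IsTree R D' E') (h : ∀ t ∈ fil j, D t = D' t)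
    {t : TensorAlgebra ℂ H} (ht : t ∈ fil (j + 1)) :
    E t = E' t + TensorAlgebra.ι ℂ (proj (E t) - proj (E' t)) := by
  have hh : ∀ t ∈ fil j, higher (proj ∘ₗ D) t = higher (proj ∘ₗ D') t := by
    intro t ht
    refine eq_on_fil (fun l hl => ?_) ht
    by_cases hl1 : l.length ≤ 1
    · rw [higher_word_of_le _ hl1, higher_word_of_le _ hl1]
    · rw [higher_word_of_lt _ (by omega), higher_word_of_lt _ (by omega), LinearMap.comp_apply,
        LinearMap.comp_apply, h _ (word_mem_fil hl)]
  have key : ∀ n ≤ j, ∀ t ∈ fil n, proj (E t) = proj (E' t) := by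
    intro n
    induction n with
    | zero =>
      intro _ t ht
      obtain ⟨c, rfl⟩ := eq_smul_one_of_mem_fil_zero ht
      rw [map_smul, map_smul E', hE.cohom.map_one, hE'.cohom.map_one]
    | succ n ih =>
      intro hn t ht
      have h1 := hE.cohom.eq_add_of_proj_eq hE'.cohom (ih (by omega)) ht
      have h2 : higher (proj ∘ₗ D) (E t) = higher (proj ∘ₗ D') (E' t) := by
        rw [hh _ (fil_mono hn (hE.cohom.mem_fil ht)), h1, map_add,
          higher_eq_zero _ (ι_mem_fil _), add_zero]
      rw [hE.proj_eq, hE'.proj_eq, h2]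
  exact hE.cohom.eq_add_of_proj_eq hE'.cohom (key j le_rfl) ht

theorem onShell_sub_eq_zero (hR : B.IsHodge R) (hD : B.IsAlg D) (hD' : B.IsAlg D') (hj : 1 ≤ j)
    (h : ∀ t ∈ fil j, D t = D' t) (hA : B.SameAmplitudes R D D') {t : TensorAlgebra ℂ H}
    (ht : t ∈ fil (j + 1)) (ht' : t ∈ tens (LinearMap.range (B.onShell R))) :
    B.onShell R ((proj ∘ₗ D' - proj ∘ₗ D) t) = 0 := by
  obtain ⟨E, hE⟩ := exists_isTree R D
  obtain ⟨E', hE'⟩ := exists_isTree R D'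
  have h0 : ∀ t ∈ fil j, (proj ∘ₗ D' - proj ∘ₗ D) t = 0 := fun t ht => by simp [h t ht]
  have h1 := hA E E' hE hE' t ht'
  have h2 : higher (proj ∘ₗ D') (E' t) = higher (proj ∘ₗ D') (E t) := by
    rw [hE.eq_add_of_eq hE' h ht, map_add, higher_eq_zero _ (ι_mem_fil _), add_zero]
  rw [hD.proj_eq, hD'.proj_eq, map_add, map_add, hR.P_Q, hR.P_Q, zero_add, zero_add, h2, eq_comm,
    ← sub_eq_zero, ← map_sub, ← LinearMap.sub_apply, ← higher_sub,
    higher_eq_self fun t ht => h0 t (fil_mono hj ht)] at h1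
  have h3 := h0 _ (hE.cohom.sub_mem_fil hE.proj_ι ht)
  rw [map_sub, sub_eq_zero] at h3
  rwa [h3] at h1

end Difference

/-! ### Invariance of the amplitudes -/

/-- A change of fields by terms in the image of the propagator keeps the tree amplitudes. -/
theorem onShell_proj_conj (hR : B.IsHodge R)
    {D F G E E' : TensorAlgebra ℂ H →ₗ[ℂ] TensorAlgebra ℂ H} (hD : B.IsAlg D) (hF : IsCohom F)
    (hGF : G ∘ₗ F = LinearMap.id)
    (hFR : ∀ t ∈ tens (LinearMap.ker R), proj (F t) - proj t ∈ LinearMap.range R)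
    (hD' : B.IsAlg (F ∘ₗ D ∘ₗ G)) (hE : IsTree R D E) (hE' : IsTree R (F ∘ₗ D ∘ₗ G) E')
    {t : TensorAlgebra ℂ H} (ht : t ∈ tens (LinearMap.range (B.onShell R))) :
    B.onShell R (proj ((F ∘ₗ D ∘ₗ G) (E' t))) = B.onShell R (proj (D (E t))) := by
  have hP : ∀ t ∈ tens (LinearMap.range (B.onShell R)), R (proj t) = 0 ∧ B.Q (proj t) = 0 := by
    intro t ht
    obtain ⟨y, hy⟩ := proj_mem_of_mem_tens ht
    rw [← hy, hR.R_P, hR.Q_P]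
    exact ⟨rfl, rfl⟩
  have hEK : ∀ t ∈ tens (LinearMap.range (B.onShell R)), E t ∈ tens (LinearMap.ker R) :=
    fun t ht => hE.cohom.mem_tens (fun t ht => by
      rw [LinearMap.mem_ker, hE.proj_eq, map_sub, (hP t ht).1, hR.R_R, sub_zero]) ht
  have hRD : ∀ t ∈ tens (LinearMap.range (B.onShell R)), R (proj (D (E t))) = 0 := by
    intro t ht
    rw [hD.proj_eq, hE.proj_eq, map_add, map_sub, map_sub, (hP t ht).2, hR.R_Q_R]
    simp
  have hDE : ∀ t ∈ tens (LinearMap.range (B.onShell R)), D (E t) ∈ tens (LinearMap.ker R) := by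
    intro t ht
    refine hD.coder.mem_tens (by simp) hE.cohom hEK (fun t ht => ?_) (fun t ht => hRD t ht) ht
    have h1 : proj (tmap B.sgn (E t)) = B.sgn (proj (E t)) :=
      LinearMap.congr_fun (proj_comp_tmap B.sgn) (E t)
    have h2 : R (proj (E t)) = 0 := proj_mem_of_mem_tens (hEK t ht)
    rw [h1, LinearMap.mem_ker, ← neg_eq_zero, ← hR.sgn_R, h2, map_zero]
  have hconj : ∀ s, (F ∘ₗ D ∘ₗ G) (F s) = F (D s) := by
    intro s
    have : G (F s) = s := LinearMap.congr_fun hGF s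
    rw [LinearMap.comp_apply, LinearMap.comp_apply, this]
  have hΨ : ∀ t ∈ tens (LinearMap.range (B.onShell R)), E' t = F (E t) := by
    intro t ht
    have h1 : ∀ t ∈ tens (LinearMap.range (B.onShell R)),
        proj ((treeInv R (F ∘ₗ D ∘ₗ G) ∘ₗ F ∘ₗ E) t) = proj (LinearMap.id (R := ℂ) t) := by
      intro t ht
      obtain ⟨v, hv⟩ := hFR _ (hEK t ht)
      obtain ⟨u, hu⟩ := hFR _ (hDE t ht)
      have h3 := congrArg R (hD'.proj_eq (F (E t)))
      rw [hconj, ← sub_add_cancel (proj (F (D (E t)))) (proj (D (E t))), ← hu, map_add, hR.R_R,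
        hRD t ht, map_add, ← sub_add_cancel (proj (F (E t))) (proj (E t)), ← hv, map_add, map_add,
        hR.R_Q_R, hE.proj_eq, map_sub, map_sub, (hP t ht).2, hR.R_Q_R, map_zero] at h3
      rw [LinearMap.comp_apply, LinearMap.comp_apply, proj_treeInv, LinearMap.id_apply,
        ← sub_add_cancel (proj (F (E t))) (proj (E t)), ← hv, hE.proj_eq]
      have h4 : R (higher (proj ∘ₗ F ∘ₗ D ∘ₗ G) (F (E t))) =
          -(R v + (0 - R (higher (proj ∘ₗ D) (E t)))) := by
        rw [eq_neg_iff_add_eq_zero, add_comm]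
        simpa using h3.symm
      rw [h4]
      abel
    have h2 := (((isCohom_treeInv R (F ∘ₗ D ∘ₗ G)).comp (hF.comp hE.cohom)).eq_on_tens isCohom_id
      h1 ht)
    have h5 := LinearMap.congr_fun hE'.comp_treeInv (F (E t))
    rw [LinearMap.comp_apply, LinearMap.comp_apply, LinearMap.id_apply] at h2
    rw [LinearMap.comp_apply, h2, LinearMap.id_apply] at h5
    exact h5
  obtain ⟨u, hu⟩ := hFR _ (hDE t ht)
  rw [hΨ t ht, hconj, ← sub_add_cancel (proj (F (D (E t)))) (proj (D (E t))), ← hu, map_add, hR.P_R,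
    zero_add]

end ConformalBackground

namespace ConformalBackground

variable {H : Type*} [AddCommGroup H] [Module ℂ H] {B : ConformalBackground H} {R : H →ₗ[ℂ] H}

/-! ### The exponential of a homotopy -/

section Exp

variable {j : ℕ} {φ : TensorAlgebra ℂ H →ₗ[ℂ] H}

/-- The even coderivation of the homotopy `φ R - R φ`. -/
def homotopyCoder (B : ConformalBackground H) (R : H →ₗ[ℂ] H) (φ : TensorAlgebra ℂ H →ₗ[ℂ] H) :
    TensorAlgebra ℂ H →ₗ[ℂ] TensorAlgebra ℂ H :=
  coder (tmap (B.scale 1)) (B.homotopy R φ)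

theorem homotopy_one (hφ : φ ∈ B.cochains j) : B.homotopy R φ 1 = 0 :=
  homotopy_eq_zero hφ (fil_mono (Nat.zero_le j) (by
    rw [← word_nil]; exact word_mem_fil (by simp)))

theorem isCoder_homotopyCoder (hφ : φ ∈ B.cochains j) :
    IsCoder LinearMap.id (B.homotopyCoder R φ) := by
  have := isCoder_coder (isCohom_tmap (B.scale 1)) (homotopy_one (R := R) hφ)
  rw [B.scale_one, tmap_id] at this
  rw [homotopyCoder, B.scale_one, tmap_id]
  exact this

theorem proj_homotopyCoder (hφ : φ ∈ B.cochains j) (t : TensorAlgebra ℂ H) :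
    proj (B.homotopyCoder R φ t) = B.homotopy R φ t :=
  LinearMap.congr_fun (proj_comp_coder (isCohom_tmap (B.scale 1)) (homotopy_one (R := R) hφ)) t

theorem homotopyCoder_apply (hφ : φ ∈ B.cochains j) {t : TensorAlgebra ℂ H}
    (ht : t ∈ fil (j + 1)) :
    B.homotopyCoder R φ t = TensorAlgebra.ι ℂ (B.homotopy R φ t) := by
  rw [← proj_homotopyCoder hφ]
  exact (isCoder_homotopyCoder hφ).apply_of_proj_eq_zero rfl
    (fun t ht => by rw [proj_homotopyCoder hφ, homotopy_eq_zero hφ ht]) ht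

theorem homotopyCoder_mem_fil (hj : 1 ≤ j) (hφ : φ ∈ B.cochains j) :
    ∀ n, ∀ t ∈ fil (n + 1), B.homotopyCoder R φ t ∈ fil n := fun _ _ ht =>
  (isCoder_homotopyCoder hφ).mem_fil_of_lower rfl
    (fun x => by rw [proj_homotopyCoder hφ, homotopy_eq_zero hφ (fil_mono hj (ι_mem_fil x))]) ht

theorem expMap_homotopy_apply (hj : 1 ≤ j) (hφ : φ ∈ B.cochains j) {t : TensorAlgebra ℂ H}
    (ht : t ∈ fil (j + 1)) :
    expMap (B.homotopyCoder R φ) t = t + TensorAlgebra.ι ℂ (B.homotopy R φ t) := by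
  rw [expMap_apply (isCoder_homotopyCoder hφ).map_one (homotopyCoder_mem_fil hj hφ) ht,
    Finset.sum_range_succ', Finset.sum_range_succ', Finset.sum_eq_zero]
  · simp [homotopyCoder_apply hφ ht, add_comm]
  · intro i _
    have h1 : B.homotopyCoder R φ (B.homotopyCoder R φ t) = 0 := by
      rw [homotopyCoder_apply hφ ht, homotopyCoder_apply hφ (fil_mono (by omega) (ι_mem_fil _)),
        homotopy_eq_zero hφ (fil_mono hj (ι_mem_fil _)), map_zero]
    rw [pow_succ, pow_succ, Module.End.mul_apply, Module.End.mul_apply, h1]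
    simp

theorem isSymp_expMap (hR : B.IsHodge R) (hj : 1 ≤ j) (hφ : φ ∈ B.cochains j) :
    B.IsSymp (expMap (B.homotopyCoder R φ)) where
  cohom := isCohom_expMap (isCoder_homotopyCoder hφ) (homotopyCoder_mem_fil hj hφ)
  deg z hz := by
    refine (expMap_comm (isCoder_homotopyCoder hφ).map_one (homotopyCoder_mem_fil hj hφ)
      (fun n t ht => tmap_mem_fil _ ht) ?_).symm
    have := coder_deg (homotopy_one (R := R) hφ) (homotopy_deg hR hφ) 1 hz
    rw [zpow_zero, one_smul] at this
    exact this.symm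
  symp := comp_expMap (isCoder_homotopyCoder hφ).map_one (homotopyCoder_mem_fil hj hφ)
    (form_of_cyc (homotopy_one hφ) (homotopy_cyc hR hφ))

theorem expMap_homotopy_sub_mem (hR : B.IsHodge R) (hj : 1 ≤ j) (hφ : φ ∈ B.cochains j)
    {t : TensorAlgebra ℂ H} (ht : t ∈ tens (LinearMap.ker R)) :
    proj (expMap (B.homotopyCoder R φ) t) - proj t ∈ LinearMap.range R := by
  have hX : ∀ s ∈ tens (LinearMap.ker R), B.homotopyCoder R φ s ∈ tens (LinearMap.ker R) := by
    intro s hs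
    refine (isCoder_homotopyCoder hφ).mem_tens (F := LinearMap.id) rfl isCohom_id
      (fun _ h => h) (fun _ h => proj_mem_of_mem_tens h) (fun u hu => ?_) hs
    rw [LinearMap.id_apply, proj_homotopyCoder hφ]
    obtain ⟨v, hv⟩ := homotopy_mem_range (B := B) (φ := φ) hu
    rw [LinearMap.mem_ker, ← hv, hR.R_R]
  have hXn : ∀ i, ((B.homotopyCoder R φ) ^ i) t ∈ tens (LinearMap.ker R) := by
    intro i
    induction i with
    | zero => exact ht
    | succ i ih => rw [pow_succ', Module.End.mul_apply]; exact hX _ ih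
  obtain ⟨n, hn⟩ := exists_mem_fil t
  rw [expMap_apply (isCoder_homotopyCoder hφ).map_one (homotopyCoder_mem_fil hj hφ) hn,
    Finset.sum_range_succ', map_add]
  simp only [Nat.factorial_zero, Nat.cast_one, inv_one, one_smul, pow_zero, Module.End.one_apply,
    add_sub_cancel_right, map_sum, map_smul]
  refine sum_mem fun i _ => Submodule.smul_mem _ _ ?_
  rw [pow_succ', Module.End.mul_apply, proj_homotopyCoder hφ]
  exact homotopy_mem_range (hXn i)

end Exp

/-! ### Construction of the isomorphism order by order -/

/-- The next order of the isomorphism between two algebras with the same amplitudes. -/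
theorem exists_next (hR : B.IsHodge R) {D D' : TensorAlgebra ℂ H →ₗ[ℂ] TensorAlgebra ℂ H}
    (hD : B.IsAlg D) (hD' : B.IsAlg D') {j : ℕ} (hj : 1 ≤ j) (h : ∀ t ∈ fil j, D t = D' t)
    (hA : B.SameAmplitudes R D D') :
    ∃ F D'' : TensorAlgebra ℂ H →ₗ[ℂ] TensorAlgebra ℂ H, B.IsSymp F ∧ (∀ t ∈ fil j, F t = t) ∧
      B.IsAlg D'' ∧ D'' ∘ₗ F = F ∘ₗ D ∧ (∀ t ∈ fil (j + 1), D'' t = D' t) ∧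
      B.SameAmplitudes R D'' D' := by
  set δ := proj ∘ₗ D' - proj ∘ₗ D with hδ
  have hδc : δ ∈ B.cochains j := sub_mem_cochains hD hD' h
  set φ := kerProjInv (laplace (B.onShell R)) (j + 1 + 1) δ with hφ'
  have hφ : φ ∈ B.cochains j := kerProjInv_mem (fun _ => laplace_mem_cochains hR) _ hδc
  have hLφ : ∀ t ∈ fil (j + 1), laplace (B.onShell R) φ t = δ t := by
    intro t ht
    rw [hφ', apply_kerProjInv, LinearMap.sub_apply, kerProj_laplace hR.P_P
      (fun t ht ht' => onShell_sub_eq_zero hR hD hD' hj h hA ht ht') ht, sub_zero]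
  set F := expMap (B.homotopyCoder R φ) with hF'
  have hF : B.IsSymp F := isSymp_expMap hR hj hφ
  have hFj : ∀ t ∈ fil j, F t = t := by
    intro t ht
    rw [hF', expMap_homotopy_apply hj hφ (fil_mono (Nat.le_succ j) ht), homotopy_eq_zero hφ ht,
      map_zero, add_zero]
  have hFι : ∀ x, F (TensorAlgebra.ι ℂ x) = TensorAlgebra.ι ℂ x :=
    fun x => hFj _ (fil_mono hj (ι_mem_fil x))
  obtain ⟨G, hFG, hGF⟩ := hF.cohom.exists_inverse (fun x => by rw [hFι, proj_ι])
  have hGι : ∀ x, G (TensorAlgebra.ι ℂ x) = TensorAlgebra.ι ℂ x := by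
    intro x
    have := LinearMap.congr_fun hGF (TensorAlgebra.ι ℂ x)
    rwa [LinearMap.comp_apply, hFι, LinearMap.id_apply] at this
  have hD'' : B.IsAlg (F ∘ₗ D ∘ₗ G) :=
    hD.conj hF hFG hGF fun x => by rw [hGι, hD.linear, hFι]
  have hint : (F ∘ₗ D ∘ₗ G) ∘ₗ F = F ∘ₗ D := by
    rw [LinearMap.comp_assoc, LinearMap.comp_assoc, hGF, LinearMap.comp_id]
  refine ⟨F, F ∘ₗ D ∘ₗ G, hF, hFj, hD'', hint, fun t ht => ?_, ?_⟩
  · have h1 := LinearMap.congr_fun hint t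
    have hDt := hD.coder.mem_fil (by simp) ht
    have h2 : B.homotopy R φ (D t) = B.homotopy R φ (lcoder B.sgn B.Q t) := by
      rw [← sub_eq_zero, ← map_sub]
      exact homotopy_eq_zero hφ (hD.sub_lcoder_mem_fil ht)
    rw [LinearMap.comp_apply, LinearMap.comp_apply F D, hF', expMap_homotopy_apply hj hφ ht,
      expMap_homotopy_apply hj hφ hDt, ← hF', map_add, hD''.linear, h2, ← eq_sub_iff_add_eq,
      add_sub_assoc, ← map_sub, homotopy_closed hR hφ ht, hLφ t ht] at h1
    rw [h1, hD.eq_add_of_eq hD' h ht]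
  · intro E E' hE hE' t ht
    obtain ⟨E₀, hE₀⟩ := exists_isTree R D
    rw [onShell_proj_conj hR hD hF.cohom hGF
      (fun t ht => expMap_homotopy_sub_mem hR hj hφ ht) hD'' hE₀ hE ht]
    exact hA E₀ E' hE₀ hE' t ht

/-- An isomorphism from `D` to an algebra which agrees with `D'` up to order `j`. -/
structure PartialIso (B : ConformalBackground H) (R : H →ₗ[ℂ] H)
    (D D' : TensorAlgebra ℂ H →ₗ[ℂ] TensorAlgebra ℂ H) (j : ℕ) where
  /-- the isomorphism -/
  map : TensorAlgebra ℂ H →ₗ[ℂ] TensorAlgebra ℂ H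
  /-- the target algebra -/
  target : TensorAlgebra ℂ H →ₗ[ℂ] TensorAlgebra ℂ H
  symp : B.IsSymp map
  isAlg : B.IsAlg target
  comm : target ∘ₗ map = map ∘ₗ D
  eq_target : ∀ t ∈ fil j, target t = D' t
  amplitudes : B.SameAmplitudes R target D'

theorem PartialIso.exists_next (hR : B.IsHodge R)
    {D D' : TensorAlgebra ℂ H →ₗ[ℂ] TensorAlgebra ℂ H} (hD' : B.IsAlg D') {j : ℕ} (hj : 1 ≤ j)
    (I : PartialIso B R D D' j) :
    ∃ I' : PartialIso B R D D' (j + 1), ∀ t ∈ fil j, I'.map t = I.map t := by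
  obtain ⟨F, D'', hF, hFj, hD'', hint, heq, hA⟩ :=
    ConformalBackground.exists_next hR I.isAlg hD' hj I.eq_target I.amplitudes
  refine ⟨⟨F ∘ₗ I.map, D'', hF.comp I.symp, hD'', ?_, heq, hA⟩,
    fun t ht => hFj _ (I.symp.cohom.mem_fil ht)⟩
  rw [← LinearMap.comp_assoc, hint, LinearMap.comp_assoc, I.comm, LinearMap.comp_assoc]

/-- Two algebras with the same amplitudes are isomorphic by a map with linear part the identity. -/
theorem exists_iso (hR : B.IsHodge R) {D D' : TensorAlgebra ℂ H →ₗ[ℂ] TensorAlgebra ℂ H}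
    (hD : B.IsAlg D) (hD' : B.IsAlg D') (hA : B.SameAmplitudes R D D') :
    ∃ F : TensorAlgebra ℂ H →ₗ[ℂ] TensorAlgebra ℂ H, B.IsSymp F ∧ D' ∘ₗ F = F ∘ₗ D ∧
      ∀ x, F (TensorAlgebra.ι ℂ x) = TensorAlgebra.ι ℂ x := by
  have h1 : ∀ t ∈ fil 1, D t = D' t := by
    intro t ht
    refine eq_on_fil (fun l hl => ?_) ht
    rcases l with _ | ⟨x, _ | ⟨y, l⟩⟩
    · rw [word_nil, hD.coder.map_one, hD'.coder.map_one]
    · rw [word_singleton, hD.linear, hD'.linear]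
    · simp at hl
  let I₀ : PartialIso B R D D' 1 :=
    ⟨LinearMap.id, D, ⟨isCohom_id, fun z _ => by simp, by simp⟩, hD, by simp, h1, hA⟩
  choose next hnext using fun (j : ℕ) (I : PartialIso B R D D' (j + 1)) =>
    I.exists_next hR hD' (Nat.le_add_left 1 j)
  let I : (j : ℕ) → PartialIso B R D D' (j + 1) := fun j => Nat.rec I₀ (fun j I => next j I) j
  have hI : ∀ j, ∀ t ∈ fil (j + 1), (I (j + 1)).map t = (I j).map t :=
    fun j t ht => hnext j (I j) t ht
  have hI' : ∀ i j, ∀ t ∈ fil (j + 1), (I (j + i)).map t = (I j).map t := by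
    intro i j t ht
    induction i with
    | zero => rfl
    | succ i ih => rw [← ih]; exact hI (j + i) t (fil_mono (by omega) ht)
  set f := glue (fun n => proj ∘ₗ (I n).map) with hf
  have hf1 : f 1 = 0 := by
    rw [← word_nil, hf, glue_word, word_nil, LinearMap.comp_apply, (I _).symp.cohom.map_one, proj_one]
  have hF := isCohom_cohom hf1
  set F := cohom f with hF'
  have hFI : ∀ n, ∀ t ∈ fil n, F t = (I n).map t := by
    intro n t ht
    refine hF.eq_of_proj_eq (I n).symp.cohom (fun t ht => ?_) ht
    have h2 : proj (F t) = f t := LinearMap.congr_fun (proj_comp_cohom hf1) t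
    rw [h2]
    refine eq_on_fil (ψ := proj ∘ₗ (I n).map) (fun l hl => ?_) ht
    obtain ⟨i, rfl⟩ := Nat.exists_eq_add_of_le hl
    rw [hf, glue_word, LinearMap.comp_apply, LinearMap.comp_apply,
      hI' i l.length _ (word_mem_fil (by omega))]
  refine ⟨F, ⟨hF, fun z hz => ?_, ?_⟩, ?_, fun x => ?_⟩
  · refine ext_word fun l => ?_
    have hl : word l ∈ fil l.length := word_mem_fil le_rfl
    rw [LinearMap.comp_apply, LinearMap.comp_apply, hFI _ _ hl, hFI _ _ (tmap_mem_fil _ hl)]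
    exact LinearMap.congr_fun ((I l.length).symp.deg z hz) (word l)
  · refine ext_word fun l => ?_
    rw [LinearMap.comp_apply, hFI _ _ (word_mem_fil le_rfl)]
    exact LinearMap.congr_fun (I l.length).symp.symp (word l)
  · refine ext_word fun l => ?_
    have hl : word l ∈ fil l.length := word_mem_fil le_rfl
    rw [LinearMap.comp_apply, LinearMap.comp_apply, hFI _ _ hl,
      hFI _ _ (hD.coder.mem_fil (by simp) hl),
      ← (I l.length).eq_target _ (fil_mono (Nat.le_succ _) ((I l.length).symp.cohom.mem_fil hl))]
    exact LinearMap.congr_fun (I l.length).comm (word l)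
  · rw [hFI 1 _ (ι_mem_fil x)]
    exact hI 0 _ (ι_mem_fil x)

end ConformalBackground

namespace ConformalBackground

variable {H : Type*} [AddCommGroup H] [Module ℂ H] {B : ConformalBackground H} {R R' : H →ₗ[ℂ] H}

/-! ### Comparison of the amplitudes -/

theorem IsTree.unique {D E E' : TensorAlgebra ℂ H →ₗ[ℂ] TensorAlgebra ℂ H}
    (hE : IsTree R D E) (hE' : IsTree R D E') : E = E' := by
  obtain ⟨G, hG, -⟩ := exists_treeInv_inverse R D
  rw [← LinearMap.comp_id E, ← LinearMap.comp_id E', ← hG, ← LinearMap.comp_assoc,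
    ← LinearMap.comp_assoc, hE.comp_treeInv, hE'.comp_treeInv]

theorem AmplitudesEq.eq (hR : B.IsHodge R)
    {A : (n : ℕ) → MultilinearMap ℂ (fun _ : Fin n => B.Cohomology) ℂ} {n : MultiOps H}
    (h0 : n 0 = 0) (hD : B.IsAlg (B.opCoder n)) (hA : B.AmplitudesEq A n R)
    {E : TensorAlgebra ℂ H →ₗ[ℂ] TensorAlgebra ℂ H} (hE : IsTree R (B.opCoder n) E)
    {k : ℕ} (hk : 2 ≤ k) (x : Fin (k + 1) → LinearMap.ker B.Q)
    (hx : ∀ i, B.onShell R (x i) = x i) {d : ℤ} (hd : (x 0 : H) ∈ B.deg d) :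
    (-1 : ℂ) ^ d * B.ω (x 0) (proj (B.opCoder n (E (word (List.ofFn fun i => (x i.succ : H)))))) =
      A (k + 1) (fun i => Submodule.Quotient.mk (x i)) := by
  have he1 : (proj ∘ₗ E) 1 = 0 := by simp [hE.cohom.map_one]
  have hcE : cohom (proj ∘ₗ E) = E :=
    (isCohom_cohom he1).ext hE.cohom (proj_comp_cohom he1)
  have h1 := sum_treeValue n R he1 (fun t => by
    have := hE.proj_eq t
    rw [proj_opCoder h0] at this
    rw [hcE, LinearMap.comp_apply, this]) (show k ≠ 1 by omega) (fun i => (x i.succ : H))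
  have h2 := hA k hk x hx d hd
  rw [h1, hcE] at h2
  rw [hD.proj_eq, proj_opCoder h0, map_add, ← h2]
  have h3 : ∀ y, B.ω (x 0) (B.Q y) = 0 := by
    intro y
    rw [← hx 0, hR.P_symm, hR.P_Q, map_zero]
  rw [h3, zero_add]

/-- The transported algebra has the same amplitudes with respect to the transported propagator. -/
theorem sameAmplitudes_transfer (hR : B.IsHodge R) (hR' : B.IsHodge R')
    {A : (n : ℕ) → MultilinearMap ℂ (fun _ : Fin n => B.Cohomology) ℂ} {n n' : MultiOps H}
    (h0 : n 0 = 0) (h0' : n' 0 = 0) (hD : B.IsAlg (B.opCoder n)) (hD' : B.IsAlg (B.opCoder n'))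
    (hA : B.AmplitudesEq A n R) (hA' : B.AmplitudesEq A n' R')
    (hDg : B.IsAlg (tmap (IsHodge.transfer B R R') ∘ₗ B.opCoder n ∘ₗ
      tmap (IsHodge.transfer B R' R))) :
    B.SameAmplitudes R' (tmap (IsHodge.transfer B R R') ∘ₗ B.opCoder n ∘ₗ
      tmap (IsHodge.transfer B R' R)) (B.opCoder n') := by
  intro Eg E' hEg hE' t ht
  obtain ⟨E, hE⟩ := exists_isTree R (B.opCoder n)
  set g := IsHodge.transfer B R R' with hg
  set g' := IsHodge.transfer B R' R with hg'
  have hgg : ∀ x, g (g' x) = x := IsHodge.transfer_transfer hR hR'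
  have hgg' : ∀ x, g' (g x) = x := IsHodge.transfer_transfer hR' hR
  have hEt := hE.transport (R' := R') (g := g) (g' := g') (LinearMap.ext hgg)
    (LinearMap.ext hgg') (IsHodge.transfer_R hR hR')
  obtain rfl := hEg.unique hEt
  rw [← sub_eq_zero, ← map_sub]
  set D := B.opCoder n with hDdef
  set D' := B.opCoder n' with hDdef'
  suffices h : (B.onShell R' ∘ₗ (proj ∘ₗ (tmap g ∘ₗ D ∘ₗ tmap g') ∘ₗ (tmap g ∘ₗ E ∘ₗ tmap g') -
      proj ∘ₗ D' ∘ₗ E')) t ∈ (⊥ : Submodule ℂ H) from h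
  refine tens_le_comap (fun l hl => ?_) ht
  rw [Submodule.mem_bot]
  simp only [LinearMap.comp_apply, LinearMap.sub_apply]
  by_cases hl1 : l.length ≤ 1
  · have hlow : ∀ {D E : TensorAlgebra ℂ H →ₗ[ℂ] TensorAlgebra ℂ H}, B.IsAlg D → IsTree R' D E →
        B.onShell R' (proj (D (E (word l)))) = 0 := by
      intro D E hD hE
      rw [hD.proj_eq, higher_eq_zero _ (hE.cohom.mem_fil (word_mem_fil hl1)), add_zero, hR'.P_Q]
    have e1 := hlow hDg hEt
    have e2 := hlow hD' hE'
    simp only [LinearMap.comp_apply] at e1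
    rw [map_sub, e1, e2, sub_zero]
  · push Not at hl1
    have hlP : ∀ i : Fin l.length, B.onShell R' l[i] = l[i] := by
      intro i
      obtain ⟨y, hy⟩ := hl l[i] (List.getElem_mem _)
      rw [← hy, hR'.P_P]
    have hlQ : ∀ i : Fin l.length, B.Q l[i] = 0 := fun i => by rw [← hlP, hR'.Q_P]
    refine B.eq_zero_of_ω fun y => ?_
    rw [← hR'.P_symm]
    have key : (B.ω.flip (proj (tmap g (D (tmap g' (tmap g (E (tmap g' (word l)))))) ) -
        proj (D' (E' (word l))))) ∘ₗ B.onShell R' = 0 := by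
      refine B.ext_deg fun d y hy => ?_
      rw [LinearMap.comp_apply, LinearMap.flip_apply, LinearMap.zero_apply]
      set x₀ := B.onShell R' y with hx₀
      have hx₀d : x₀ ∈ B.deg d := by
        refine B.mem_deg_of_scale ?_
        rw [hx₀, hR'.scale_P two_ne_zero, B.scale_of_mem _ hy, map_smul]
      have hPd : ∀ {x}, x ∈ B.deg d → B.onShell R x ∈ B.deg d := by
        intro x hx
        refine B.mem_deg_of_scale ?_
        rw [hR.scale_P two_ne_zero, B.scale_of_mem _ hx, map_smul]
      let x' : Fin (l.length + 1) → LinearMap.ker B.Q :=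
        Fin.cons ⟨x₀, hR'.Q_P y⟩ fun i => ⟨l[i], hlQ i⟩
      have hx' : ∀ i, B.onShell R' (x' i) = x' i := by
        intro i
        refine Fin.cases ?_ (fun i => ?_) i
        · exact hR'.P_P y
        · exact hlP i
      let x : Fin (l.length + 1) → LinearMap.ker B.Q := fun i => ⟨B.onShell R (x' i), hR.Q_P _⟩
      have hxg : ∀ i, (x i : H) = g' (x' i) := by
        intro i
        change B.onShell R (x' i) = _
        rw [← hx' i, hg', IsHodge.transfer_P hR']
      have hcl : (fun i => Submodule.Quotient.mk (x i) : Fin (l.length + 1) → B.Cohomology) =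
          fun i => Submodule.Quotient.mk (x' i) := by
        funext i
        rw [Submodule.Quotient.eq]
        refine ⟨-R (x' i), ?_⟩
        have h1 : B.Q (x' i : H) = 0 := (x' i).2
        change _ = B.onShell R (x' i) - (x' i : H)
        rw [IsHodge.onShell_apply, h1, map_neg, map_zero]
        abel
      have a1 := hA.eq hR h0 hD hE hl1 x (fun i => hR.P_P _) (d := d) (hPd hx₀d)
      have a2 := hA'.eq hR' h0' hD' hE' hl1 x' hx' (d := d) hx₀d
      rw [hcl, ← a2] at a1
      have a3 := mul_left_cancel₀ (zpow_ne_zero d (by norm_num : (-1 : ℂ) ≠ 0)) a1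
      have w1 : (List.ofFn fun i : Fin l.length => (x' i.succ : H)) = l := List.ofFn_getElem
      have w2 : word (List.ofFn fun i : Fin l.length => (x i.succ : H)) = tmap g' (word l) := by
        rw [tmap_word]
        congr 1
        conv_rhs => rw [← w1]
        rw [List.map_ofFn]
        congr 1
        funext i
        exact hxg i.succ
      have hp : ∀ s, proj (tmap g s) = g (proj s) := LinearMap.congr_fun (proj_comp_tmap g)
      have ht : ∀ s, tmap g' (tmap g s) = s := by
        intro s
        have : tmap g' ∘ₗ tmap g = LinearMap.id := by
          rw [← tmap_comp, LinearMap.ext (f := g' ∘ₗ g) (g := LinearMap.id) hgg', tmap_id]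
        exact LinearMap.congr_fun this s
      have hx0 : x₀ = g (x 0) := by rw [hxg 0, hgg]; rfl
      rw [w1, w2] at a3
      rw [map_sub, sub_eq_zero, ht, hp]
      nth_rw 1 [hx0]
      rw [hg, IsHodge.transfer_symp hR hR']
      exact a3
    exact LinearMap.congr_fun key y

/-! ### The main theorem -/

theorem IsClassicalOpenSFT.isCyclicAInfinity
    {A : (n : ℕ) → MultilinearMap ℂ (fun _ : Fin n => B.Cohomology) ℂ} {m : MultiOps H}
    (hm : B.IsClassicalOpenSFT A m) : B.IsCyclicAInfinity m where
  zero := hm.action.zero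
  degree := hm.action.degree
  relation := insertSum_eq_zero hm.action.degree hm.action.cyclic hm.master
  cyclic := hm.action.cyclic

theorem IsClassicalOpenSFT.cyclicIsomorphic
    {A : (n : ℕ) → MultilinearMap ℂ (fun _ : Fin n => B.Cohomology) ℂ} {m m' : MultiOps H}
    (hm : B.IsClassicalOpenSFT A m) (hm' : B.IsClassicalOpenSFT A m') :
    B.CyclicIsomorphic m m' := by
  refine ⟨hm.isCyclicAInfinity, hm'.isCyclicAInfinity, ?_⟩
  have hDm := isAlg_of_master hm.action hm.master
  have hDm' := isAlg_of_master hm'.action hm'.master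
  obtain ⟨p, hp, hpr, R, hRp, n, f, hf, hA⟩ := hm.proper_and_amplitudes
  obtain ⟨p', hp', hpr', R', hRp', n', f', hf', hA'⟩ := hm'.proper_and_amplitudes
  have hR := isHodge_of_isPropagator hm.action hp hpr hRp
  have hR' := isHodge_of_isPropagator hm'.action hp' hpr' hRp'
  have hD := hf.isAlg hm.action.zero hDm
  have hD' := hf'.isAlg hm'.action.zero hDm'
  set g := IsHodge.transfer B R R' with hg
  set g' := IsHodge.transfer B R' R with hg'
  have hgg : ∀ x, g (g' x) = x := IsHodge.transfer_transfer hR hR'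
  have hgg' : ∀ x, g' (g x) = x := IsHodge.transfer_transfer hR' hR
  have hgs : B.IsSymp (tmap g) :=
    isSymp_tmap (IsHodge.transfer_symp hR hR') fun z hz => IsHodge.scale_transfer hR hR' hz
  have t1 : tmap g ∘ₗ tmap g' = LinearMap.id := by
    rw [← tmap_comp, LinearMap.ext (f := g ∘ₗ g') (g := LinearMap.id) hgg, tmap_id]
  have t2 : tmap g' ∘ₗ tmap g = LinearMap.id := by
    rw [← tmap_comp, LinearMap.ext (f := g' ∘ₗ g) (g := LinearMap.id) hgg', tmap_id]
  have hDg : B.IsAlg (tmap g ∘ₗ B.opCoder n ∘ₗ tmap g') :=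
    hD.conj hgs t1 t2 fun x => by
      rw [tmap_ι, hD.linear, tmap_ι, hg, IsHodge.transfer_Q hR, hg', IsHodge.Q_transfer hR]
  obtain ⟨F, hF, hFD, hFι⟩ := exists_iso hR' hDg hD' (sameAmplitudes_transfer hR hR'
    hf.action.zero hf'.action.zero hD hD' hA hA' hDg)
  have hs := isSymp_of_morphism hf.morphism
  have hs' := isSymp_of_morphism hf'.morphism
  obtain ⟨G, hFG, hGF⟩ := hs.cohom.exists_inverse hf.proj_cohom
  have hG := hs.of_inverse hFG hGF
  have i1 := intertwine_of_morphism hf.action.zero hm.action.zero hf.morphism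
  have i2 := intertwine_of_morphism hf'.action.zero hm'.action.zero hf'.morphism
  have hGD : B.opCoder n ∘ₗ G = G ∘ₗ B.opCoder m := by
    rw [← LinearMap.id_comp (B.opCoder n ∘ₗ G), ← hGF, LinearMap.comp_assoc,
      ← LinearMap.comp_assoc G, ← i1, LinearMap.comp_assoc, hFG, LinearMap.comp_id]
  have hgD : (tmap g ∘ₗ B.opCoder n ∘ₗ tmap g') ∘ₗ tmap g = tmap g ∘ₗ B.opCoder n := by
    rw [LinearMap.comp_assoc, LinearMap.comp_assoc, t2, LinearMap.comp_id]
  have hcomm : B.opCoder m' ∘ₗ (cohom f'.lin ∘ₗ F ∘ₗ tmap g ∘ₗ G) =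
      (cohom f'.lin ∘ₗ F ∘ₗ tmap g ∘ₗ G) ∘ₗ B.opCoder m := by
    rw [← LinearMap.comp_assoc, i2, LinearMap.comp_assoc, ← LinearMap.comp_assoc _ F, hFD,
      LinearMap.comp_assoc, ← LinearMap.comp_assoc G, hgD, LinearMap.comp_assoc, hGD]
    simp only [LinearMap.comp_assoc]
  have hΦ := hs'.comp (hF.comp (hgs.comp hG))
  refine ⟨_, isCyclicMorphism_of hm.action.zero hm'.action.zero hΦ hcomm, ?_⟩
  have hGι : ∀ x, G (TensorAlgebra.ι ℂ x) = TensorAlgebra.ι ℂ x := by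
    intro x
    have h1 := LinearMap.congr_fun hGF (TensorAlgebra.ι ℂ x)
    rwa [LinearMap.comp_apply, hs.cohom.map_ι, hf.proj_cohom, LinearMap.id_apply] at h1
  have hlin : (fun x : H => (toOps (proj ∘ₗ cohom f'.lin ∘ₗ F ∘ₗ tmap g ∘ₗ G)).on [x]) = g := by
    funext x
    rw [toOps_on, word_singleton]
    simp only [LinearMap.comp_apply]
    rw [hGι, tmap_ι, hFι, hf'.proj_cohom]
  rw [hlin]
  exact ⟨Function.LeftInverse.injective hgg', Function.RightInverse.surjective hgg⟩

end ConformalBackground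

end

/-- Any two classical open string field theories on the same conformal background (with the same
tree on-shell open string amplitudes) are cyclic `A∞`-isomorphic. -/
theorem theorem5p6 {H : Type*} [AddCommGroup H] [Module ℂ H] (B : ConformalBackground H)
    (A : (n : ℕ) → MultilinearMap ℂ (fun _ : Fin n => B.Cohomology) ℂ)
    (m m' : MultiOps H)
    (hm : B.IsClassicalOpenSFT A m) (hm' : B.IsClassicalOpenSFT A m') :
    B.CyclicIsomorphic m m' :=
  hm.cyclicIsomorphic hm'
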